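/- **Theorem (flag curvature of $F^v$, Berwald case).** Let $G$ be a (finite-dimensional, real) Lie group with Lie algebra $\mathfrak g$ of left invariant vector fields, $g$ a left invariant Riemannian metric on $G$ with norm $\|\cdot\|$ and Levi-Civita connection $\nabla$, and $X\in\mathfrak g$. Let $\phi:(-b_0,b_0)\to(0,\infty)$ be smooth with $$\phi(s)-s\phi'(s)+(b^2-s^2)\phi''(s)>0\qquad\text{for all } |s|\le b<b_0,$$ and suppose $\|X\|<b_0$, so that $F=\sqrt{g(y,y)}\;\phi\!\left(\frac{g(X,y)}{\sqrt{g(y,y)}}\right)$ is a left invariant $(\alpha,\beta)$-metric on $G$. For a vector field $A=\xi^i\frac{\partial}{\partial x^i}$ on $G$ let $A^v=\xi^i\frac{\partial}{\partial y^i}$ and $A^c=\xi^i\frac{\partial}{\partial x^i}+y^j\frac{\partial\xi^i}{\partial x^j}\frac{\partial}{\partial y^i}$ be its vertical and complete lifts to $TG$; let $\tilde g$ be the Riemannian metric on $TG$ determined by $\tilde g(A^c,B^c)=\tilde g(A^v,B^v)=g(A,B)$, $\tilde g(A^c,B^v)=0$ for $A,B\in\mathfrak g$; and let $$F^v(\tilde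 z)=\sqrt{\tilde g(\tilde z,\tilde z)}\;\phi\!\left(\frac{\tilde g(X^v,\tilde z)}{\sqrt{\tilde g(\tilde z,\tilde z)}}\right),\qquad \tilde z\in T(TG).$$ Assume that $F^v$ is of Berwald type, i.e. in local coordinates its spray coefficients have the form $G^i=\frac12\Gamma^i_{jk}(x)y^jy^k$. In the degenerate case that there are constants $a$ and $c\neq0$ with $\phi(s)^2=a+cs^2$ for all $|s|\le\|X\|$ (then $F^v$ is a Riemannian metric, hence trivially of Berwald type), assume in addition that $X^v$ is parallel with respect to the Levi-Civita connection of $\tilde g$. Let $Y,V\in\mathfrak g$ be orthonormal with respect to $g$. Denote by $K(V,Y)$ the sectional curvature of $g$ of the plane spanned by $V$ and $Y$, by $\mathrm{ad}^*_A$ the $g$-adjoint of $\mathrm{ad}_A$, that is $g(\mathrm{ad}^*_AB,C)=g(B,[A,C])$, put $D(s)=\frac{\phi''(s)}{\phi(s)-s\phi'(s)}$, and let $K^{F^v}(\tilde P,y)$ be the flag curvature of $F^v$ for the flag $\tilde P$ with flagpole $y$. Then at every point of $TG$: 1. for $\tilde P=\mathrm{span}\{Y^c,V^c\}$: $$K^{F^v}(\tilde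 P,Y^c)=\frac{1}{\phi^2(0)}K(V,Y);$$ 2. for $\tilde P=\mathrm{span}\{Y^c,V^v\}$: $$K^{F^v}(\tilde P,Y^c)=\frac{1}{\phi^2(0)\,[1+g(X,V)^2D(0)]}\Big\{K(V,Y)+\tfrac12g([V,\nabla_YV],Y)-\tfrac12g(\nabla_V\mathrm{ad}^*_VY,Y)+\tfrac14g([V,\mathrm{ad}^*_VY],Y)+\tfrac12g([[Y,V],V],Y)\Big\};$$ 3. for $\tilde P=\mathrm{span}\{Y^v,V^c\}$: $$K^{F^v}(\tilde P,Y^v)=\frac{1}{\phi^2(g(X,Y))}\Big\{K(V,Y)+\tfrac12g([Y,\nabla_VY],V)-\tfrac12g(\nabla_Y\mathrm{ad}^*_YV,V)+\tfrac14g([Y,\mathrm{ad}^*_YV],V)+\tfrac12g([[V,Y],Y],V)\Big\};$$ 4. for $\tilde P=\mathrm{span}\{Y^v,V^v\}$: $$K^{F^v}(\tilde P,Y^v)=\frac{1}{\phi^2(g(X,Y))\,[1+g(X,V)^2D(g(X,Y))]}\Big\{K(V,Y)+g(\nabla_{[V,Y]}Y,V)+\tfrac14\|[V,Y]\|^2\Big\}.$$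 -/

import Mathlib

open Set Bundle VectorField
open scoped Manifold ContDiff Topology

set_option linter.unusedSectionVars false

noncomputable section

namespace LieFinsler

/-! ### Finsler geometry in a coordinate domain of a normed space `W`

A function `F : W → W → ℝ` is read as `F x y`, with `x` the position and `y` the velocity. -/

section Local

variable {W : Type*} [NormedAddCommGroup W] [NormedSpace ℝ W]
  {V : Type*} [NormedAddCommGroup V] [NormedSpace ℝ V]

/-- The fundamental tensor `g_y(u,v) = ½ ∂²/∂s∂t F²(y + su + tv)` at `s = t = 0`. -/
def fundTensor (F : W → W → ℝ) (x y : W) : W →L[ℝ] W →L[ℝ] ℝ :=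
  (1 / 2 : ℝ) • fderiv ℝ (fderiv ℝ (fun z => F x z ^ 2)) y

/-- Spray coefficients `G^i = ¼ g^{il} ([F²]_{x^m y^l} y^m - [F²]_{x^l})`. Here
`(fundTensor F x y).inverse` raises the index of a covector. -/
def spray (F : W → W → ℝ) (x y : W) : W :=
  (1 / 4 : ℝ) • (fundTensor F x y).inverse
    (fderiv ℝ (fun x' => fderiv ℝ (fun z => F x' z ^ 2) y) x y - fderiv ℝ (fun x' => F x' y ^ 2) x)

/-- The nonlinear connection `N^i_j = ∂G^i/∂y^j`. -/
def nonlinConn (F : W → W → ℝ) (x y : W) : W →L[ℝ] W :=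
  fderiv ℝ (spray F x) y

/-- The horizontal derivative `δ/δx^j = ∂/∂x^j - N^i_j ∂/∂y^i` of a function of `(x, y)`. -/
def horDeriv (F : W → W → ℝ) (h : W → W → V) (x y : W) : W →L[ℝ] V :=
  fderiv ℝ (fun x' => h x' y) x - (fderiv ℝ (h x) y).comp (nonlinConn F x y)

/-- The coefficients of the Chern connection,
`Γ^i_{jk} = ½ g^{il} (δg_{lj}/δx^k + δg_{lk}/δx^j - δg_{jk}/δx^l)`, applied to `u, v`. -/
def chern (F : W → W → ℝ) (x y u v : W) : W :=
  (1 / 2 : ℝ) • (fundTensor F x y).inverse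
    (horDeriv F (fundTensor F) x y u v + horDeriv F (fundTensor F) x y v u
      - ((horDeriv F (fundTensor F) x y).flip u).flip v)

/-- The (horizontal) curvature `R(u,v)w = ∇_u ∇_v w - ∇_v ∇_u w - ∇_{[u,v]} w` of the Chern
connection:
`R_j^i_{kl} = δΓ^i_{jl}/δx^k - δΓ^i_{jk}/δx^l + Γ^i_{hk} Γ^h_{jl} - Γ^i_{hl} Γ^h_{jk}`. -/
def chernCurv (F : W → W → ℝ) (x y u v w : W) : W :=
  horDeriv F (fun x' y' => chern F x' y' v w) x y u
    - horDeriv F (fun x' y' => chern F x' y' u w) x y v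
    + chern F x y u (chern F x y v w) - chern F x y v (chern F x y u w)

/-- The flag curvature of the flag `span {u, y}` with flagpole `y`:
`g_y(R(u,y)y, u) / (g_y(y,y) g_y(u,u) - g_y(u,y)²)`. -/
def flagCurvatureLocal (F : W → W → ℝ) (x y u : W) : ℝ :=
  fundTensor F x y (chernCurv F x y u y y) u /
    (fundTensor F x y y y * fundTensor F x y u u - fundTensor F x y u y ^ 2)

/-- Christoffel symbols (Levi-Civita connection) of a Riemannian metric `h`. -/
def christoffel (h : W → W →L[ℝ] W →L[ℝ] ℝ) (x u v : W) : W :=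
  (1 / 2 : ℝ) • (h x).inverse
    (fderiv ℝ h x u v + fderiv ℝ h x v u - ((fderiv ℝ h x).flip u).flip v)

/-- The Riemann curvature `R(u,v)w = ∇_u ∇_v w - ∇_v ∇_u w - ∇_{[u,v]} w` of `h`. -/
def riemannCurv (h : W → W →L[ℝ] W →L[ℝ] ℝ) (x u v w : W) : W :=
  fderiv ℝ (fun x' => christoffel h x' v w) x u - fderiv ℝ (fun x' => christoffel h x' u w) x v
    + christoffel h x u (christoffel h x v w) - christoffel h x v (christoffel h x u w)

end Local

/-! ### Finsler and Riemannian geometry on a manifold, through its charts -/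

section Manifold

variable {W : Type*} [NormedAddCommGroup W] [NormedSpace ℝ W]
  {H : Type*} [TopologicalSpace H] (I : ModelWithCorners ℝ W H)
  {M : Type*} [TopologicalSpace M] [ChartedSpace H M]

/-- The tangent vector at the point with coordinates `x` in the chart at `p`, as a function of the
components of that vector in the coordinate frame. -/
def coordFrame (p : M) (x : W) : W →L[ℝ] TangentSpace I ((extChartAt I p).symm x) :=
  mfderivWithin 𝓘(ℝ, W) I (extChartAt I p).symm (range I) x

/-- The components of a tangent vector at `p` in the coordinate frame of the chart at `p`. -/
def components (p : M) : TangentSpace I p →L[ℝ] W :=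
  mfderiv I 𝓘(ℝ, W) (extChartAt I p) p

/-- The components of a vector field in the chart at `p`, as a function of the coordinates. -/
def fieldInChart (p : M) (X : ∀ q : M, TangentSpace I q) : W → W :=
  mpullbackWithin 𝓘(ℝ, W) I (extChartAt I p).symm X (range I)

/-- A function on the tangent bundle, in the coordinates `(x, y)` given by the chart at `p`. -/
def finslerInChart (F : ∀ q : M, TangentSpace I q → ℝ) (p : M) (x y : W) : ℝ :=
  F ((extChartAt I p).symm x) (coordFrame I p x y)

/-- `F` is of Berwald type: in local coordinates, its spray coefficients are quadratic in the
velocity, `G^i = ½ Γ^i_{jk}(x) y^j y^k`. -/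
def IsBerwald (F : ∀ q : M, TangentSpace I q → ℝ) : Prop :=
  ∀ p : M, ∃ Γ : W → W →L[ℝ] W →L[ℝ] W, ∀ x ∈ (extChartAt I p).target, ∀ y : W, y ≠ 0 →
    spray (finslerInChart I F p) x y = (1 / 2 : ℝ) • Γ x y y

/-- The flag curvature `K(span {u, y}, y)` of `F` at the point `p`. -/
def flagCurvature (F : ∀ q : M, TangentSpace I q → ℝ) (p : M) (y u : TangentSpace I p) : ℝ :=
  flagCurvatureLocal (finslerInChart I F p) (extChartAt I p p) (components I p y)
    (components I p u)

/-- A Riemannian metric, in the chart at `p`. -/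
def metricInChart (h : ∀ q : M, TangentSpace I q →L[ℝ] TangentSpace I q →L[ℝ] ℝ) (p : M) (x : W) :
    W →L[ℝ] W →L[ℝ] ℝ :=
  (ContinuousLinearMap.precomp ℝ (coordFrame I p x)).comp
    ((h ((extChartAt I p).symm x)).comp (coordFrame I p x))

/-- The Levi-Civita derivative `(∇_u X)(p)` of a vector field `X` with respect to the metric `h`,
with components `u^j ∂_j X^i + Γ^i_{jk} u^j X^k`. -/
def covDeriv (h : ∀ q : M, TangentSpace I q →L[ℝ] TangentSpace I q →L[ℝ] ℝ)
    (X : ∀ q : M, TangentSpace I q) (p : M) (u : TangentSpace I p) : TangentSpace I p :=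
  (components I p).inverse
    (fderiv ℝ (fieldInChart I p X) (extChartAt I p p) (components I p u)
      + christoffel (metricInChart I h p) (extChartAt I p p) (components I p u)
          (fieldInChart I p X (extChartAt I p p)))

/-- `X` is parallel with respect to the Levi-Civita connection of `h`. -/
def IsParallel (h : ∀ q : M, TangentSpace I q →L[ℝ] TangentSpace I q →L[ℝ] ℝ)
    (X : ∀ q : M, TangentSpace I q) : Prop :=
  ∀ (p : M) (u : TangentSpace I p), covDeriv I h X p u = 0

/-- The sectional curvature of `h` at `p` of the plane spanned by `u` and `y`. -/
def sectionalCurvature (h : ∀ q : M, TangentSpace I q →L[ℝ] TangentSpace I q →L[ℝ] ℝ) (p : M)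
    (u y : TangentSpace I p) : ℝ :=
  metricInChart I h p (extChartAt I p p)
      (riemannCurv (metricInChart I h p) (extChartAt I p p) (components I p u) (components I p y)
        (components I p y)) (components I p u) /
    (h p y y * h p u u - h p u y ^ 2)

/-- The function `F = α φ(β/α)` with `α(z) = √h(z,z)` and `β(z) = h(X,z)`. -/
def alphaBetaMetric (h : ∀ q : M, TangentSpace I q →L[ℝ] TangentSpace I q →L[ℝ] ℝ)
    (X : ∀ q : M, TangentSpace I q) (φ : ℝ → ℝ) (q : M) (z : TangentSpace I q) : ℝ :=
  √(h q z z) * φ (h q (X q) z / √(h q z z))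

end Manifold

/-- The conditions on `φ : (-b₀, b₀) → (0, ∞)` under which `α φ(β/α)` is a Finsler metric for all
`β` with `‖β‖ < b₀`. -/
structure IsAlphaBetaProfile (φ : ℝ → ℝ) (b₀ : ℝ) : Prop where
  smooth : ContDiffOn ℝ ∞ φ (Ioo (-b₀) b₀)
  pos : ∀ s ∈ Ioo (-b₀) b₀, 0 < φ s
  convex : ∀ s b : ℝ, |s| ≤ b → b < b₀ →
    0 < φ s - s * deriv φ s + (b ^ 2 - s ^ 2) * deriv (deriv φ) s

/-- `D = φ'' / (φ - s φ')`. -/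
def profileD (φ : ℝ → ℝ) (s : ℝ) : ℝ :=
  deriv (deriv φ) s / (φ s - s * deriv φ s)

/-! ### Lifts of vector fields to the tangent bundle -/

section Lifts

variable {E : Type*} [NormedAddCommGroup E] [NormedSpace ℝ E]
  {M : Type*} [TopologicalSpace M] [ChartedSpace E M] [IsManifold 𝓘(ℝ, E) ∞ M]

/-- The vertical lift `X^v = ξ^i ∂/∂y^i` of `X = ξ^i ∂/∂x^i`, in the coordinates `(x, y)` of `TM`
induced by the chart of `M` at the base point. -/
def verticalLift (X : ∀ q : M, TangentSpace 𝓘(ℝ, E) q) (p : TangentBundle 𝓘(ℝ, E) M) :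
    TangentSpace 𝓘(ℝ, E).tangent p :=
  (components 𝓘(ℝ, E).tangent p).inverse
    ((0 : E), fieldInChart 𝓘(ℝ, E) p.proj X (extChartAt 𝓘(ℝ, E).tangent p p).1)

/-- The complete lift `X^c = ξ^i ∂/∂x^i + y^j ∂ξ^i/∂x^j ∂/∂y^i` of `X = ξ^i ∂/∂x^i`, in the
coordinates `(x, y)` of `TM` induced by the chart of `M` at the base point. -/
def completeLift (X : ∀ q : M, TangentSpace 𝓘(ℝ, E) q) (p : TangentBundle 𝓘(ℝ, E) M) :
    TangentSpace 𝓘(ℝ, E).tangent p :=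
  (components 𝓘(ℝ, E).tangent p).inverse
    (fieldInChart 𝓘(ℝ, E) p.proj X (extChartAt 𝓘(ℝ, E).tangent p p).1,
      fderiv ℝ (fieldInChart 𝓘(ℝ, E) p.proj X) (extChartAt 𝓘(ℝ, E).tangent p p).1
        (extChartAt 𝓘(ℝ, E).tangent p p).2)

end Lifts

/-! ### Left invariant objects on a Lie group and on its tangent bundle -/

section LieGroup

variable {E : Type*} [NormedAddCommGroup E] [NormedSpace ℝ E] [FiniteDimensional ℝ E]
  {G : Type*} [TopologicalSpace G] [ChartedSpace E G] [Group G] [LieGroup 𝓘(ℝ, E) ∞ G]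

/-- `g` is a left invariant Riemannian metric: left translations are isometries. -/
def IsLeftInvariant
    (g : ContMDiffRiemannianMetric 𝓘(ℝ, E) ∞ E (fun x : G => TangentSpace 𝓘(ℝ, E) x)) : Prop :=
  ∀ (a x : G) (u v : TangentSpace 𝓘(ℝ, E) x),
    g.inner (a * x) (mfderiv 𝓘(ℝ, E) 𝓘(ℝ, E) (a * ·) x u)
      (mfderiv 𝓘(ℝ, E) 𝓘(ℝ, E) (a * ·) x v) = g.inner x u v

/-- The value of `g` on left invariant vector fields, as an inner product on the Lie algebra. -/
def lieInner (g : ContMDiffRiemannianMetric 𝓘(ℝ, E) ∞ E (fun x : G => TangentSpace 𝓘(ℝ, E) x)) :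
    GroupLieAlgebra 𝓘(ℝ, E) G →L[ℝ] GroupLieAlgebra 𝓘(ℝ, E) G →L[ℝ] ℝ :=
  g.inner 1

/-- `∇_A B` for left invariant vector fields `A, B`, where `∇` is the Levi-Civita connection of the
left invariant metric `g`; the result is again left invariant, and is given by its value at `1`. -/
def nabla (g : ContMDiffRiemannianMetric 𝓘(ℝ, E) ∞ E (fun x : G => TangentSpace 𝓘(ℝ, E) x))
    (A B : GroupLieAlgebra 𝓘(ℝ, E) G) : GroupLieAlgebra 𝓘(ℝ, E) G :=
  covDeriv 𝓘(ℝ, E) g.inner (mulInvariantVectorField B) 1 A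

theorem lieGroup_minSmoothness : LieGroup 𝓘(ℝ, E) (minSmoothness ℝ 3) G := by
  rw [minSmoothness_of_isRCLikeNormedField]
  infer_instance

/-- The functional `C ↦ g(B, [A, C])`. -/
def adForm (g : ContMDiffRiemannianMetric 𝓘(ℝ, E) ∞ E (fun x : G => TangentSpace 𝓘(ℝ, E) x))
    (A B : GroupLieAlgebra 𝓘(ℝ, E) G) : GroupLieAlgebra 𝓘(ℝ, E) G →L[ℝ] ℝ :=
  haveI : LieGroup 𝓘(ℝ, E) (minSmoothness ℝ 3) G := lieGroup_minSmoothness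
  haveI : CompleteSpace E := FiniteDimensional.complete ℝ E
  haveI : FiniteDimensional ℝ (GroupLieAlgebra 𝓘(ℝ, E) G) := inferInstanceAs (FiniteDimensional ℝ E)
  haveI : T2Space (GroupLieAlgebra 𝓘(ℝ, E) G) := inferInstanceAs (T2Space E)
  LinearMap.toContinuousLinearMap
    { toFun := fun C => lieInner g B ⁅A, C⁆
      map_add' := fun C C' => by rw [lie_add, map_add]
      map_smul' := fun c C => by rw [lie_smul, map_smul, RingHom.id_apply] }

/-- `ad*_A B`, where `ad*_A` is the adjoint of `ad_A` with respect to `g`: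
`g(ad*_A B, C) = g(B, [A, C])`. -/
def adStar (g : ContMDiffRiemannianMetric 𝓘(ℝ, E) ∞ E (fun x : G => TangentSpace 𝓘(ℝ, E) x))
    (A B : GroupLieAlgebra 𝓘(ℝ, E) G) : GroupLieAlgebra 𝓘(ℝ, E) G :=
  (lieInner g).inverse (adForm g A B)

/-- The left invariant vector field `A^c` on `TG`. -/
def liftC (A : GroupLieAlgebra 𝓘(ℝ, E) G) (p : TangentBundle 𝓘(ℝ, E) G) :
    TangentSpace 𝓘(ℝ, E).tangent p :=
  completeLift (mulInvariantVectorField A) p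

/-- The left invariant vector field `A^v` on `TG`. -/
def liftV (A : GroupLieAlgebra 𝓘(ℝ, E) G) (p : TangentBundle 𝓘(ℝ, E) G) :
    TangentSpace 𝓘(ℝ, E).tangent p :=
  verticalLift (mulInvariantVectorField A) p

theorem fieldInChart_linear (x : G) (z : E) (c : ℝ) (A B : GroupLieAlgebra 𝓘(ℝ, E) G) :
    fieldInChart 𝓘(ℝ, E) x (mulInvariantVectorField (c • A + B)) z =
     c • fieldInChart 𝓘(ℝ, E) x (mulInvariantVectorField A) z +
       fieldInChart 𝓘(ℝ, E) x (mulInvariantVectorField B) z := by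
  simp only [fieldInChart, mulInvariantVectorField_add, mulInvariantVectorField_smul]
  rw [mpullbackWithin_add, mpullbackWithin_const_smul]
  rfl

theorem differentiableAt_fieldInChart (x : G) (A : GroupLieAlgebra 𝓘(ℝ, E) G) :
    DifferentiableAt ℝ (fieldInChart 𝓘(ℝ, E) x (mulInvariantVectorField A))
      (extChartAt 𝓘(ℝ, E) x x) := by
  have : LieGroup 𝓘(ℝ, E) (minSmoothness ℝ 3) G := lieGroup_minSmoothness
  have : CompleteSpace E := FiniteDimensional.complete ℝ E
  have : IsManifold 𝓘(ℝ, E) 2 G := inferInstance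
  have h := contMDiffWithinAt_mpullbackWithin_extChartAt_symm (I := 𝓘(ℝ, E)) (s := univ) (m := 1)
    (n := 2) (x := x) (V := mulInvariantVectorField A)
    (((contMDiff_mulInvariantVectorField A).of_le
      (by rw [minSmoothness_of_isRCLikeNormedField]; norm_num)) x).contMDiffWithinAt
    uniqueMDiffOn_univ (mem_univ _) (by norm_num)
  rw [preimage_univ, inter_univ, contMDiffWithinAt_vectorSpace_iff_contDiffWithinAt] at h
  exact (h.contDiffAt (extChartAt_target_mem_nhds x)).differentiableAt (by norm_num)

theorem components_invertible {W : Type*} [NormedAddCommGroup W] [NormedSpace ℝ W]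
    {H : Type*} [TopologicalSpace H] (I : ModelWithCorners ℝ W H)
    {M : Type*} [TopologicalSpace M] [ChartedSpace H M] [IsManifold I 1 M] (p : M) :
    (components I p).IsInvertible :=
  isInvertible_mfderiv_extChartAt (mem_extChartAt_source p)

theorem fieldInChart_eq_zero (x : G) (A : GroupLieAlgebra 𝓘(ℝ, E) G)
    (h : fieldInChart 𝓘(ℝ, E) x (mulInvariantVectorField A) (extChartAt 𝓘(ℝ, E) x x) = 0) :
    A = 0 := by
  have : LieGroup 𝓘(ℝ, E) (minSmoothness ℝ 3) G := lieGroup_minSmoothness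
  have h1 : mulInvariantVectorField A x = 0 := by
    have h2 := (isInvertible_mfderivWithin_extChartAt_symm (I := 𝓘(ℝ, E))
      (mem_extChartAt_target x)).inverse.injective (h.trans (map_zero _).symm)
    rwa [extChartAt_to_inv] at h2
  have h3 := congrFun (mpullback_mulInvariantVectorField (I := 𝓘(ℝ, E)) x A) 1
  rw [mpullback_apply, mul_one, h1, map_zero] at h3
  have h4 : mulInvariantVectorField A (1 : G) = A := by
    have h5 : (fun y : G => 1 * y) = id := funext one_mul
    rw [mulInvariantVectorField, h5, mfderiv_id]
    rfl
  rw [← h4, ← h3]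

theorem liftC_add_liftV (p : TangentBundle 𝓘(ℝ, E) G) (A B : GroupLieAlgebra 𝓘(ℝ, E) G) :
    liftC A p + liftV B p = (components 𝓘(ℝ, E).tangent p).inverse
      (fieldInChart 𝓘(ℝ, E) p.proj (mulInvariantVectorField A) (extChartAt 𝓘(ℝ, E) p.proj p.proj),
        fderiv ℝ (fieldInChart 𝓘(ℝ, E) p.proj (mulInvariantVectorField A))
            (extChartAt 𝓘(ℝ, E) p.proj p.proj) (extChartAt 𝓘(ℝ, E).tangent p p).2
          + fieldInChart 𝓘(ℝ, E) p.proj (mulInvariantVectorField B)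
              (extChartAt 𝓘(ℝ, E) p.proj p.proj)) := by
  simp only [liftC, liftV, completeLift, verticalLift]
  rw [← map_add]
  congr 1
  exact Prod.ext (add_zero _) rfl

theorem liftC_add_liftV_linear (p : TangentBundle 𝓘(ℝ, E) G) (c : ℝ)
    (A B A' B' : GroupLieAlgebra 𝓘(ℝ, E) G) :
    liftC (c • A + A') p + liftV (c • B + B') p =
      c • (liftC A p + liftV B p) + (liftC A' p + liftV B' p) := by
  simp only [liftC_add_liftV]
  rw [← map_smul, ← map_add]
  congr 1
  have h : fieldInChart 𝓘(ℝ, E) p.proj (mulInvariantVectorField (c • A + A')) =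
      c • fieldInChart 𝓘(ℝ, E) p.proj (mulInvariantVectorField A) +
        fieldInChart 𝓘(ℝ, E) p.proj (mulInvariantVectorField A') :=
    funext fun z => fieldInChart_linear p.proj z c A A'
  refine Prod.ext (fieldInChart_linear _ _ c A A') ?_
  simp only [fieldInChart_linear]
  rw [h, fderiv_add ((differentiableAt_fieldInChart _ A).const_smul c)
    (differentiableAt_fieldInChart _ A'), fderiv_const_smul (differentiableAt_fieldInChart _ A)]
  simp only [add_apply, smul_apply, Prod.smul_mk,
    Prod.mk_add_mk, smul_add]
  abel

/-- The linear isomorphism `(A, B) ↦ A^c(p) + B^v(p)` from pairs of elements of the Lie algebra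
to the tangent space of `TG` at `p`. -/
def liftFrame (p : TangentBundle 𝓘(ℝ, E) G) :
    (GroupLieAlgebra 𝓘(ℝ, E) G × GroupLieAlgebra 𝓘(ℝ, E) G) →L[ℝ]
      TangentSpace 𝓘(ℝ, E).tangent p :=
  haveI : FiniteDimensional ℝ (GroupLieAlgebra 𝓘(ℝ, E) G) := inferInstanceAs (FiniteDimensional ℝ E)
  haveI : T2Space (GroupLieAlgebra 𝓘(ℝ, E) G) := inferInstanceAs (T2Space E)
  LinearMap.toContinuousLinearMap
    { toFun := fun A => liftC A.1 p + liftV A.2 p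
      map_add' := fun A B => by
        simpa using liftC_add_liftV_linear p 1 A.1 A.2 B.1 B.2
      map_smul' := fun c A => by
        have h0 := liftC_add_liftV_linear p 1 0 0 0 0
        have h := liftC_add_liftV_linear p c A.1 A.2 0 0
        simp only [smul_zero, add_zero, one_smul, left_eq_add] at h0 h
        rw [h0, add_zero] at h
        exact h }

theorem liftFrame_apply (p : TangentBundle 𝓘(ℝ, E) G)
    (A : GroupLieAlgebra 𝓘(ℝ, E) G × GroupLieAlgebra 𝓘(ℝ, E) G) :
    liftFrame p A = liftC A.1 p + liftV A.2 p :=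
  rfl

theorem liftFrame_injective (p : TangentBundle 𝓘(ℝ, E) G) :
    Function.Injective (liftFrame p) := by
  rw [injective_iff_map_eq_zero]
  rintro ⟨A, B⟩ h
  rw [liftFrame_apply, liftC_add_liftV] at h
  have h1 := (components_invertible 𝓘(ℝ, E).tangent p).inverse.injective (h.trans (map_zero _).symm)
  have hA : A = 0 := fieldInChart_eq_zero p.proj A (congrArg Prod.fst h1)
  subst hA
  have h2 := congrArg Prod.snd h1
  have h3 : fieldInChart 𝓘(ℝ, E) p.proj (mulInvariantVectorField (0 : GroupLieAlgebra 𝓘(ℝ, E) G))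
      = 0 := by
    funext z
    have h4 := fieldInChart_linear p.proj z 1 (0 : GroupLieAlgebra 𝓘(ℝ, E) G) 0
    simpa using h4
  rw [h3] at h2
  have hB : B = 0 := by
    refine fieldInChart_eq_zero p.proj B ?_
    simpa using h2
  rw [hB]
  rfl

theorem liftFrame_invertible (p : TangentBundle 𝓘(ℝ, E) G) : (liftFrame p).IsInvertible := by
  have : FiniteDimensional ℝ (GroupLieAlgebra 𝓘(ℝ, E) G) :=
    inferInstanceAs (FiniteDimensional ℝ E)
  have : FiniteDimensional ℝ (TangentSpace 𝓘(ℝ, E).tangent p) :=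
    inferInstanceAs (FiniteDimensional ℝ (E × E))
  have : T2Space (GroupLieAlgebra 𝓘(ℝ, E) G) := inferInstanceAs (T2Space E)
  have : T2Space (TangentSpace 𝓘(ℝ, E).tangent p) := inferInstanceAs (T2Space (E × E))
  have hd : Module.finrank ℝ (GroupLieAlgebra 𝓘(ℝ, E) G × GroupLieAlgebra 𝓘(ℝ, E) G) =
      Module.finrank ℝ (TangentSpace 𝓘(ℝ, E).tangent p) := rfl
  let e := (LinearEquiv.ofInjectiveOfFinrankEq (liftFrame p).toLinearMap
    (liftFrame_injective p) hd).toContinuousLinearEquiv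
  exact ⟨e, rfl⟩

/-- The lifted left invariant Riemannian metric `g̃` on `TG`, given on left invariant vector fields
by `g̃(A^c, B^c) = g(A, B)`, `g̃(A^v, B^v) = g(A, B)` and `g̃(A^c, B^v) = 0`. -/
def liftedMetric
    (g : ContMDiffRiemannianMetric 𝓘(ℝ, E) ∞ E (fun x : G => TangentSpace 𝓘(ℝ, E) x))
    (p : TangentBundle 𝓘(ℝ, E) G) :
    TangentSpace 𝓘(ℝ, E).tangent p →L[ℝ] TangentSpace 𝓘(ℝ, E).tangent p →L[ℝ] ℝ :=
  let a : TangentSpace 𝓘(ℝ, E).tangent p →L[ℝ] GroupLieAlgebra 𝓘(ℝ, E) G :=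
    (ContinuousLinearMap.fst ℝ _ _).comp (liftFrame p).inverse
  let b : TangentSpace 𝓘(ℝ, E).tangent p →L[ℝ] GroupLieAlgebra 𝓘(ℝ, E) G :=
    (ContinuousLinearMap.snd ℝ _ _).comp (liftFrame p).inverse
  (ContinuousLinearMap.precomp ℝ a).comp ((lieInner g).comp a) +
    (ContinuousLinearMap.precomp ℝ b).comp ((lieInner g).comp b)

/-- The defining property of `g̃`. -/
theorem liftedMetric_apply
    (g : ContMDiffRiemannianMetric 𝓘(ℝ, E) ∞ E (fun x : G => TangentSpace 𝓘(ℝ, E) x))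
    (p : TangentBundle 𝓘(ℝ, E) G) (A B A' B' : GroupLieAlgebra 𝓘(ℝ, E) G) :
    liftedMetric g p (liftC A p + liftV B p) (liftC A' p + liftV B' p) =
      lieInner g A A' + lieInner g B B' := by
  have h : ∀ C D : GroupLieAlgebra 𝓘(ℝ, E) G,
      (liftFrame p).inverse (liftC C p + liftV D p) = (C, D) := fun C D =>
    (liftFrame_invertible p).inverse_apply_self (C, D)
  change lieInner g ((liftFrame p).inverse _).1 ((liftFrame p).inverse _).1 +
    lieInner g ((liftFrame p).inverse _).2 ((liftFrame p).inverse _).2 = _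
  rw [h, h]

/-- The defining property of `ad*`. -/
theorem lieInner_adStar
    (g : ContMDiffRiemannianMetric 𝓘(ℝ, E) ∞ E (fun x : G => TangentSpace 𝓘(ℝ, E) x))
    (A B C : GroupLieAlgebra 𝓘(ℝ, E) G) :
    lieInner g (adStar g A B) C = lieInner g B ⁅A, C⁆ := by
  have : FiniteDimensional ℝ (GroupLieAlgebra 𝓘(ℝ, E) G) :=
    inferInstanceAs (FiniteDimensional ℝ E)
  have : T2Space (GroupLieAlgebra 𝓘(ℝ, E) G) := inferInstanceAs (T2Space E)
  let d : (GroupLieAlgebra 𝓘(ℝ, E) G →ₗ[ℝ] ℝ) ≃ₗ[ℝ] (GroupLieAlgebra 𝓘(ℝ, E) G →L[ℝ] ℝ) :=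
    LinearMap.toContinuousLinearMap
  have : FiniteDimensional ℝ (GroupLieAlgebra 𝓘(ℝ, E) G →L[ℝ] ℝ) :=
    inferInstanceAs (FiniteDimensional ℝ (E →L[ℝ] ℝ))
  have : T2Space (GroupLieAlgebra 𝓘(ℝ, E) G →L[ℝ] ℝ) :=
    inferInstanceAs (T2Space (E →L[ℝ] ℝ))
  have hd : Module.finrank ℝ (GroupLieAlgebra 𝓘(ℝ, E) G) =
      Module.finrank ℝ (GroupLieAlgebra 𝓘(ℝ, E) G →L[ℝ] ℝ) := by
    rw [← d.finrank_eq]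
    exact (Subspace.dual_finrank_eq).symm
  have hinj : Function.Injective (lieInner g).toLinearMap := by
    rw [injective_iff_map_eq_zero]
    intro v hv
    by_contra hne
    have h1 := g.pos 1 v hne
    have h2 : lieInner g v v = 0 := by
      have h3 : lieInner g v = 0 := hv
      rw [h3]
      rfl
    exact h1.ne' h2
  let e := (LinearEquiv.ofInjectiveOfFinrankEq (lieInner g).toLinearMap hinj
    hd).toContinuousLinearEquiv
  have hinv : (lieInner g).IsInvertible := ⟨e, rfl⟩
  change lieInner g ((lieInner g).inverse (adForm g A B)) C = _
  rw [hinv.self_apply_inverse]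
  rfl

/-- The vertical lift `F^v = √g̃ φ(g̃(X^v, ·) / √g̃)` to `TG` of the left invariant `(α,β)`-metric
`F = √g φ(g(X, ·) / √g)` on `G`. -/
def verticalLiftedMetric
    (g : ContMDiffRiemannianMetric 𝓘(ℝ, E) ∞ E (fun x : G => TangentSpace 𝓘(ℝ, E) x))
    (X : GroupLieAlgebra 𝓘(ℝ, E) G) (φ : ℝ → ℝ) (p : TangentBundle 𝓘(ℝ, E) G) :
    TangentSpace 𝓘(ℝ, E).tangent p → ℝ :=
  alphaBetaMetric 𝓘(ℝ, E).tangent (liftedMetric g) (liftV X) φ p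

end LieGroup

end LieFinsler

end

open LieFinsler

/-! Left invariance turns the differential geometry into algebra. In a frame of left invariant
fields the metric has constant coefficients, so the Levi-Civita connection becomes a bilinear
product `n` on the Lie algebra, given by Koszul's formula, and the Riemann tensor becomes
`productCurv n`. On TG the lifts form such a frame, with brackets [A^c, B^c] = [A, B]^c, [A^c, B^v]
= [A, B]^v and [A^v, B^v] = 0, so g̃ is encoded by the product `liftProduct` on pairs.

On the Finsler side, F² in frame components is a fixed function `sqNorm`. If F² is parallel for a
symmetric linear connection Γ, then Γ determines the spray, the nonlinear connection and the Chern
connection, and the Chern curvature is the curvature of Γ (`chernCurv_eq`). The Levi-Civita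
connection of g̃ qualifies as soon as X^v is parallel, because then it preserves both α and β.

The crux is therefore that the Berwald condition makes X^v parallel (`parallel_of_berwald`). A spray
quadratic in the velocity comes from a symmetric connection for which F² is parallel
(`parallel_of_spray_eq`). If T is its difference from the Levi-Civita connection, each operator T a
+ n a is an infinitesimal isometry of the Minkowski norm α φ(β/α). By `isometry_rigidity` it
preserves α and β separately, unless φ² = a + c s² on the range of slopes. Hence T a is skew; T is
also symmetric, so T = 0 and n a X = 0. In the exceptional case with c ≠ 0 the parallelism is a
hypothesis; with c = 0 the profile is constant on the relevant range, F^v is a multiple of the norm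
of g̃, and X may be replaced by 0.

Once X^v is parallel, R(u, y)y is orthogonal to y and to X^v. Only one term of the Hessian of
`sqNorm` survives in the numerator, and the flag curvature is the curvature of g̃ divided by φ(s)²
(1 + g̃(X^v, u)² D(s)) with s = g̃(X^v, y). It remains to compare the curvature of `liftProduct`
with that of `koszul`, which is done in `curv_lift_cc`, `curv_lift_vc`, `curv_lift_cv` and
`curv_lift_vv`. -/

noncomputable section

namespace LieFinsler

/-! ### Levi-Civita connection and curvature in an invariant frame -/

section Frames

variable {L W : Type*} [NormedAddCommGroup L] [NormedSpace ℝ L] [FiniteDimensional ℝ L]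
  [NormedAddCommGroup W] [NormedSpace ℝ W] [FiniteDimensional ℝ W]

/-- `m` is an inner product on `L`. -/
structure IsInnerForm (m : L →L[ℝ] L →L[ℝ] ℝ) : Prop where
  symm : ∀ a b, m a b = m b a
  pos : ∀ a, a ≠ 0 → 0 < m a a

/-- `m` is an inner product on `L` and the product `n` is skew-symmetric with respect to it. -/
structure IsMetricProduct (m : L →L[ℝ] L →L[ℝ] ℝ) (n : L →L[ℝ] L →L[ℝ] L) : Prop
    extends IsInnerForm m where
  skew : ∀ a b c, m (n a b) c + m b (n a c) = 0

/-- The curvature of the product `n`, regarded as a connection with torsion-free bracket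
`[a, b] = n a b - n b a`. -/
def productCurv (n : L →L[ℝ] L →L[ℝ] L) (a b c : L) : L :=
  n a (n b c) - n b (n a c) - n (n a b - n b a) c

/-- The fields `x ↦ ξ x a` are a smooth frame on `U`, with brackets `[a, b] = n a b - n b a`, in
which the metric `h` has the constant coefficients `m`. -/
structure IsInvariantFrame (m : L →L[ℝ] L →L[ℝ] ℝ) (n : L →L[ℝ] L →L[ℝ] L) (U : Set W)
    (ξ : W → L →L[ℝ] W) (h : W → W →L[ℝ] W →L[ℝ] ℝ) : Prop where
  isOpen : IsOpen U
  smooth : ContDiffOn ℝ ∞ ξ U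
  invertible : ∀ x ∈ U, (ξ x).IsInvertible
  metric : ∀ x ∈ U, ∀ a b, h x (ξ x a) (ξ x b) = m a b
  bracket : ∀ x ∈ U, ∀ a b,
    fderiv ℝ ξ x (ξ x a) b - fderiv ℝ ξ x (ξ x b) a = ξ x (n a b - n b a)

/-- The connection coefficients for which `∇_{ξ a} (ξ b) = ξ (n a b)`. -/
def frameConn (n : L →L[ℝ] L →L[ℝ] L) (ξ : W → L →L[ℝ] W) (x : W) : W →L[ℝ] W →L[ℝ] W :=
  (ContinuousLinearMap.compL ℝ W L W (ξ x)).comp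
      (((ContinuousLinearMap.compL ℝ W L L).flip (ξ x).inverse).comp (n.comp (ξ x).inverse))
    - ((ContinuousLinearMap.compL ℝ W L W).flip (ξ x).inverse).comp (fderiv ℝ ξ x)

theorem frameConn_apply (n : L →L[ℝ] L →L[ℝ] L) (ξ : W → L →L[ℝ] W) (x u v : W) :
    frameConn n ξ x u v =
      ξ x (n ((ξ x).inverse u) ((ξ x).inverse v)) - fderiv ℝ ξ x u ((ξ x).inverse v) := rfl

theorem IsInnerForm.eq_zero {m : L →L[ℝ] L →L[ℝ] ℝ} (hm : IsInnerForm m) {a : L} (h : m a a = 0) : a = 0 := by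
  by_contra hne
  exact (hm.pos a hne).ne' h

/-- A bilinear form without left kernel on a finite-dimensional space is invertible. -/
theorem isInvertible_of_forall_eq_zero (b : W →L[ℝ] W →L[ℝ] ℝ)
    (hb : ∀ w, (∀ v, b w v = 0) → w = 0) : b.IsInvertible := by
  have hinj : Function.Injective b.toLinearMap := by
    rw [injective_iff_map_eq_zero]
    intro w hw
    exact hb w fun v => by
      have : b w = 0 := hw
      rw [this]; rfl
  let d : (W →ₗ[ℝ] ℝ) ≃ₗ[ℝ] (W →L[ℝ] ℝ) := LinearMap.toContinuousLinearMap
  have hd : Module.finrank ℝ W = Module.finrank ℝ (W →L[ℝ] ℝ) := by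
    rw [← d.finrank_eq]
    exact (Subspace.dual_finrank_eq).symm
  exact ⟨(LinearEquiv.ofInjectiveOfFinrankEq b.toLinearMap hinj hd).toContinuousLinearEquiv, rfl⟩

namespace IsInvariantFrame

variable {m : L →L[ℝ] L →L[ℝ] ℝ} {n : L →L[ℝ] L →L[ℝ] L} {U : Set W}
  {ξ : W → L →L[ℝ] W} {h : W → W →L[ℝ] W →L[ℝ] ℝ} {x : W}

theorem contDiffAt (hf : IsInvariantFrame m n U ξ h) (hx : x ∈ U) : ContDiffAt ℝ ∞ ξ x :=
  hf.smooth.contDiffAt (hf.isOpen.mem_nhds hx)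

theorem contDiffAt_inverse (hf : IsInvariantFrame m n U ξ h) (hx : x ∈ U) :
    ContDiffAt ℝ ∞ (fun x => (ξ x).inverse) x := by
  have : CompleteSpace L := FiniteDimensional.complete ℝ L
  exact (hf.invertible x hx).contDiffAt_map_inverse.comp x (hf.contDiffAt hx)

theorem apply_inverse (hf : IsInvariantFrame m n U ξ h) (hx : x ∈ U) (u : W) :
    ξ x ((ξ x).inverse u) = u := (hf.invertible x hx).self_apply_inverse u

theorem inverse_apply (hf : IsInvariantFrame m n U ξ h) (hx : x ∈ U) (a : L) :
    (ξ x).inverse (ξ x a) = a := (hf.invertible x hx).inverse_apply_self a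

theorem differentiableAt (hf : IsInvariantFrame m n U ξ h) (hx : x ∈ U) :
    DifferentiableAt ℝ ξ x := (hf.contDiffAt hx).differentiableAt (by simp)

theorem fderiv_inverse (hf : IsInvariantFrame m n U ξ h) (hx : x ∈ U) (u v : W) :
    fderiv ℝ (fun x => (ξ x).inverse) x u v =
      -(ξ x).inverse (fderiv ℝ ξ x u ((ξ x).inverse v)) := by
  have hi : DifferentiableAt ℝ (fun x => (ξ x).inverse) x :=
    (hf.contDiffAt_inverse hx).differentiableAt (by simp)
  have h1 : (fun x => ξ x ((ξ x).inverse v)) =ᶠ[𝓝 x] fun _ => v := by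
    filter_upwards [hf.isOpen.mem_nhds hx] with z hz using hf.apply_inverse hz v
  have h2 := h1.fderiv_eq (𝕜 := ℝ)
  rw [fderiv_fun_const, fderiv_clm_apply (hf.differentiableAt hx)
    (hi.clm_apply (differentiableAt_const v)), fderiv_clm_apply hi (differentiableAt_const v)] at h2
  have h3 := congrArg (ξ x).inverse (congrArg (fun T : W →L[ℝ] W => T u) h2)
  simp [hf.inverse_apply hx] at h3
  exact eq_neg_of_add_eq_zero_left h3

/-- This trades the derivative of the coframe, which appears when a function of `(ξ x).inverse y` is
differentiated in x, for the algebraic product `n`. -/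
theorem inverse_frameConn (hf : IsInvariantFrame m n U ξ h) (hx : x ∈ U) (u v : W) :
    (ξ x).inverse (frameConn n ξ x u v) = n ((ξ x).inverse u) ((ξ x).inverse v) +
      fderiv ℝ (fun x => (ξ x).inverse) x u v := by
  rw [hf.fderiv_inverse hx, frameConn_apply, map_sub, hf.inverse_apply hx, sub_eq_add_neg]

set_option synthInstance.maxHeartbeats 200000 in
theorem contDiffAt_frameConn (hf : IsInvariantFrame m n U ξ h) (hx : x ∈ U) :
    ContDiffAt ℝ ∞ (frameConn n ξ) x := by
  have hi := hf.contDiffAt_inverse hx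
  have h0 := hf.contDiffAt hx
  have hd : ContDiffAt ℝ ∞ (fderiv ℝ ξ) x := h0.fderiv_right (by simp)
  unfold frameConn
  refine ContDiffAt.sub (ContDiffAt.clm_comp ?_ (ContDiffAt.clm_comp ?_ ?_)) (ContDiffAt.clm_comp ?_ hd)
  · exact contDiffAt_const.clm_apply h0
  · exact contDiffAt_const.clm_apply hi
  · exact contDiffAt_const.clm_comp hi
  · exact contDiffAt_const.clm_apply hi

/-- Vanishing torsion is the bracket relation of the frame. -/
theorem frameConn_symm (hf : IsInvariantFrame m n U ξ h) (hx : x ∈ U) (u v : W) :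
    frameConn n ξ x u v = frameConn n ξ x v u := by
  have h1 := hf.bracket x hx ((ξ x).inverse u) ((ξ x).inverse v)
  rw [hf.apply_inverse hx, hf.apply_inverse hx, map_sub] at h1
  rw [frameConn_apply, frameConn_apply, sub_eq_sub_iff_sub_eq_sub, h1]

theorem metric_apply (hf : IsInvariantFrame m n U ξ h) (hx : x ∈ U) (u v : W) :
    h x u v = m ((ξ x).inverse u) ((ξ x).inverse v) := by
  rw [← hf.metric x hx, hf.apply_inverse hx, hf.apply_inverse hx]

-- Metric compatibility: in the coframe the metric is the constant form `m`, so only the coframe is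
-- differentiated, and the skewness of `n` accounts for the difference from the connection.
set_option synthInstance.maxHeartbeats 200000 in
theorem fderiv_metric (hf : IsInvariantFrame m n U ξ h) (hm : IsMetricProduct m n) (hx : x ∈ U)
    (u v w : W) :
    fderiv ℝ h x u v w = h x (frameConn n ξ x u v) w + h x v (frameConn n ξ x u w) := by
  have hi : DifferentiableAt ℝ (fun x => (ξ x).inverse) x :=
    (hf.contDiffAt_inverse hx).differentiableAt (by simp)
  have h1 : h =ᶠ[𝓝 x] fun z =>
      ((ContinuousLinearMap.compL ℝ W L ℝ).flip (ξ z).inverse).comp (m.comp (ξ z).inverse) := by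
    filter_upwards [hf.isOpen.mem_nhds hx] with z hz
    ext u v
    exact hf.metric_apply hz u v
  have hh : DifferentiableAt ℝ h x := by
    refine DifferentiableAt.congr_of_eventuallyEq ?_ h1
    exact (((ContinuousLinearMap.compL ℝ W L ℝ).flip.differentiableAt).comp x hi).clm_comp
      ((differentiableAt_const m).clm_comp hi)
  have h2 : fderiv ℝ h x u v w = fderiv ℝ (fun z => h z v w) x u := by
    rw [fderiv_clm_apply (hh.clm_apply (differentiableAt_const v)) (differentiableAt_const w),
      fderiv_clm_apply hh (differentiableAt_const v)]
    simp
  have h3 : (fun z => h z v w) =ᶠ[𝓝 x] fun z => m ((ξ z).inverse v) ((ξ z).inverse w) := by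
    filter_upwards [hf.isOpen.mem_nhds hx] with z hz using hf.metric_apply hz v w
  have hv : DifferentiableAt ℝ (fun z => (ξ z).inverse v) x := hi.clm_apply (differentiableAt_const v)
  have hw : DifferentiableAt ℝ (fun z => (ξ z).inverse w) x := hi.clm_apply (differentiableAt_const w)
  rw [h2, h3.fderiv_eq, fderiv_clm_apply ((differentiableAt_const m).clm_apply hv) hw,
    fderiv_clm_apply (differentiableAt_const m) hv, fderiv_clm_apply hi (differentiableAt_const v),
    fderiv_clm_apply hi (differentiableAt_const w), hf.metric_apply hx, hf.metric_apply hx,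
    hf.inverse_frameConn hx, hf.inverse_frameConn hx]
  have h4 := hm.skew ((ξ x).inverse u) ((ξ x).inverse v) ((ξ x).inverse w)
  simp
  linarith

theorem metric_invertible (hf : IsInvariantFrame m n U ξ h) (hm : IsMetricProduct m n) (hx : x ∈ U) :
    (h x).IsInvertible := by
  refine isInvertible_of_forall_eq_zero _ fun w hw => ?_
  have h1 := hw w
  rw [hf.metric_apply hx] at h1
  rw [← hf.apply_inverse hx w, hm.eq_zero h1, map_zero]

/-- Uniqueness of the Levi-Civita connection: `frameConn` is metric and symmetric, so the Koszul
combination of derivatives of `h` collapses to twice one term. -/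
theorem christoffel_eq (hf : IsInvariantFrame m n U ξ h) (hm : IsMetricProduct m n) (hx : x ∈ U)
    (u v : W) : christoffel h x u v = frameConn n ξ x u v := by
  have h1 : fderiv ℝ h x u v + fderiv ℝ h x v u - ((fderiv ℝ h x).flip u).flip v
      = h x ((2 : ℝ) • frameConn n ξ x u v) := by
    ext w
    simp only [add_apply, sub_apply, ContinuousLinearMap.flip_apply, hf.fderiv_metric hm hx]
    have hs : ∀ a b, h x a b = h x b a := fun a b => by
      rw [hf.metric_apply hx, hf.metric_apply hx, hm.symm]
    rw [hf.frameConn_symm hx v u, hf.frameConn_symm hx w u, hf.frameConn_symm hx w v,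
      hs (frameConn n ξ x u w) v, map_smul, smul_apply, smul_eq_mul]
    ring
  rw [christoffel, h1, (hf.metric_invertible hm hx).inverse_apply_self, smul_smul]
  norm_num

theorem cov_eq (hf : IsInvariantFrame m n U ξ h) (hx : x ∈ U) (a b : L) :
    fderiv ℝ ξ x (ξ x a) b + frameConn n ξ x (ξ x a) (ξ x b) = ξ x (n a b) := by
  rw [frameConn_apply, hf.inverse_apply hx, hf.inverse_apply hx]
  abel

set_option synthInstance.maxHeartbeats 200000 in
/-- The second covariant derivatives of the frame, in coordinates. -/
theorem fderiv_frameConn (hf : IsInvariantFrame m n U ξ h) (hx : x ∈ U) (a b c : L) :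
    fderiv ℝ (fun z => frameConn n ξ z (ξ x b) (ξ x c)) x (ξ x a) =
      ξ x (n a (n b c)) - frameConn n ξ x (ξ x a) (frameConn n ξ x (ξ x b) (ξ x c))
        - frameConn n ξ x (ξ x a) (fderiv ℝ ξ x (ξ x b) c)
        - frameConn n ξ x (ξ x b) (fderiv ℝ ξ x (ξ x a) c)
        - frameConn n ξ x (fderiv ℝ ξ x (ξ x a) b) (ξ x c)
        - fderiv ℝ ξ x (fderiv ℝ ξ x (ξ x a) b) c
        - fderiv ℝ (fderiv ℝ ξ) x (ξ x a) (ξ x b) c := by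
  have hΓ : DifferentiableAt ℝ (frameConn n ξ) x :=
    (hf.contDiffAt_frameConn hx).differentiableAt (by simp)
  have hd : DifferentiableAt ℝ (fderiv ℝ ξ) x :=
    ((hf.contDiffAt hx).fderiv_right (m := ∞) (by simp)).differentiableAt (by simp)
  have h0 := hf.differentiableAt hx
  have hev : ∀ e : L, DifferentiableAt ℝ (fun z => ξ z e) x := fun e =>
    h0.clm_apply (differentiableAt_const e)
  have hdev : ∀ (e : L) (u : W), fderiv ℝ (fun z => ξ z e) x u = fderiv ℝ ξ x u e := fun e u => by
    rw [fderiv_clm_apply h0 (differentiableAt_const e)]; simp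
  -- The identity ∇_{ξ b}(ξ c) = ξ (n b c) is differentiated along ξ a; `h3` applies the same
  -- identity to the field ξ (n b c).
  have h1 : (fun z => fderiv ℝ ξ z (ξ z b) c + frameConn n ξ z (ξ z b) (ξ z c)) =ᶠ[𝓝 x]
      fun z => ξ z (n b c) := by
    filter_upwards [hf.isOpen.mem_nhds hx] with z hz using hf.cov_eq hz b c
  have h2 := congrArg (fun T : W →L[ℝ] W => T (ξ x a)) h1.fderiv_eq
  have h3 := hf.cov_eq hx a (n b c)
  rw [← hf.cov_eq hx b c, map_add] at h3
  have h4 : fderiv ℝ (fun z => frameConn n ξ z (ξ x b) (ξ x c)) x (ξ x a) =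
      fderiv ℝ (frameConn n ξ) x (ξ x a) (ξ x b) (ξ x c) := by
    rw [fderiv_clm_apply (hΓ.clm_apply (differentiableAt_const _)) (differentiableAt_const _),
      fderiv_clm_apply hΓ (differentiableAt_const _)]
    simp
  rw [fderiv_fun_add ((hd.clm_apply (hev b)).clm_apply (differentiableAt_const c))
      ((hΓ.clm_apply (hev b)).clm_apply (hev c)),
    fderiv_clm_apply (hd.clm_apply (hev b)) (differentiableAt_const c),
    fderiv_clm_apply hd (hev b),
    fderiv_clm_apply (hΓ.clm_apply (hev b)) (hev c), fderiv_clm_apply hΓ (hev b)] at h2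
  simp [hdev] at h2
  rw [← h3, ← h2, h4]
  abel

/-- Antisymmetrising `fderiv_frameConn` in a and b cancels the second derivatives of the frame and
the mixed terms; what is left of the first derivatives assembles into the bracket term of
`productCurv`. -/
theorem riemannCurv_eq (hf : IsInvariantFrame m n U ξ h) (hm : IsMetricProduct m n) (hx : x ∈ U)
    (a b c : L) :
    riemannCurv h x (ξ x a) (ξ x b) (ξ x c) = ξ x (productCurv n a b c) := by
  have h1 : ∀ v w, (fun x' => christoffel h x' v w) =ᶠ[𝓝 x] fun x' => frameConn n ξ x' v w := by
    intro v w
    filter_upwards [hf.isOpen.mem_nhds hx] with z hz using hf.christoffel_eq hm hz v w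
  have hsymm : fderiv ℝ (fderiv ℝ ξ) x (ξ x a) (ξ x b) = fderiv ℝ (fderiv ℝ ξ) x (ξ x b) (ξ x a) :=
    ((hf.contDiffAt hx).isSymmSndFDerivAt
      (by rw [minSmoothness_of_isRCLikeNormedField]; exact WithTop.coe_le_coe.2 (le_top : (2 : ℕ∞) ≤ ⊤))) _ _
  rw [riemannCurv, (h1 _ _).fderiv_eq, (h1 _ _).fderiv_eq, hf.christoffel_eq hm hx,
    hf.christoffel_eq hm hx, hf.christoffel_eq hm hx, hf.christoffel_eq hm hx,
    hf.fderiv_frameConn hx, hf.fderiv_frameConn hx, hsymm, productCurv, map_sub, map_sub,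
    ← hf.cov_eq hx _ c, ← hf.bracket x hx]
  simp only [map_sub, sub_apply]
  abel

end IsInvariantFrame

end Frames

/-! ### Chern connection of a Finsler metric parallel for a linear connection -/

section LocalFinsler

variable {W : Type*} [NormedAddCommGroup W] [NormedSpace ℝ W]

/-- The function `F²` of position and velocity. -/
def energy (F : W → W → ℝ) (p : W × W) : ℝ := F p.1 p.2 ^ 2

/-- `F²` is smooth off the zero section over `U`, is homogeneous of degree two, and has a
nondegenerate vertical Hessian. -/
structure IsFinslerOn (F : W → W → ℝ) (U : Set W) : Prop where
  isOpen : IsOpen U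
  smooth : ContDiffOn ℝ ∞ (energy F) (U ×ˢ {0}ᶜ)
  euler : ∀ x ∈ U, ∀ y ≠ 0, fderiv ℝ (energy F) (x, y) (0, y) = 2 * energy F (x, y)
  nondeg : ∀ x ∈ U, ∀ y ≠ 0, (fundTensor F x y).IsInvertible

namespace IsFinslerOn

variable {F : W → W → ℝ} {U : Set W} {x y : W}

theorem mem_nhds (hF : IsFinslerOn F U) (hx : x ∈ U) (hy : y ≠ 0) :
    U ×ˢ ({0}ᶜ : Set W) ∈ 𝓝 (x, y) :=
  (hF.isOpen.prod isOpen_compl_singleton).mem_nhds ⟨hx, hy⟩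

theorem contDiffAt (hF : IsFinslerOn F U) (hx : x ∈ U) (hy : y ≠ 0) :
    ContDiffAt ℝ ∞ (energy F) (x, y) :=
  hF.smooth.contDiffAt (hF.mem_nhds hx hy)

theorem contDiffAt_fderiv (hF : IsFinslerOn F U) (hx : x ∈ U) (hy : y ≠ 0) :
    ContDiffAt ℝ ∞ (fderiv ℝ (energy F)) (x, y) :=
  (hF.contDiffAt hx hy).fderiv_right (by simp)

theorem contDiffAt_fderiv_fderiv (hF : IsFinslerOn F U) (hx : x ∈ U) (hy : y ≠ 0) :
    ContDiffAt ℝ ∞ (fderiv ℝ (fderiv ℝ (energy F))) (x, y) :=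
  (hF.contDiffAt_fderiv hx hy).fderiv_right (by simp)

theorem fderiv_velocity (hF : IsFinslerOn F U) (hx : x ∈ U) (hy : y ≠ 0) :
    fderiv ℝ (fun z => F x z ^ 2) y =
      (fderiv ℝ (energy F) (x, y)).comp (ContinuousLinearMap.inr ℝ W W) :=
  (((hF.contDiffAt hx hy).differentiableAt (by simp)).hasFDerivAt.comp y
    (hasFDerivAt_prodMk_right x y)).fderiv

theorem fderiv_position (hF : IsFinslerOn F U) (hx : x ∈ U) (hy : y ≠ 0) :
    fderiv ℝ (fun z => F z y ^ 2) x =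
      (fderiv ℝ (energy F) (x, y)).comp (ContinuousLinearMap.inl ℝ W W) :=
  (HasFDerivAt.comp (f := fun z => (z, y)) x
    ((hF.contDiffAt hx hy).differentiableAt (by simp)).hasFDerivAt
    (hasFDerivAt_prodMk_left x y)).fderiv

theorem fundTensor_eq (hF : IsFinslerOn F U) (hx : x ∈ U) (hy : y ≠ 0) :
    fundTensor F x y = (1 / 2 : ℝ) •
      ((ContinuousLinearMap.compL ℝ W (W × W) ℝ).flip (ContinuousLinearMap.inr ℝ W W)).comp
        ((fderiv ℝ (fderiv ℝ (energy F)) (x, y)).comp (ContinuousLinearMap.inr ℝ W W)) := by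
  have h1 : fderiv ℝ (fun z => F x z ^ 2) =ᶠ[𝓝 y] fun z =>
      (fderiv ℝ (energy F) (x, z)).comp (ContinuousLinearMap.inr ℝ W W) := by
    filter_upwards [isOpen_compl_singleton.mem_nhds hy] with z hz using hF.fderiv_velocity hx hz
  have h2 := ((hF.contDiffAt_fderiv hx hy).differentiableAt (by simp)).hasFDerivAt.comp y
    (hasFDerivAt_prodMk_right x y)
  have h3 := ((ContinuousLinearMap.compL ℝ W (W × W) ℝ).flip
    (ContinuousLinearMap.inr ℝ W W)).hasFDerivAt.comp y h2
  rw [fundTensor, h1.fderiv_eq]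
  exact congrArg _ h3.fderiv

theorem fundTensor_apply (hF : IsFinslerOn F U) (hx : x ∈ U) (hy : y ≠ 0) (v w : W) :
    fundTensor F x y v w =
      1 / 2 * fderiv ℝ (fderiv ℝ (energy F)) (x, y) (0, v) (0, w) := by
  rw [hF.fundTensor_eq hx hy]
  rfl

set_option synthInstance.maxHeartbeats 200000 in
theorem fderiv_position_velocity (hF : IsFinslerOn F U) (hx : x ∈ U) (hy : y ≠ 0) (u v : W) :
    fderiv ℝ (fun x' => fderiv ℝ (fun z => F x' z ^ 2) y) x u v =
      fderiv ℝ (fderiv ℝ (energy F)) (x, y) (u, 0) (0, v) := by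
  have h1 : (fun x' => fderiv ℝ (fun z => F x' z ^ 2) y) =ᶠ[𝓝 x] fun x' =>
      (fderiv ℝ (energy F) (x', y)).comp (ContinuousLinearMap.inr ℝ W W) := by
    filter_upwards [hF.isOpen.mem_nhds hx] with z hz using hF.fderiv_velocity hz hy
  have h2 := HasFDerivAt.comp (f := fun z => (z, y)) x
    ((hF.contDiffAt_fderiv hx hy).differentiableAt (by simp)).hasFDerivAt
    (hasFDerivAt_prodMk_left x y)
  have h3 := ((ContinuousLinearMap.compL ℝ W (W × W) ℝ).flip
    (ContinuousLinearMap.inr ℝ W W)).hasFDerivAt.comp x h2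
  rw [h1.fderiv_eq]
  exact congrArg (fun T : W →L[ℝ] W →L[ℝ] ℝ => T u v) h3.fderiv

theorem symm_two (hF : IsFinslerOn F U) (hx : x ∈ U) (hy : y ≠ 0) (a b : W × W) :
    fderiv ℝ (fderiv ℝ (energy F)) (x, y) a b = fderiv ℝ (fderiv ℝ (energy F)) (x, y) b a :=
  ((hF.contDiffAt hx hy).isSymmSndFDerivAt
    (by rw [minSmoothness_of_isRCLikeNormedField]
        exact WithTop.coe_le_coe.2 (le_top : (2 : ℕ∞) ≤ ⊤))) a b

theorem symm_three_left (hF : IsFinslerOn F U) (hx : x ∈ U) (hy : y ≠ 0) (a b c : W × W) :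
    fderiv ℝ (fderiv ℝ (fderiv ℝ (energy F))) (x, y) a b c =
      fderiv ℝ (fderiv ℝ (fderiv ℝ (energy F))) (x, y) b a c :=
  congrArg (fun T : W × W →L[ℝ] ℝ => T c) (((hF.contDiffAt_fderiv hx hy).isSymmSndFDerivAt
    (by rw [minSmoothness_of_isRCLikeNormedField]
        exact WithTop.coe_le_coe.2 (le_top : (2 : ℕ∞) ≤ ⊤))) a b)

theorem fderiv_two_apply (hF : IsFinslerOn F U) (hx : x ∈ U) (hy : y ≠ 0) (a b c : W × W) :
    fderiv ℝ (fun p => fderiv ℝ (fderiv ℝ (energy F)) p b c) (x, y) a =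
      fderiv ℝ (fderiv ℝ (fderiv ℝ (energy F))) (x, y) a b c := by
  have h2 := (hF.contDiffAt_fderiv_fderiv hx hy).differentiableAt (by simp)
  rw [fderiv_clm_apply (h2.clm_apply (differentiableAt_const b)) (differentiableAt_const c),
    fderiv_clm_apply h2 (differentiableAt_const b)]
  simp

/-- The second derivative is symmetric at all nearby points, so its derivative is symmetric in the
last two slots. -/
theorem symm_three_right (hF : IsFinslerOn F U) (hx : x ∈ U) (hy : y ≠ 0) (a b c : W × W) :
    fderiv ℝ (fderiv ℝ (fderiv ℝ (energy F))) (x, y) a b c =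
      fderiv ℝ (fderiv ℝ (fderiv ℝ (energy F))) (x, y) a c b := by
  rw [← hF.fderiv_two_apply hx hy, ← hF.fderiv_two_apply hx hy]
  refine congrArg (fun T : W × W →L[ℝ] ℝ => T a) (Filter.EventuallyEq.fderiv_eq ?_)
  filter_upwards [hF.mem_nhds hx hy] with p hp using hF.symm_two hp.1 hp.2 b c

set_option synthInstance.maxHeartbeats 200000 in
theorem differentiableAt_fundTensor (hF : IsFinslerOn F U) (hx : x ∈ U) (hy : y ≠ 0) :
    DifferentiableAt ℝ (fun p : W × W => fundTensor F p.1 p.2) (x, y) := by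
  have h2 := (hF.contDiffAt_fderiv_fderiv hx hy).differentiableAt (by simp)
  refine DifferentiableAt.congr_of_eventuallyEq (f := fun p : W × W => ((1 / 2 : ℝ) •
      (ContinuousLinearMap.compL ℝ W (W × W) ℝ).flip (ContinuousLinearMap.inr ℝ W W)).comp
        ((fderiv ℝ (fderiv ℝ (energy F)) p).comp (ContinuousLinearMap.inr ℝ W W))) ?_ ?_
  · exact (differentiableAt_const _).clm_comp (h2.clm_comp (differentiableAt_const _))
  · filter_upwards [hF.mem_nhds hx hy] with p hp using hF.fundTensor_eq hp.1 hp.2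

theorem fderiv_fundTensor (hF : IsFinslerOn F U) (hx : x ∈ U) (hy : y ≠ 0) (a : W × W) (v w : W) :
    fderiv ℝ (fun p : W × W => fundTensor F p.1 p.2) (x, y) a v w =
      1 / 2 * fderiv ℝ (fderiv ℝ (fderiv ℝ (energy F))) (x, y) a (0, v) (0, w) := by
  have h0 := hF.differentiableAt_fundTensor hx hy
  have h1 : fderiv ℝ (fun p : W × W => fundTensor F p.1 p.2 v w) (x, y) a =
      fderiv ℝ (fun p : W × W => fundTensor F p.1 p.2) (x, y) a v w := by
    rw [fderiv_clm_apply (h0.clm_apply (differentiableAt_const v)) (differentiableAt_const w),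
      fderiv_clm_apply h0 (differentiableAt_const v)]
    simp
  have h2 : (fun p : W × W => fundTensor F p.1 p.2 v w) =ᶠ[𝓝 (x, y)] fun p =>
      1 / 2 * fderiv ℝ (fderiv ℝ (energy F)) p (0, v) (0, w) := by
    filter_upwards [hF.mem_nhds hx hy] with p hp using hF.fundTensor_apply hp.1 hp.2 v w
  have h3 : DifferentiableAt ℝ (fun p => fderiv ℝ (fderiv ℝ (energy F)) p (0, v) (0, w)) (x, y) :=
    (((hF.contDiffAt_fderiv_fderiv hx hy).differentiableAt (by simp)).clm_apply
      (differentiableAt_const _)).clm_apply (differentiableAt_const _)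
  rw [← h1, h2.fderiv_eq, fderiv_const_mul h3, smul_apply, hF.fderiv_two_apply hx hy, smul_eq_mul]

/-- Lowering the index removes the inverse fundamental tensor, so the spray can be handled through
derivatives of F² alone. -/
theorem fundTensor_spray (hF : IsFinslerOn F U) (hx : x ∈ U) (hy : y ≠ 0) (v : W) :
    fundTensor F x y (spray F x y) v = 1 / 4 *
      (fderiv ℝ (fderiv ℝ (energy F)) (x, y) (y, 0) (0, v) - fderiv ℝ (energy F) (x, y) (v, 0)) := by
  rw [spray, map_smul, (hF.nondeg x hx y hy).self_apply_inverse, smul_apply,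
    sub_apply, hF.fderiv_position_velocity hx hy, hF.fderiv_position hx hy]
  rfl

/-- Differentiating an identity between the first derivatives of `F²` in a vertical direction. -/
theorem fderiv_of_eventually (hF : IsFinslerOn F U) (hx : x ∈ U) (hy : y ≠ 0)
    {f₁ f₂ : W → W × W} {f₁' f₂' : W →L[ℝ] W × W} (h₁ : HasFDerivAt f₁ f₁' y)
    (h₂ : HasFDerivAt f₂ f₂' y)
    (h : ∀ z ≠ 0, fderiv ℝ (energy F) (x, z) (f₁ z) = fderiv ℝ (energy F) (x, z) (f₂ z)) (v : W) :
    fderiv ℝ (fderiv ℝ (energy F)) (x, y) (0, v) (f₁ y) + fderiv ℝ (energy F) (x, y) (f₁' v) =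
      fderiv ℝ (fderiv ℝ (energy F)) (x, y) (0, v) (f₂ y) +
        fderiv ℝ (energy F) (x, y) (f₂' v) := by
  have h1 : (fun z => fderiv ℝ (energy F) (x, z) (f₁ z)) =ᶠ[𝓝 y]
      fun z => fderiv ℝ (energy F) (x, z) (f₂ z) := by
    filter_upwards [isOpen_compl_singleton.mem_nhds hy] with z hz using h z hz
  have h2 := ((hF.contDiffAt_fderiv hx hy).differentiableAt (by simp)).hasFDerivAt.comp y
    (hasFDerivAt_prodMk_right x y)
  have h3 := congrArg (fun T : W →L[ℝ] ℝ => T v)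
    (((h2.clm_apply h₁).fderiv.symm.trans h1.fderiv_eq).trans (h2.clm_apply h₂).fderiv)
  simp at h3
  linarith

section Parallel

variable {Γ : W → W →L[ℝ] W →L[ℝ] W}

/-- The hypothesis `hP` says that the horizontal derivative of F² for Γ vanishes. It is
differentiated in the velocity; the last term arises because Γ x u y is linear in y. -/
theorem fderiv_parallel (hF : IsFinslerOn F U)
    (hP : ∀ x ∈ U, ∀ y ≠ 0, ∀ u,
      fderiv ℝ (energy F) (x, y) (u, 0) = fderiv ℝ (energy F) (x, y) (0, Γ x u y))
    (hx : x ∈ U) (hy : y ≠ 0) (u v : W) :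
    fderiv ℝ (fderiv ℝ (energy F)) (x, y) (0, v) (u, 0) =
      fderiv ℝ (fderiv ℝ (energy F)) (x, y) (0, v) (0, Γ x u y) +
        fderiv ℝ (energy F) (x, y) (0, Γ x u v) := by
  have h1 := hF.fderiv_of_eventually hx hy (hasFDerivAt_const (u, (0 : W)) y)
    ((ContinuousLinearMap.inr ℝ W W).comp (Γ x u)).hasFDerivAt (fun z hz => hP x hx z hz u) v
  simpa using h1

theorem fderiv_fderiv_parallel (hF : IsFinslerOn F U)
    (hP : ∀ x ∈ U, ∀ y ≠ 0, ∀ u,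
      fderiv ℝ (energy F) (x, y) (u, 0) = fderiv ℝ (energy F) (x, y) (0, Γ x u y))
    (hx : x ∈ U) (hy : y ≠ 0) (u v w : W) :
    fderiv ℝ (fderiv ℝ (fderiv ℝ (energy F))) (x, y) (0, w) (0, v) (u, 0) =
      fderiv ℝ (fderiv ℝ (fderiv ℝ (energy F))) (x, y) (0, w) (0, v) (0, Γ x u y) +
        fderiv ℝ (fderiv ℝ (energy F)) (x, y) (0, v) (0, Γ x u w) +
        fderiv ℝ (fderiv ℝ (energy F)) (x, y) (0, w) (0, Γ x u v) := by
  have h1 : (fun z => fderiv ℝ (fderiv ℝ (energy F)) (x, z) (0, v) (u, 0)) =ᶠ[𝓝 y]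
      fun z => fderiv ℝ (fderiv ℝ (energy F)) (x, z) (0, v) (0, Γ x u z) +
        fderiv ℝ (energy F) (x, z) (0, Γ x u v) := by
    filter_upwards [isOpen_compl_singleton.mem_nhds hy] with z hz
      using hF.fderiv_parallel hP hx hz u v
  have h2 := ((hF.contDiffAt_fderiv hx hy).differentiableAt (by simp)).hasFDerivAt.comp y
    (hasFDerivAt_prodMk_right x y)
  have h3 := ((hF.contDiffAt_fderiv_fderiv hx hy).differentiableAt (by simp)).hasFDerivAt.comp y
    (hasFDerivAt_prodMk_right x y)
  have h4 := h3.clm_apply (hasFDerivAt_const ((0 : W), v) y)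
  have h5 := h4.clm_apply (hasFDerivAt_const (u, (0 : W)) y)
  have h6 := (h4.clm_apply ((ContinuousLinearMap.inr ℝ W W).comp (Γ x u)).hasFDerivAt).add
    (h2.clm_apply (hasFDerivAt_const ((0 : W), Γ x u v) y))
  have h7 := congrArg (fun T : W →L[ℝ] ℝ => T w)
    ((h5.fderiv.symm.trans h1.fderiv_eq).trans h6.fderiv)
  simp at h7
  linarith

/-- Substituting `hP` and its velocity derivative into the formula of `fundTensor_spray` leaves the
Hessian term at Γ x y y; the first order terms cancel by symmetry of Γ. -/
theorem spray_eq (hF : IsFinslerOn F U) (hΓ : ∀ x ∈ U, ∀ u v, Γ x u v = Γ x v u)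
    (hP : ∀ x ∈ U, ∀ y ≠ 0, ∀ u,
      fderiv ℝ (energy F) (x, y) (u, 0) = fderiv ℝ (energy F) (x, y) (0, Γ x u y))
    (hx : x ∈ U) (hy : y ≠ 0) : spray F x y = (1 / 2 : ℝ) • Γ x y y := by
  refine (hF.nondeg x hx y hy).injective ?_
  ext v
  rw [hF.fundTensor_spray hx hy, map_smul, smul_apply, hF.fundTensor_apply hx hy,
    hP x hx y hy v, hF.symm_two hx hy (y, 0), hF.fderiv_parallel hP hx hy, hΓ x hx v y,
    hF.symm_two hx hy (0, v), smul_eq_mul]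
  ring

theorem nonlinConn_eq (hF : IsFinslerOn F U) (hΓ : ∀ x ∈ U, ∀ u v, Γ x u v = Γ x v u)
    (hP : ∀ x ∈ U, ∀ y ≠ 0, ∀ u,
      fderiv ℝ (energy F) (x, y) (u, 0) = fderiv ℝ (energy F) (x, y) (0, Γ x u y))
    (hx : x ∈ U) (hy : y ≠ 0) (u : W) : nonlinConn F x y u = Γ x u y := by
  have h1 : spray F x =ᶠ[𝓝 y] fun z => (1 / 2 : ℝ) • Γ x z z := by
    filter_upwards [isOpen_compl_singleton.mem_nhds hy] with z hz using hF.spray_eq hΓ hP hx hz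
  have h2 := (((Γ x).hasFDerivAt (x := y)).clm_apply (hasFDerivAt_id y)).const_smul (1 / 2 : ℝ)
  rw [nonlinConn, h1.fderiv_eq]
  refine (congrArg (fun T : W →L[ℝ] W => T u) h2.fderiv).trans ?_
  simp [hΓ x hx y u, ← two_smul ℝ]

-- The fundamental tensor inherits parallelism from F²: this is `hP` differentiated twice in the
-- velocity, with the third derivative along Γ x u y absorbed by the nonlinear connection.
set_option synthInstance.maxHeartbeats 200000 in
theorem horDeriv_fundTensor (hF : IsFinslerOn F U) (hΓ : ∀ x ∈ U, ∀ u v, Γ x u v = Γ x v u)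
    (hP : ∀ x ∈ U, ∀ y ≠ 0, ∀ u,
      fderiv ℝ (energy F) (x, y) (u, 0) = fderiv ℝ (energy F) (x, y) (0, Γ x u y))
    (hx : x ∈ U) (hy : y ≠ 0) (u v w : W) :
    horDeriv F (fundTensor F) x y u v w =
      fundTensor F x y (Γ x u v) w + fundTensor F x y v (Γ x u w) := by
  have h0 := (hF.differentiableAt_fundTensor hx hy).hasFDerivAt
  have hl : HasFDerivAt (fun z : W => (z, y)) (ContinuousLinearMap.inl ℝ W W) x :=
    hasFDerivAt_prodMk_left x y
  have hc : HasFDerivAt (fun x' => fundTensor F x' y)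
      ((fderiv ℝ (fun p : W × W => fundTensor F p.1 p.2) (x, y)).comp
        (ContinuousLinearMap.inl ℝ W W)) x := 
    HasFDerivAt.comp (G := W →L[ℝ] W →L[ℝ] ℝ) (f := fun z : W => (z, y))
      (g := fun p : W × W => fundTensor F p.1 p.2) x h0 hl
  have hr' : HasFDerivAt (fun z : W => (x, z)) (ContinuousLinearMap.inr ℝ W W) y :=
    hasFDerivAt_prodMk_right x y
  have hr : HasFDerivAt (fun z => fundTensor F x z)
      ((fderiv ℝ (fun p : W × W => fundTensor F p.1 p.2) (x, y)).comp
        (ContinuousLinearMap.inr ℝ W W)) y :=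
    HasFDerivAt.comp (G := W →L[ℝ] W →L[ℝ] ℝ) (f := fun z : W => (x, z))
      (g := fun p : W × W => fundTensor F p.1 p.2) y h0 hr'
  have h1 : fderiv ℝ (fun x' => fundTensor F x' y) x =
      (fderiv ℝ (fun p : W × W => fundTensor F p.1 p.2) (x, y)).comp
        (ContinuousLinearMap.inl ℝ W W) := hc.fderiv
  have h2 : fderiv ℝ (fundTensor F x) y =
      (fderiv ℝ (fun p : W × W => fundTensor F p.1 p.2) (x, y)).comp
        (ContinuousLinearMap.inr ℝ W W) := hr.fderiv
  rw [horDeriv, h1, h2]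
  simp only [sub_apply, ContinuousLinearMap.comp_apply, ContinuousLinearMap.inl_apply,
    ContinuousLinearMap.inr_apply, hF.nonlinConn_eq hΓ hP hx hy, hF.fderiv_fundTensor hx hy,
    hF.fundTensor_apply hx hy]
  have h3 := hF.fderiv_fderiv_parallel hP hx hy u v w
  rw [hF.symm_three_right hx hy _ _ (u, 0), hF.symm_three_left hx hy _ (u, 0),
    hF.symm_three_right hx hy _ _ (0, v), hF.symm_three_right hx hy _ _ (0, Γ x u y),
    hF.symm_three_left hx hy _ (0, Γ x u y), hF.symm_three_right hx hy _ (0, w) (0, v)] at h3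
  rw [hF.symm_two hx hy (0, Γ x u v), h3]
  ring

/-- The Koszul argument of `christoffel_eq`, with horizontal derivatives of the fundamental tensor
in place of derivatives of a metric. -/
theorem chern_eq (hF : IsFinslerOn F U) (hΓ : ∀ x ∈ U, ∀ u v, Γ x u v = Γ x v u)
    (hP : ∀ x ∈ U, ∀ y ≠ 0, ∀ u,
      fderiv ℝ (energy F) (x, y) (u, 0) = fderiv ℝ (energy F) (x, y) (0, Γ x u y))
    (hx : x ∈ U) (hy : y ≠ 0) (u v : W) : chern F x y u v = Γ x u v := by
  have h1 : horDeriv F (fundTensor F) x y u v + horDeriv F (fundTensor F) x y v u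
      - ((horDeriv F (fundTensor F) x y).flip u).flip v
      = fundTensor F x y ((2 : ℝ) • Γ x u v) := by
    ext w
    simp only [add_apply, sub_apply, ContinuousLinearMap.flip_apply,
      hF.horDeriv_fundTensor hΓ hP hx hy]
    have hs : ∀ a b, fundTensor F x y a b = fundTensor F x y b a := fun a b => by
      rw [hF.fundTensor_apply hx hy, hF.fundTensor_apply hx hy, hF.symm_two hx hy]
    rw [hΓ x hx v u, hΓ x hx w u, hΓ x hx w v, hs (Γ x u w) v, map_smul, smul_apply, smul_eq_mul]
    ring
  rw [chern, h1, (hF.nondeg x hx y hy).inverse_apply_self, smul_smul]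
  norm_num

/-- The Chern coefficients do not depend on the velocity, so the vertical part of the horizontal
derivative vanishes and the two curvature formulas agree term by term. -/
theorem chernCurv_eq (hF : IsFinslerOn F U) {h : W → W →L[ℝ] W →L[ℝ] ℝ}
    (hc : ∀ x ∈ U, ∀ u v, christoffel h x u v = Γ x u v)
    (hΓ : ∀ x ∈ U, ∀ u v, Γ x u v = Γ x v u)
    (hP : ∀ x ∈ U, ∀ y ≠ 0, ∀ u,
      fderiv ℝ (energy F) (x, y) (u, 0) = fderiv ℝ (energy F) (x, y) (0, Γ x u y))
    (hx : x ∈ U) (hy : y ≠ 0) (u v w : W) :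
    chernCurv F x y u v w = riemannCurv h x u v w := by
  have h1 : ∀ a b, (fun x' => chern F x' y a b) =ᶠ[𝓝 x] fun x' => christoffel h x' a b := by
    intro a b
    filter_upwards [hF.isOpen.mem_nhds hx] with z hz
    rw [hF.chern_eq hΓ hP hz hy, hc z hz]
  have h2 : ∀ a b, (fun y' => chern F x y' a b) =ᶠ[𝓝 y] fun _ => christoffel h x a b := by
    intro a b
    filter_upwards [isOpen_compl_singleton.mem_nhds hy] with z hz
    rw [hF.chern_eq hΓ hP hx hz, hc x hx]
  have h3 : ∀ a b, horDeriv F (fun x' y' => chern F x' y' a b) x y =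
      fderiv ℝ (fun x' => christoffel h x' a b) x := by
    intro a b
    rw [horDeriv, (h1 a b).fderiv_eq, (h2 a b).fderiv_eq, fderiv_fun_const]
    ext
    simp
  simp only [chernCurv, riemannCurv, h3, hF.chern_eq hΓ hP hx hy, hc x hx]

end Parallel

/-- If the spray of `F` is that of a symmetric connection, then `F²` is parallel for it. -/
theorem parallel_of_spray_eq (hF : IsFinslerOn F U) (hx : x ∈ U) {B : W →L[ℝ] W →L[ℝ] W}
    (hB : ∀ u v, B u v = B v u) (hs : ∀ y ≠ 0, spray F x y = (1 / 2 : ℝ) • B y y) (hy : y ≠ 0)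
    (u : W) : fderiv ℝ (energy F) (x, y) (u, 0) = fderiv ℝ (energy F) (x, y) (0, B u y) := by
  have h1 : ∀ z ≠ 0, ∀ v, fderiv ℝ (fderiv ℝ (energy F)) (x, z) (0, v) (0, B z z) =
      fderiv ℝ (fderiv ℝ (energy F)) (x, z) (0, v) (z, 0) - fderiv ℝ (energy F) (x, z) (v, 0) := by
    intro z hz v
    have h := hF.fundTensor_spray hx hz v
    rw [hs z hz, map_smul, smul_apply, hF.fundTensor_apply hx hz, smul_eq_mul] at h
    rw [hF.symm_two hx hz (0, v), hF.symm_two hx hz (0, v)]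
    linarith
  -- Euler's identity differentiated in both position and velocity.
  have h2 : ∀ z ≠ 0, ∀ a : W × W, fderiv ℝ (fderiv ℝ (energy F)) (x, z) a (0, z) =
      2 * fderiv ℝ (energy F) (x, z) a - fderiv ℝ (energy F) (x, z) (0, a.2) := by
    intro z hz a
    have e1 : (fun p : W × W => fderiv ℝ (energy F) p (0, p.2)) =ᶠ[𝓝 (x, z)]
        fun p => 2 * energy F p := by
      filter_upwards [hF.mem_nhds hx hz] with p hp using hF.euler p.1 hp.1 p.2 hp.2
    have e2 := ((hF.contDiffAt_fderiv hx hz).differentiableAt (by simp)).hasFDerivAt.clm_apply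
      (((ContinuousLinearMap.inr ℝ W W).comp (ContinuousLinearMap.snd ℝ W W)).hasFDerivAt
        (x := (x, z)))
    have e3 := ((hF.contDiffAt hx hz).differentiableAt (by simp)).hasFDerivAt.const_mul 2
    have e4 := congrArg (fun T : W × W →L[ℝ] ℝ => T a)
      ((e2.fderiv.symm.trans e1.fderiv_eq).trans e3.fderiv)
    simp at e4
    linarith
  -- Taking v = z in `h1` and applying `h2` gives the claim in the direction u = z only.
  have h3 : ∀ z ≠ 0, fderiv ℝ (energy F) (x, z) (0, B z z) = fderiv ℝ (energy F) (x, z) (z, 0) := by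
    intro z hz
    have e1 := h1 z hz z
    have e2 := h2 z hz (0, B z z)
    have e3 := h2 z hz (z, 0)
    rw [hF.symm_two hx hz] at e2 e3
    rw [e2, e3] at e1
    simp only [Prod.mk_zero_zero, map_zero] at e1
    linarith
  have hBB := (B.hasFDerivAt (x := y)).clm_apply (hasFDerivAt_id y)
  -- Polarisation: the velocity derivative of `h3` in the direction u, compared with `h1` for v = u,
  -- gives the claim for every u.
  have h4 := hF.fderiv_of_eventually hx hy
    ((ContinuousLinearMap.inr ℝ W W).hasFDerivAt.comp y hBB)
    (ContinuousLinearMap.inl ℝ W W).hasFDerivAt h3 u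
  have h5 := h1 y hy u
  simp [hB y u] at h4
  have h6 : ((0 : W), B u y + B u y) = (2 : ℝ) • ((0 : W), B u y) := by
    rw [two_smul]; simp
  rw [h6, map_smul, smul_eq_mul] at h4
  linarith

end IsFinslerOn

end LocalFinsler

/-! ### The Minkowski norm α φ(β/α) and its Hessian -/

theorem IsAlphaBetaProfile.contDiffAt {φ : ℝ → ℝ} {b₀ s : ℝ} (hφ : IsAlphaBetaProfile φ b₀)
    (hs : |s| < b₀) : ContDiffAt ℝ ∞ φ s :=
  hφ.smooth.contDiffAt (isOpen_Ioo.mem_nhds (abs_lt.1 hs))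

theorem IsAlphaBetaProfile.hasDerivAt {φ : ℝ → ℝ} {b₀ s : ℝ} (hφ : IsAlphaBetaProfile φ b₀)
    (hs : |s| < b₀) : HasDerivAt φ (deriv φ s) s :=
  ((hφ.contDiffAt hs).differentiableAt (by simp)).hasDerivAt

theorem IsAlphaBetaProfile.hasDerivAt_deriv {φ : ℝ → ℝ} {b₀ s : ℝ} (hφ : IsAlphaBetaProfile φ b₀)
    (hs : |s| < b₀) : HasDerivAt (deriv φ) (deriv (deriv φ) s) s :=
  (((hφ.smooth.deriv_of_isOpen (m := ∞) isOpen_Ioo (by simp)).contDiffAt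
    (isOpen_Ioo.mem_nhds (abs_lt.1 hs))).differentiableAt (by simp)).hasDerivAt

/-- The convexity condition at its extreme b = |s|. -/
theorem IsAlphaBetaProfile.sub_pos {φ : ℝ → ℝ} {b₀ s : ℝ} (hφ : IsAlphaBetaProfile φ b₀)
    (hs : |s| < b₀) : 0 < φ s - s * deriv φ s := by
  have h := hφ.convex s |s| le_rfl hs
  rwa [sq_abs, sub_self, zero_mul, add_zero] at h

section Minkowski

variable {L : Type*} [NormedAddCommGroup L] [NormedSpace ℝ L] [FiniteDimensional ℝ L]
  {m : L →L[ℝ] L →L[ℝ] ℝ} {X : L} {φ : ℝ → ℝ} {b₀ : ℝ}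

theorem IsInnerForm.nonneg (hm : IsInnerForm m) (a : L) : 0 ≤ m a a := by
  rcases eq_or_ne a 0 with rfl | h
  · simp
  · exact (hm.pos a h).le

theorem IsInnerForm.sq_le (hm : IsInnerForm m) (a b : L) : m a b ^ 2 ≤ m a a * m b b := by
  rcases eq_or_ne b 0 with rfl | h
  · simp
  have hb := hm.pos b h
  have h1 := hm.nonneg (m b b • a - m a b • b)
  simp only [map_sub, map_smul, sub_apply, smul_apply, smul_eq_mul, hm.symm b a] at h1
  have h2 : 0 ≤ m b b * (m a a * m b b - m a b ^ 2) := by linarith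
  have h3 := nonneg_of_mul_nonneg_right h2 hb
  linarith

/-- The Cauchy-Schwarz inequality in the orthogonal complement of `y`. -/
theorem IsInnerForm.sq_mul_le (hm : IsInnerForm m) (a y w : L) (h : m y w = 0) :
    m a w ^ 2 * m y y ≤ (m a a * m y y - m a y ^ 2) * m w w := by
  rcases eq_or_ne y 0 with rfl | hy
  · simp
  have hb := hm.pos y hy
  have h1 := hm.sq_le (m y y • a - m a y • y) w
  simp only [map_sub, map_smul, sub_apply, smul_apply, smul_eq_mul, hm.symm y a, h] at h1
  have h2 : 0 ≤ m y y * ((m a a * m y y - m a y ^ 2) * m w w - m a w ^ 2 * m y y) := by linarith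
  have h3 := nonneg_of_mul_nonneg_right h2 hb
  linarith

variable (m X) in
/-- The ratio `β / α`. -/
def slope (y : L) : ℝ := m X y / √(m y y)

variable (m X φ) in
/-- The square of the Minkowski norm `α φ(β/α)`. -/
def sqNorm (y : L) : ℝ := m y y * φ (slope m X y) ^ 2

theorem IsInnerForm.sqrt_pos (hm : IsInnerForm m) {y : L} (hy : y ≠ 0) : 0 < √(m y y) :=
  Real.sqrt_pos.2 (hm.pos y hy)

theorem IsInnerForm.sqrt_mul_self (hm : IsInnerForm m) (y : L) : √(m y y) * √(m y y) = m y y :=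
  Real.mul_self_sqrt (hm.nonneg y)

theorem IsInnerForm.slope_mul (hm : IsInnerForm m) {y : L} (hy : y ≠ 0) :
    slope m X y * √(m y y) = m X y := by
  rw [slope, div_mul_cancel₀ _ (hm.sqrt_pos hy).ne']

/-- Cauchy-Schwarz; it keeps every slope inside the domain of φ. -/
theorem IsInnerForm.abs_slope_le (hm : IsInnerForm m) {y : L} (hy : y ≠ 0) :
    |slope m X y| ≤ √(m X X) := by
  rw [slope, abs_div, abs_of_pos (hm.sqrt_pos hy), div_le_iff₀ (hm.sqrt_pos hy),
    ← Real.sqrt_mul (hm.nonneg X), ← Real.sqrt_sq_eq_abs]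
  exact Real.sqrt_le_sqrt (hm.sq_le X y)

theorem contDiffAt_sqNorm (hm : IsInnerForm m) (hφ : IsAlphaBetaProfile φ b₀)
    (hX : √(m X X) < b₀) {y : L} (hy : y ≠ 0) : ContDiffAt ℝ ∞ (sqNorm m X φ) y := by
  have ha : ContDiffAt ℝ ∞ (fun z => m z z) y := m.contDiff.contDiffAt.clm_apply contDiffAt_id
  have hs : ContDiffAt ℝ ∞ (slope m X) y :=
    (m X).contDiff.contDiffAt.div (ha.sqrt (hm.pos y hy).ne') (hm.sqrt_pos hy).ne'
  exact ha.mul (((hφ.contDiffAt ((hm.abs_slope_le hy).trans_lt hX)).comp y hs).pow 2)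

/-- To first order α does not change in directions orthogonal to y, which is what keeps
`hessian_sqNorm` short. -/
theorem hasDerivAt_line (w y : L) (hy : m y w = 0) (hs : ∀ a b, m a b = m b a) :
    HasDerivAt (fun t : ℝ => m (y + t • w) (y + t • w)) 0 0 := by
  have h : (fun t : ℝ => m (y + t • w) (y + t • w)) = fun t => m y y + m w w * t ^ 2 := by
    funext t
    simp [hy, hs w y]
    ring
  rw [h]
  simpa using ((hasDerivAt_pow 2 (0 : ℝ)).const_mul (m w w)).const_add (m y y)

theorem fderiv_sqNorm (hm : IsInnerForm m) (hφ : IsAlphaBetaProfile φ b₀) (hX : √(m X X) < b₀)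
    {y : L} (hy : y ≠ 0) (v : L) :
    fderiv ℝ (sqNorm m X φ) y v =
      2 * φ (slope m X y) * (φ (slope m X y) - slope m X y * deriv φ (slope m X y)) * m y v +
        2 * √(m y y) * φ (slope m X y) * deriv φ (slope m X y) * m X v := by
  have hα := hm.sqrt_pos hy
  have ha : HasFDerivAt (fun z => m z z) ((2 : ℝ) • m y) y := by
    refine (m.hasFDerivAt.clm_apply (hasFDerivAt_id y)).congr_fderiv ?_
    ext w
    simp [hm.symm w y]
    ring
  have hs : HasFDerivAt (slope m X) _ y := ((m X).hasFDerivAt (x := y)).mul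
    ((hasDerivAt_inv hα.ne').comp_hasFDerivAt y (ha.sqrt (hm.pos y hy).ne'))
  have hd := hφ.hasDerivAt ((hm.abs_slope_le hy).trans_lt hX)
  have h1 := (ha.mul ((hd.comp_hasFDerivAt y hs).pow 2)).fderiv
  refine (congrArg (fun T : L →L[ℝ] ℝ => T v) h1).trans ?_
  have h2 : m X y = slope m X y * √(m y y) := (hm.slope_mul hy).symm
  have h3 : m y y = √(m y y) * √(m y y) := (hm.sqrt_mul_self y).symm
  simp
  rw [h2]
  generalize slope m X y = s at *
  generalize √(m y y) = α at *
  rw [h3]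
  field_simp
  ring

theorem hessian_sqNorm_comm (hm : IsInnerForm m) (hφ : IsAlphaBetaProfile φ b₀)
    (hX : √(m X X) < b₀) {y : L} (hy : y ≠ 0) (v w : L) :
    fderiv ℝ (fderiv ℝ (sqNorm m X φ)) y v w = fderiv ℝ (fderiv ℝ (sqNorm m X φ)) y w v :=
  ((contDiffAt_sqNorm hm hφ hX hy).isSymmSndFDerivAt
    (by rw [minSmoothness_of_isRCLikeNormedField]
        exact WithTop.coe_le_coe.2 (le_top : (2 : ℕ∞) ≤ ⊤))) v w

theorem differentiableAt_fderiv_sqNorm (hm : IsInnerForm m) (hφ : IsAlphaBetaProfile φ b₀)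
    (hX : √(m X X) < b₀) {y : L} (hy : y ≠ 0) :
    DifferentiableAt ℝ (fderiv ℝ (sqNorm m X φ)) y :=
  ((contDiffAt_sqNorm hm hφ hX hy).fderiv_right (m := ∞) (by simp)).differentiableAt (by simp)

theorem fderiv_sqNorm_self (hm : IsInnerForm m) (hφ : IsAlphaBetaProfile φ b₀)
    (hX : √(m X X) < b₀) {y : L} (hy : y ≠ 0) :
    fderiv ℝ (sqNorm m X φ) y y = 2 * sqNorm m X φ y := by
  rw [fderiv_sqNorm hm hφ hX hy, sqNorm, ← hm.slope_mul (X := X) hy]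
  linear_combination (2 * slope m X y * φ (slope m X y) * deriv φ (slope m X y)) *
    hm.sqrt_mul_self y

/-- Derivative of Euler's relation `fderiv_sqNorm_self`. -/
theorem hessian_sqNorm_self (hm : IsInnerForm m) (hφ : IsAlphaBetaProfile φ b₀)
    (hX : √(m X X) < b₀) {y : L} (hy : y ≠ 0) (v : L) :
    fderiv ℝ (fderiv ℝ (sqNorm m X φ)) y v y = fderiv ℝ (sqNorm m X φ) y v := by
  have e1 : (fun z => fderiv ℝ (sqNorm m X φ) z z) =ᶠ[𝓝 y] fun z => 2 * sqNorm m X φ z := by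
    filter_upwards [isOpen_compl_singleton.mem_nhds hy] with z hz
      using fderiv_sqNorm_self hm hφ hX hz
  have e2 := (differentiableAt_fderiv_sqNorm hm hφ hX hy).hasFDerivAt.clm_apply (hasFDerivAt_id y)
  have e3 := ((contDiffAt_sqNorm hm hφ hX hy).differentiableAt (by simp)).hasFDerivAt.const_mul 2
  have e4 := congrArg (fun T : L →L[ℝ] ℝ => T v)
    ((e2.fderiv.symm.trans e1.fderiv_eq).trans e3.fderiv)
  simp at e4
  linarith

/-- One argument is taken orthogonal to y: along y + t w the norm α is stationary and the slope
moves at rate m X w / α, so the first derivative formula can be differentiated along a line. The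
direction y is covered by `hessian_sqNorm_self`. -/
theorem hessian_sqNorm (hm : IsInnerForm m) (hφ : IsAlphaBetaProfile φ b₀)
    (hX : √(m X X) < b₀) {y w : L} (hy : y ≠ 0) (hw : m y w = 0) (v : L) :
    fderiv ℝ (fderiv ℝ (sqNorm m X φ)) y w v =
      2 * φ (slope m X y) * (φ (slope m X y) - slope m X y * deriv φ (slope m X y)) * m w v +
      2 * (φ (slope m X y) * deriv (deriv φ) (slope m X y) + deriv φ (slope m X y) ^ 2) *
        m X w * m X v +
      2 * (φ (slope m X y) * deriv φ (slope m X y) - slope m X y *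
        (φ (slope m X y) * deriv (deriv φ) (slope m X y) + deriv φ (slope m X y) ^ 2)) *
        (m X w / √(m y y)) * m y v := by
  have hα := hm.sqrt_pos hy
  have hy0 : y + (0 : ℝ) • w = y := by simp
  have hl : HasDerivAt (fun t : ℝ => y + t • w) w 0 := by
    simpa using ((hasDerivAt_id (0 : ℝ)).smul_const w).const_add y
  have h1 : HasDerivAt (fun t : ℝ => fderiv ℝ (sqNorm m X φ) (y + t • w) v)
      (fderiv ℝ (fderiv ℝ (sqNorm m X φ)) y w v) 0 := by
    have e1 := (differentiableAt_fderiv_sqNorm hm hφ hX hy).hasFDerivAt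
    have e2 := e1.clm_apply (hasFDerivAt_const v y)
    have e3 := e2.comp_hasDerivAt_of_eq (0 : ℝ) hl hy0.symm
    rw [ContinuousLinearMap.comp_zero, zero_add, ContinuousLinearMap.flip_apply] at e3
    exact e3
  have ha : HasDerivAt (fun t : ℝ => m (y + t • w) (y + t • w)) 0 0 :=
    hasDerivAt_line w y hw hm.symm
  have hsq : HasDerivAt (fun t : ℝ => √(m (y + t • w) (y + t • w))) 0 0 := by
    have e := ha.sqrt (by rw [hy0]; exact (hm.pos y hy).ne')
    simpa using e
  have hβ : ∀ u, HasDerivAt (fun t : ℝ => m u (y + t • w)) (m u w) 0 := fun u =>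
    (m u).hasFDerivAt.comp_hasDerivAt (0 : ℝ) hl
  have hβ' : HasDerivAt (fun t : ℝ => m (y + t • w) v) (m w v) 0 := by
    simpa only [hm.symm _ v] using hβ v
  have hs : HasDerivAt (fun t : ℝ => slope m X (y + t • w)) (m X w / √(m y y)) 0 := by
    have e := (hβ X).div hsq (by rw [hy0]; exact hα.ne')
    rw [hy0, mul_zero, sub_zero, pow_two, mul_div_mul_right _ _ hα.ne'] at e
    exact e
  have hlt := (hm.abs_slope_le (X := X) hy).trans_lt hX
  have hd := hφ.hasDerivAt hlt
  have hd' := hφ.hasDerivAt_deriv hlt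
  rw [← hy0] at hd hd'
  have hφs := hd.comp (0 : ℝ) hs
  have hφs' := hd'.comp (0 : ℝ) hs
  have h2 := ((((hφs.const_mul 2).mul (hφs.sub (hs.mul hφs'))).mul hβ')).add
    ((((hsq.const_mul 2).mul hφs).mul hφs').mul (hasDerivAt_const (0 : ℝ) (m X v)))
  have h4 := h1.unique (h2.congr_of_eventuallyEq (by
    filter_upwards [hl.continuousAt.preimage_mem_nhds
      (isOpen_compl_singleton.mem_nhds (show y + (0 : ℝ) • w ≠ 0 by rwa [hy0]))] with t ht
    exact fderiv_sqNorm hm hφ hX ht v))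
  rw [h4]
  simp
  field_simp
  ring

/-- Clear if φ'' ≥ 0. If φ'' < 0, Cauchy-Schwarz in the complement of y bounds (m X w)² by (m X X -
s²) m w w, and the convexity condition at b = √(m X X) concludes. -/
theorem convex_pos (hm : IsInnerForm m) (hφ : IsAlphaBetaProfile φ b₀)
    (hX : √(m X X) < b₀) {y w : L} (hy : y ≠ 0) (hw : m y w = 0) (hw0 : w ≠ 0) :
    0 < (φ (slope m X y) - slope m X y * deriv φ (slope m X y)) * m w w +
      deriv (deriv φ) (slope m X y) * m X w ^ 2 := by
  have hle := hm.abs_slope_le (X := X) hy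
  have hq := hφ.sub_pos (hle.trans_lt hX)
  have hc := hφ.convex _ _ hle hX
  rw [Real.sq_sqrt (hm.nonneg X)] at hc
  have hww := hm.pos w hw0
  have hyy := hm.pos y hy
  have h1 : m X w ^ 2 ≤ (m X X - slope m X y ^ 2) * m w w := by
    have e := hm.sq_mul_le X y w hw
    rw [← hm.slope_mul (X := X) hy, mul_pow, Real.sq_sqrt hyy.le] at e
    refine le_of_mul_le_mul_right ?_ hyy
    linarith
  rcases le_or_gt 0 (deriv (deriv φ) (slope m X y)) with h | h
  · have := mul_nonneg h (sq_nonneg (m X w))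
    have := mul_pos hq hww
    linarith
  · have h2 := mul_le_mul_of_nonpos_left h1 h.le
    have h3 := mul_pos hc hww
    linarith

/-- Nondegeneracy of the fundamental tensor. Split w = c y + e with e orthogonal to y. Testing
against y gives a linear relation between c and m X e; inserted in the test against e, it leaves a
positive multiple of the expression in `convex_pos`. Hence e = 0, and then c = 0. -/
theorem eq_zero_of_hessian_sqNorm (hm : IsInnerForm m) (hφ : IsAlphaBetaProfile φ b₀)
    (hX : √(m X X) < b₀) {y w : L} (hy : y ≠ 0)
    (hw : ∀ v, fderiv ℝ (fderiv ℝ (sqNorm m X φ)) y w v = 0) : w = 0 := by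
  have hyy := hm.pos y hy
  have hlt := (hm.abs_slope_le (X := X) hy).trans_lt hX
  have hφ0 := hφ.pos _ (abs_lt.1 hlt)
  obtain ⟨c, e, hwe, he⟩ : ∃ (c : ℝ) (e : L), w = c • y + e ∧ m y e = 0 := by
    refine ⟨m y w / m y y, w - (m y w / m y y) • y, by abel, ?_⟩
    rw [map_sub, map_smul, smul_eq_mul, div_mul_cancel₀ _ hyy.ne', sub_self]
  have h1 := hw y
  have h2 := hw e
  rw [hessian_sqNorm_self hm hφ hX hy, hwe, map_add, map_smul,
    fderiv_sqNorm_self hm hφ hX hy, fderiv_sqNorm hm hφ hX hy, he, sqNorm] at h1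
  rw [hwe, map_add, map_smul, add_apply, smul_apply, hessian_sqNorm_comm hm hφ hX hy,
    hessian_sqNorm_self hm hφ hX hy, hessian_sqNorm hm hφ hX hy he, fderiv_sqNorm hm hφ hX hy, he,
    smul_eq_mul] at h2
  have hα := hm.sqrt_pos hy
  have hαα := hm.sqrt_mul_self y
  have he0 : e = 0 := by
    by_contra hne
    have h3 := convex_pos hm hφ hX hy he hne
    refine (mul_pos (mul_pos hα hφ0) h3).ne' ?_
    have h4 : c * √(m y y) * φ (slope m X y) + deriv φ (slope m X y) * m X e = 0 := by
      refine (mul_eq_zero.1 (?_ : (2 * √(m y y) * φ (slope m X y)) * _ = 0)).resolve_left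
        (by positivity)
      rw [smul_eq_mul] at h1
      linear_combination h1 + 2 * c * φ (slope m X y) ^ 2 * hαα
    linear_combination (√(m y y) / 2) * h2 - √(m y y) * deriv φ (slope m X y) * m X e * h4
  rw [he0, map_zero, mul_zero, mul_zero, add_zero, add_zero, smul_eq_mul] at h1
  have hc : c = 0 := by
    have : 0 < 2 * (m y y * φ (slope m X y) ^ 2) := by positivity
    exact (mul_eq_zero.1 h1).resolve_right this.ne'
  rw [hwe, he0, hc, zero_smul, add_zero]

end Minkowski

/-! ### Left invariant (α,β)-metrics with parallel β -/

section FrameFinsler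

variable {L W : Type*} [NormedAddCommGroup L] [NormedSpace ℝ L] [FiniteDimensional ℝ L]
  [NormedAddCommGroup W] [NormedSpace ℝ W] [FiniteDimensional ℝ W]
  {m : L →L[ℝ] L →L[ℝ] ℝ} {n : L →L[ℝ] L →L[ℝ] L} {U : Set W} {ξ : W → L →L[ℝ] W}
  {h : W → W →L[ℝ] W →L[ℝ] ℝ} {F : W → W → ℝ} {X : L} {φ : ℝ → ℝ} {b₀ : ℝ} {x : W}

namespace IsInvariantFrame

theorem inverse_ne_zero (hf : IsInvariantFrame m n U ξ h) (hx : x ∈ U) {y : W} (hy : y ≠ 0) :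
    (ξ x).inverse y ≠ 0 := fun h0 => hy (by rw [← hf.apply_inverse hx y, h0, map_zero])

theorem energy_eventuallyEq (hf : IsInvariantFrame m n U ξ h)
    (hF : ∀ x ∈ U, ∀ y, F x y ^ 2 = sqNorm m X φ ((ξ x).inverse y)) (hx : x ∈ U) (y : W) :
    energy F =ᶠ[𝓝 (x, y)] fun p => sqNorm m X φ ((ξ p.1).inverse p.2) := by
  filter_upwards [(hf.isOpen.prod isOpen_univ).mem_nhds ⟨hx, mem_univ y⟩] with p hp
    using hF p.1 hp.1 p.2

theorem contDiffAt_energy (hf : IsInvariantFrame m n U ξ h) (hm : IsInnerForm m)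
    (hφ : IsAlphaBetaProfile φ b₀) (hX : √(m X X) < b₀)
    (hF : ∀ x ∈ U, ∀ y, F x y ^ 2 = sqNorm m X φ ((ξ x).inverse y)) (hx : x ∈ U) {y : W}
    (hy : y ≠ 0) : ContDiffAt ℝ ∞ (energy F) (x, y) := by
  refine ContDiffAt.congr_of_eventuallyEq ?_ (hf.energy_eventuallyEq hF hx y)
  exact ContDiffAt.comp (x, y) (contDiffAt_sqNorm hm hφ hX (hf.inverse_ne_zero hx hy))
    (((hf.contDiffAt_inverse hx).comp (x, y) contDiffAt_fst).clm_apply contDiffAt_snd)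

theorem fderiv_energy (hf : IsInvariantFrame m n U ξ h) (hm : IsInnerForm m)
    (hφ : IsAlphaBetaProfile φ b₀) (hX : √(m X X) < b₀)
    (hF : ∀ x ∈ U, ∀ y, F x y ^ 2 = sqNorm m X φ ((ξ x).inverse y)) (hx : x ∈ U) {y : W}
    (hy : y ≠ 0) (u v : W) :
    fderiv ℝ (energy F) (x, y) (u, v) = fderiv ℝ (sqNorm m X φ) ((ξ x).inverse y)
      (fderiv ℝ (fun x => (ξ x).inverse) x u y + (ξ x).inverse v) := by
  have hfst : HasFDerivAt (Prod.fst : W × W → W) (ContinuousLinearMap.fst ℝ W W) (x, y) :=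
    hasFDerivAt_fst
  have h1 : HasFDerivAt (fun p : W × W => (ξ p.1).inverse)
      ((fderiv ℝ (fun x => (ξ x).inverse) x).comp (ContinuousLinearMap.fst ℝ W W)) (x, y) :=
    HasFDerivAt.comp (G := W →L[ℝ] L) (g := fun x => (ξ x).inverse) (f := Prod.fst) (x, y)
      ((hf.contDiffAt_inverse hx).differentiableAt (by simp)).hasFDerivAt hfst
  have h2 := h1.clm_apply (hasFDerivAt_snd (𝕜 := ℝ) (p := (x, y)))
  have h3 := ((contDiffAt_sqNorm hm hφ hX (hf.inverse_ne_zero hx hy)).differentiableAt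
    (by simp)).hasFDerivAt.comp (x, y) h2
  rw [(hf.energy_eventuallyEq hF hx y).fderiv_eq]
  refine (congrArg (fun T : W × W →L[ℝ] ℝ => T (u, v)) h3.fderiv).trans ?_
  simp [add_comm]

theorem fundTensor_frame (hf : IsInvariantFrame m n U ξ h) (hm : IsInnerForm m)
    (hφ : IsAlphaBetaProfile φ b₀) (hX : √(m X X) < b₀)
    (hF : ∀ x ∈ U, ∀ y, F x y ^ 2 = sqNorm m X φ ((ξ x).inverse y)) (hx : x ∈ U) {y : W}
    (hy : y ≠ 0) (v w : W) :
    fundTensor F x y v w = 1 / 2 * fderiv ℝ (fderiv ℝ (sqNorm m X φ)) ((ξ x).inverse y)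
      ((ξ x).inverse v) ((ξ x).inverse w) := by
  have h0 : (fun z => F x z ^ 2) = sqNorm m X φ ∘ (ξ x).inverse := funext (hF x hx)
  have h1 : fderiv ℝ (fun z => F x z ^ 2) =ᶠ[𝓝 y] fun z =>
      ((ContinuousLinearMap.compL ℝ W L ℝ).flip (ξ x).inverse)
        (fderiv ℝ (sqNorm m X φ) ((ξ x).inverse z)) := by
    filter_upwards [isOpen_compl_singleton.mem_nhds hy] with z hz
    rw [h0]
    exact (((contDiffAt_sqNorm hm hφ hX (hf.inverse_ne_zero hx hz)).differentiableAt
      (by simp)).hasFDerivAt.comp z (ξ x).inverse.hasFDerivAt).fderiv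
  have h2 := ((ContinuousLinearMap.compL ℝ W L ℝ).flip (ξ x).inverse).hasFDerivAt.comp y
    ((differentiableAt_fderiv_sqNorm hm hφ hX (hf.inverse_ne_zero hx hy)).hasFDerivAt.comp y
      (ξ x).inverse.hasFDerivAt)
  rw [fundTensor, h1.fderiv_eq]
  exact congrArg (fun T : W →L[ℝ] W →L[ℝ] ℝ => 1 / 2 * T v w) h2.fderiv

/-- A left invariant `(α,β)`-metric is a Finsler metric. -/
theorem isFinslerOn (hf : IsInvariantFrame m n U ξ h) (hm : IsInnerForm m)
    (hφ : IsAlphaBetaProfile φ b₀) (hX : √(m X X) < b₀)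
    (hF : ∀ x ∈ U, ∀ y, F x y ^ 2 = sqNorm m X φ ((ξ x).inverse y)) : IsFinslerOn F U where
  isOpen := hf.isOpen
  smooth := fun p hp => (hf.contDiffAt_energy hm hφ hX hF hp.1 hp.2).contDiffWithinAt
  euler := fun x hx y hy => by
    rw [hf.fderiv_energy hm hφ hX hF hx hy, map_zero, zero_apply, zero_add,
      fderiv_sqNorm_self hm hφ hX (hf.inverse_ne_zero hx hy), energy, hF x hx]
  nondeg := fun x hx y hy => by
    refine isInvertible_of_forall_eq_zero _ fun w hw => ?_
    have h1 : (ξ x).inverse w = 0 := by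
      refine eq_zero_of_hessian_sqNorm hm hφ hX (hf.inverse_ne_zero hx hy) fun v => ?_
      have h2 := hw (ξ x v)
      rw [hf.fundTensor_frame hm hφ hX hF hx hy, hf.inverse_apply hx] at h2
      linarith
    rw [← hf.apply_inverse hx w, h1, map_zero]

/-- The last term is the defect of parallelism of F² for the Levi-Civita connection; it is the
derivative of the Minkowski norm along the operator n a. -/
theorem fderiv_energy_frameConn (hf : IsInvariantFrame m n U ξ h) (hm : IsInnerForm m)
    (hφ : IsAlphaBetaProfile φ b₀) (hX : √(m X X) < b₀)
    (hF : ∀ x ∈ U, ∀ y, F x y ^ 2 = sqNorm m X φ ((ξ x).inverse y)) (hx : x ∈ U) {y : W}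
    (hy : y ≠ 0) (u : W) :
    fderiv ℝ (energy F) (x, y) (0, frameConn n ξ x u y) = fderiv ℝ (energy F) (x, y) (u, 0) +
      fderiv ℝ (sqNorm m X φ) ((ξ x).inverse y) (n ((ξ x).inverse u) ((ξ x).inverse y)) := by
  rw [hf.fderiv_energy hm hφ hX hF hx hy, hf.fderiv_energy hm hφ hX hF hx hy,
    hf.inverse_frameConn hx, ← map_add]
  congr 1
  simp only [map_zero, zero_apply]
  abel

end IsInvariantFrame

/-- An operator n a that is skew and kills X changes neither α nor β. -/
theorem fderiv_sqNorm_product (hm : IsMetricProduct m n) (hφ : IsAlphaBetaProfile φ b₀)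
    (hX : √(m X X) < b₀) (hp : ∀ a, n a X = 0) {y : L} (hy : y ≠ 0) (a : L) :
    fderiv ℝ (sqNorm m X φ) y (n a y) = 0 := by
  have h1 := hm.skew a y y
  have h2 := hm.skew a X y
  rw [hm.symm (n a y)] at h1
  rw [hp, map_zero, zero_apply, zero_add] at h2
  have h3 : m y (n a y) = 0 := by linarith
  rw [fderiv_sqNorm hm.toIsInnerForm hφ hX hy, h2, h3, mul_zero, mul_zero, add_zero]

/-- The curvature is built from commutators and values of the skew operators n a, hence is itself
skew. -/
theorem productCurv_skew (hm : IsMetricProduct m n) (a b c d : L) :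
    m (productCurv n a b c) d + m c (productCurv n a b d) = 0 := by
  simp only [productCurv, map_sub, sub_apply]
  have h1 := hm.skew a (n b c) d
  have h2 := hm.skew b (n a c) d
  have h3 := hm.skew b c (n a d)
  have h4 := hm.skew a c (n b d)
  have h5 := hm.skew (n a b) c d
  have h6 := hm.skew (n b a) c d
  linarith

theorem productCurv_eq_zero (hp : ∀ a, n a X = 0) (a b : L) : productCurv n a b X = 0 := by
  simp [productCurv, hp]

/-- The flag curvature of a left invariant `(α,β)`-metric with parallel `β`. -/
theorem IsInvariantFrame.flagCurvatureLocal_eq (hf : IsInvariantFrame m n U ξ h)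
    (hm : IsMetricProduct m n) (hφ : IsAlphaBetaProfile φ b₀) (hX : √(m X X) < b₀)
    (hF : ∀ x ∈ U, ∀ y, F x y ^ 2 = sqNorm m X φ ((ξ x).inverse y)) (hp : ∀ a, n a X = 0)
    (hx : x ∈ U) {y u : L} (hy : m y y = 1) (hu : m u u = 1) (hyu : m y u = 0) :
    flagCurvatureLocal F x (ξ x y) (ξ x u) =
      1 / (φ (m X y) ^ 2 * (1 + m X u ^ 2 * profileD φ (m X y))) *
        m (productCurv n u y y) u := by
  have hy0 : y ≠ 0 := by rintro rfl; simp at hy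
  have hξy : ξ x y ≠ 0 := fun h0 => hy0 (by rw [← hf.inverse_apply hx y, h0, map_zero])
  have hi := hm.toIsInnerForm
  have hFin := hf.isFinslerOn hi hφ hX hF
  have hc := hFin.chernCurv_eq (Γ := frameConn n ξ) (fun x hx => hf.christoffel_eq hm hx)
    (fun x hx => hf.frameConn_symm hx) (fun x hx y hy u => by
      rw [hf.fderiv_energy_frameConn hi hφ hX hF hx hy,
        fderiv_sqNorm_product hm hφ hX hp (hf.inverse_ne_zero hx hy), add_zero]) hx hξy
  have hslope : slope m X y = m X y := by rw [slope, hy, Real.sqrt_one, div_one]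
  have hlt : |m X y| < b₀ := hslope ▸ (hi.abs_slope_le (X := X) hy0).trans_lt hX
  have hφ0 := hφ.pos _ (abs_lt.1 hlt)
  have hq := hφ.sub_pos hlt
  -- R(u, y)y is orthogonal to y by skewness, and to X because the curvature kills X; so only the
  -- first term of `hessian_sqNorm` survives in the numerator.
  have hr1 : m y (productCurv n u y y) = 0 := by
    have h1 := productCurv_skew hm u y y y
    rw [hm.symm _ y] at h1
    linarith
  have hr2 : m X (productCurv n u y y) = 0 := by
    have h1 := productCurv_skew hm u y X y
    rwa [productCurv_eq_zero hp, map_zero, zero_apply, zero_add] at h1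
  have hyu' : m u y = 0 := by rw [hm.symm, hyu]
  rw [flagCurvatureLocal, hc, hf.riemannCurv_eq hm hx]
  simp only [hf.fundTensor_frame hi hφ hX hF hx hξy, hf.inverse_apply hx]
  rw [hessian_sqNorm hi hφ hX hy0 hr1, hessian_sqNorm_self hi hφ hX hy0,
    hessian_sqNorm_self hi hφ hX hy0, fderiv_sqNorm_self hi hφ hX hy0, hessian_sqNorm hi hφ hX hy0 hyu,
    fderiv_sqNorm hi hφ hX hy0, sqNorm, hslope, hy, hu, hyu, hr2, profileD, Real.sqrt_one]
  generalize m X y = s at *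
  generalize m X u = t at *
  generalize m (productCurv n u y y) u = r
  generalize deriv (deriv φ) s = φ2
  generalize hq' : φ s - s * deriv φ s = q at *
  have hden : 1 + t ^ 2 * (φ2 / q) = (q + t ^ 2 * φ2) / q := by field_simp
  rw [hden]
  have hnum : 1 / 2 * (2 * φ s * q * r + 2 * (φ s * φ2 + deriv φ s ^ 2) * 0 * t +
      2 * (φ s * deriv φ s - s * (φ s * φ2 + deriv φ s ^ 2)) * (0 / 1) * 0) = φ s * q * r := by ring
  have hden' : 1 / 2 * (2 * (1 * φ s ^ 2)) *
      (1 / 2 * (2 * φ s * q * 1 + 2 * (φ s * φ2 + deriv φ s ^ 2) * t * t +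
        2 * (φ s * deriv φ s - s * (φ s * φ2 + deriv φ s ^ 2)) * (t / 1) * 0)) -
      (1 / 2 * (2 * φ s * q * 0 + 2 * 1 * φ s * deriv φ s * t)) ^ 2 =
      φ s ^ 3 * (q + t ^ 2 * φ2) := by ring
  rw [hnum, hden']
  -- If this factor were zero, both sides would be 0 by the convention for division by zero, so its
  -- positivity is not called on.
  rcases eq_or_ne (q + t ^ 2 * φ2) 0 with h0 | h0
  · rw [h0]; simp
  · field_simp

end FrameFinsler

/-! ### Rigidity of infinitesimal isometries of the Minkowski norm -/

/-- A profile with `φ' = k s (φ - s φ')` is the square root of a quadratic polynomial. -/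
theorem exists_sq_eq_of_deriv_eq {φ : ℝ → ℝ} {b₀ b k : ℝ} (hφ : IsAlphaBetaProfile φ b₀)
    (hb : 0 < b) (hb₀ : b < b₀)
    (h : ∀ s, |s| < b → deriv φ s = k * s * (φ s - s * deriv φ s)) :
    ∃ a c : ℝ, ∀ s, |s| ≤ b → φ s ^ 2 = a + c * s ^ 2 := by
  -- The equation reads φ' (1 + k s²) = k s φ. Where 1 + k s² vanishes, φ > 0 forces k s = 0, which
  -- contradicts that vanishing.
  have hne : ∀ s, |s| < b → 1 + k * s ^ 2 ≠ 0 := by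
    intro s hs h0
    have h1 := h s hs
    have hpos := hφ.pos s (abs_lt.1 (hs.trans hb₀))
    have h2 : k * s * φ s = 0 := by linear_combination deriv φ s * h0 - h1
    have h3 : k * s = 0 := (mul_eq_zero.1 h2).resolve_right hpos.ne'
    have h4 : (1 : ℝ) = 0 := by linear_combination h0 - s * h3
    exact one_ne_zero h4
  -- The quotient φ² / (1 + k s²) is a first integral of the equation.
  have hd : ∀ s ∈ Ioo (-b) b, HasDerivAt (fun s => φ s ^ 2 / (1 + k * s ^ 2)) 0 s := by
    intro s hs
    have hs' := abs_lt.2 hs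
    have h1 := (hφ.hasDerivAt (hs'.trans hb₀)).pow 2
    have h2 := ((hasDerivAt_pow 2 s).const_mul k).const_add 1
    refine (h1.div h2 (hne s hs')).congr_deriv ?_
    rw [div_eq_zero_iff]
    left
    simp
    linear_combination (2 * φ s) * h s hs'
  have hc : ∀ s ∈ Ioo (-b) b, φ s ^ 2 / (1 + k * s ^ 2) = φ 0 ^ 2 / (1 + k * 0 ^ 2) := by
    intro s hs
    exact isOpen_Ioo.is_const_of_deriv_eq_zero isPreconnected_Ioo
      (fun t ht => (hd t ht).differentiableAt.differentiableWithinAt)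
      (fun t ht => (hd t ht).deriv) hs ⟨by linarith, hb⟩
  refine ⟨φ 0 ^ 2, φ 0 ^ 2 * k, fun s hs => ?_⟩
  -- The endpoints are reached by continuity.
  have hE : EqOn (fun s => φ s ^ 2) (fun s => φ 0 ^ 2 + φ 0 ^ 2 * k * s ^ 2) (Icc (-b) b) := by
    refine EqOn.of_subset_closure (s := Ioo (-b) b) ?_ ?_ ?_ Ioo_subset_Icc_self ?_
    · intro s hs
      have h1 := hc s hs
      rw [div_eq_iff (hne s (abs_lt.2 hs))] at h1
      simp only [h1]
      ring
    · intro s hs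
      exact (((hφ.contDiffAt ((abs_le.2 hs).trans_lt hb₀)).continuousAt).pow 2).continuousWithinAt
    · fun_prop
    · rw [closure_Ioo (by linarith)]
  exact hE (abs_le.1 hs)

section Rigidity

variable {L : Type*} [NormedAddCommGroup L] [NormedSpace ℝ L] [FiniteDimensional ℝ L]
  {m : L →L[ℝ] L →L[ℝ] ℝ} {X : L} {φ : ℝ → ℝ} {b₀ : ℝ}

/-- The infinitesimal linear isometries of the Minkowski norm `α φ(β/α)` preserve `α` and `β`,
unless the norm is Euclidean. -/
theorem isometry_rigidity (hm : IsInnerForm m) (hφ : IsAlphaBetaProfile φ b₀)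
    (hX : √(m X X) < b₀) (hne : ¬ ∃ a c : ℝ, ∀ s, |s| ≤ √(m X X) → φ s ^ 2 = a + c * s ^ 2)
    (S : L →L[ℝ] L) (hS : ∀ y ≠ 0, fderiv ℝ (sqNorm m X φ) y (S y) = 0) (y : L) :
    m y (S y) = 0 ∧ m X (S y) = 0 := by
  have hX0 : X ≠ 0 := by
    rintro rfl
    refine hne ⟨φ 0 ^ 2, 0, fun s hs => ?_⟩
    have : s = 0 := by simpa using hs
    rw [this]; ring
  have hb : 0 < √(m X X) := hm.sqrt_pos hX0
  have hbb := hm.sqrt_mul_self X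
  have hE : ∀ y ≠ 0, (φ (slope m X y) - slope m X y * deriv φ (slope m X y)) * m y (S y) +
      √(m y y) * deriv φ (slope m X y) * m X (S y) = 0 := by
    intro y hy
    have h1 := hS y hy
    have hpos := hφ.pos _ (abs_lt.1 ((hm.abs_slope_le (X := X) hy).trans_lt hX))
    rw [fderiv_sqNorm hm hφ hX hy] at h1
    refine (mul_eq_zero.1 (?_ : 2 * φ (slope m X y) * _ = 0)).resolve_left (by positivity)
    linear_combination h1
  -- At y = X the slope is √(m X X), and the two terms of `hE` add up to φ times m X (S X).
  have hA : m X (S X) = 0 := by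
    have h1 := hE X hX0
    have h2 : slope m X X = √(m X X) := by rw [slope, Real.div_sqrt]
    have hpos := hφ.pos _ (abs_lt.1 ((hm.abs_slope_le (X := X) hX0).trans_lt hX))
    rw [h2] at h1 hpos
    refine (mul_eq_zero.1 (?_ : φ √(m X X) * _ = 0)).resolve_left hpos.ne'
    linear_combination h1
  -- Both e and -e have slope 0; adding their equations cancels the odd term m X (S e).
  have hB : ∀ e, m X e = 0 → m e (S e) = 0 := by
    intro e he
    rcases eq_or_ne e 0 with rfl | he0
    · simp
    have h1 := hE e he0
    have h2 := hE (-e) (neg_ne_zero.2 he0)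
    have h3 : slope m X e = 0 := by rw [slope, he, zero_div]
    have h4 : slope m X (-e) = 0 := by rw [slope, map_neg, he, neg_zero, zero_div]
    rw [h3] at h1
    rw [h4] at h2
    simp only [map_neg, neg_apply, neg_neg] at h2
    have hpos := hφ.pos 0 (abs_lt.1 (by rw [abs_zero]; exact hb.trans hX))
    refine (mul_eq_zero.1 (?_ : φ 0 * _ = 0)).resolve_left hpos.ne'
    linear_combination (h1 + h2) / 2
  -- With b = √(m X X) and r = √(b² - s²), the vector (s / (b r)) X + e has norm b / r and slope s.
  -- Every slope in (-b, b) thus occurs in the plane of X and e, and `hE` becomes a differential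
  -- equation for φ with constant coefficients m X (S e) and m e (S X).
  have hC : ∀ e, m X e = 0 → m e e = 1 → ∀ s, |s| < √(m X X) →
      (φ s - s * deriv φ s) * s * (m X (S e) + m e (S X)) +
        m X X * deriv φ s * m X (S e) = 0 := by
    intro e he hee s hs
    have hr : 0 < √(m X X - s ^ 2) := by
      refine Real.sqrt_pos.2 ?_
      have := sq_lt_sq' (abs_lt.1 hs).1 (abs_lt.1 hs).2
      rw [Real.sq_sqrt (hm.nonneg X)] at this
      linarith
    have hrr : √(m X X - s ^ 2) * √(m X X - s ^ 2) = m X X - s ^ 2 :=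
      Real.mul_self_sqrt (Real.sqrt_pos.1 hr).le
    have heX : m e X = 0 := by rw [hm.symm, he]
    generalize √(m X X - s ^ 2) = r at *
    obtain ⟨b, hb'⟩ : ∃ b, b = √(m X X) := ⟨_, rfl⟩
    rw [← hb'] at hb hbb
    have hyy : m ((s / (b * r)) • X + e) ((s / (b * r)) • X + e) = (b / r) ^ 2 := by
      simp only [map_add, map_smul, add_apply, smul_apply, smul_eq_mul, he, heX, hee]
      rw [← hbb] at hrr ⊢
      field_simp
      linear_combination b * hrr
    have hy0 : (s / (b * r)) • X + e ≠ 0 := by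
      intro h0
      rw [h0] at hyy
      have : 0 < (b / r) ^ 2 := by positivity
      rw [← hyy] at this
      simp at this
    have hsq : √(m ((s / (b * r)) • X + e) ((s / (b * r)) • X + e)) = b / r := by
      rw [hyy, Real.sqrt_sq (by positivity)]
    have hsl : slope m X ((s / (b * r)) • X + e) = s := by
      rw [slope, hsq, map_add, map_smul, he, ← hbb, smul_eq_mul]
      field_simp
      ring
    have h1 := hE _ hy0
    rw [hsl, hsq] at h1
    simp only [map_add, map_smul, add_apply, smul_apply, smul_eq_mul, hA, hB e he] at h1
    rw [← hbb]
    have h2 : b * r * ((φ s - s * deriv φ s) * (s / (b * r)) * (m X (S e) + m e (S X)) +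
      b / r * deriv φ s * m X (S e)) = 0 := by
      rw [mul_eq_zero]
      right
      linear_combination h1
    field_simp at h2
    linear_combination h2
  have hκ : ∀ e, m X e = 0 → m e e = 1 → m X (S e) = 0 ∧ m e (S X) = 0 := by
    intro e he hee
    -- Otherwise `hC` can be solved for φ' and is the equation of `exists_sq_eq_of_deriv_eq`, which
    -- `hne` excludes.
    have hκ0 : m X (S e) = 0 := by
      by_contra hκ
      refine hne (exists_sq_eq_of_deriv_eq hφ hb hX
        (k := -(m X (S e) + m e (S X)) / (m X X * m X (S e))) fun s hs => ?_)
      have h1 := hC e he hee s hs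
      have hXX := hm.pos X hX0
      field_simp
      linear_combination h1
    refine ⟨hκ0, ?_⟩
    -- Any nonzero slope below √(m X X) would serve: there φ - s φ' > 0, so the remaining
    -- coefficient vanishes.
    have hs : |√(m X X) / 2| < √(m X X) := by
      rw [abs_of_pos (by positivity)]
      linarith
    have h1 := hC e he hee _ hs
    have hq := hφ.sub_pos (hs.trans hX)
    rw [hκ0, zero_add, mul_zero, add_zero] at h1
    exact (mul_eq_zero.1 h1).resolve_left (by positivity)
  have hκ' : ∀ e, m X e = 0 → m X (S e) = 0 ∧ m e (S X) = 0 := by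
    intro e he
    rcases eq_or_ne e 0 with rfl | he0
    · simp
    have hs := hm.sqrt_pos he0
    have h1 := hκ ((√(m e e))⁻¹ • e) (by simp [he]) (by
      simp only [map_smul, smul_apply, smul_eq_mul]
      rw [← mul_assoc, ← mul_inv, hm.sqrt_mul_self, inv_mul_cancel₀ (hm.pos e he0).ne'])
    simpa [hs.ne'] using h1
  obtain ⟨t, e, hye, he⟩ : ∃ (t : ℝ) (e : L), y = t • X + e ∧ m X e = 0 := by
    refine ⟨m X y / m X X, y - (m X y / m X X) • X, by abel, ?_⟩
    rw [map_sub, map_smul, smul_eq_mul, div_mul_cancel₀ _ (hm.pos X hX0).ne', sub_self]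
  have h1 := hκ' e he
  rw [hye]
  simp only [map_add, map_smul, add_apply, smul_apply, smul_eq_mul, hA, hB e he, h1.1, h1.2]
  simp

end Rigidity

/-! ### The Berwald condition forces β to be parallel -/

section Berwald

variable {L W : Type*} [NormedAddCommGroup L] [NormedSpace ℝ L] [FiniteDimensional ℝ L]
  [NormedAddCommGroup W] [NormedSpace ℝ W] [FiniteDimensional ℝ W]
  {m : L →L[ℝ] L →L[ℝ] ℝ} {n : L →L[ℝ] L →L[ℝ] L} {U : Set W} {ξ : W → L →L[ℝ] W}
  {h : W → W →L[ℝ] W →L[ℝ] ℝ} {F : W → W → ℝ} {X : L} {φ : ℝ → ℝ} {b₀ : ℝ} {x : W}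

/-- A bilinear map that is symmetric and skew-adjoint vanishes. -/
theorem eq_zero_of_symm_of_skew (hm : IsInnerForm m) {T : L → L →L[ℝ] L}
    (hT : ∀ a b, T a b = T b a) (hs : ∀ a b, m b (T a b) = 0) (a b : L) : T a b = 0 := by
  have h1 : ∀ a b c, m b (T a c) = -m c (T a b) := by
    intro a b c
    have e := hs a (b + c)
    simp only [map_add, add_apply, hs] at e
    linarith
  -- The trilinear form m c (T a b) is symmetric in a, b and antisymmetric in b, c; alternating
  -- these symmetries returns the form to its negative.
  have h2 : ∀ c, m c (T a b) = 0 := by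
    intro c
    have e1 := h1 a b c
    have e2 := h1 c b a
    have e3 := h1 b a c
    rw [hT a c] at e1
    rw [hT c b] at e2
    rw [hT b a] at e3
    linarith
  exact hm.eq_zero (h2 _)

/-- A left invariant `(α,β)`-metric of Berwald type has parallel `β`, unless it is Riemannian. -/
theorem IsInvariantFrame.parallel_of_berwald (hf : IsInvariantFrame m n U ξ h)
    (hm : IsMetricProduct m n) (hφ : IsAlphaBetaProfile φ b₀) (hX : √(m X X) < b₀)
    (hF : ∀ x ∈ U, ∀ y, F x y ^ 2 = sqNorm m X φ ((ξ x).inverse y))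
    (hne : ¬ ∃ a c : ℝ, ∀ s, |s| ≤ √(m X X) → φ s ^ 2 = a + c * s ^ 2)
    (hx : x ∈ U) (B : W →L[ℝ] W →L[ℝ] W) (hB : ∀ y ≠ 0, spray F x y = (1 / 2 : ℝ) • B y y)
    (a : L) : n a X = 0 := by
  have hi := hm.toIsInnerForm
  have hFin := hf.isFinslerOn hi hφ hX hF
  -- The map supplied by the Berwald condition need not be symmetric, but the spray sees only its
  -- symmetric part.
  let Bs : W →L[ℝ] W →L[ℝ] W := (1 / 2 : ℝ) • (B + B.flip)
  have hBs : ∀ u v, Bs u v = (1 / 2 : ℝ) • (B u v + B v u) := fun u v => rfl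
  have hpar : ∀ y ≠ 0, ∀ u,
      fderiv ℝ (energy F) (x, y) (u, 0) = fderiv ℝ (energy F) (x, y) (0, Bs u y) := by
    intro y hy u
    refine hFin.parallel_of_spray_eq hx (fun u v => ?_) (fun y hy => ?_) hy u
    · rw [hBs, hBs, add_comm]
    · rw [hB y hy, hBs, ← two_smul ℝ, smul_smul (1 / 2 : ℝ) 2]
      norm_num
  -- The difference tensor, in frame components, between the Berwald connection and the Levi-Civita
  -- connection.
  let T : L → L →L[ℝ] L := fun a =>
    (ξ x).inverse.comp ((Bs (ξ x a) - frameConn n ξ x (ξ x a)).comp (ξ x))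
  have hT : ∀ a b, T a b =
      (ξ x).inverse (Bs (ξ x a) (ξ x b) - frameConn n ξ x (ξ x a) (ξ x b)) := fun a b => rfl
  -- Parallelism of F² for `Bs` says that T a + n a is an infinitesimal isometry of the Minkowski
  -- norm.
  have hS : ∀ a y, m y ((T a + n a) y) = 0 ∧ m X ((T a + n a) y) = 0 := by
    intro a
    refine isometry_rigidity hi hφ hX hne (T a + n a) fun y hy => ?_
    have hξy : ξ x y ≠ 0 := fun h0 => hy (by rw [← hf.inverse_apply hx y, h0, map_zero])
    have h1 := hf.fderiv_energy_frameConn hi hφ hX hF hx hξy (ξ x a)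
    have h2 := hpar _ hξy (ξ x a)
    have h3 := hf.fderiv_energy hi hφ hX hF hx hξy 0
      (Bs (ξ x a) (ξ x y) - frameConn n ξ x (ξ x a) (ξ x y))
    rw [map_zero, zero_apply, zero_add, hf.inverse_apply hx, ← hT] at h3
    rw [hf.inverse_apply hx, hf.inverse_apply hx] at h1
    have h4 : ((0 : W), Bs (ξ x a) (ξ x y) - frameConn n ξ x (ξ x a) (ξ x y)) =
        (0, Bs (ξ x a) (ξ x y)) - (0, frameConn n ξ x (ξ x a) (ξ x y)) := by simp
    rw [h4, map_sub] at h3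
    rw [add_apply, map_add, ← h3]
    linarith
  have hn : ∀ a y, m y (n a y) = 0 := by
    intro a y
    have h1 := hm.skew a y y
    rw [hm.symm (n a y)] at h1
    linarith
  -- T is symmetric because both connections are, and T a is skew as the difference of the skew
  -- operators T a + n a and n a.
  have hT0 := eq_zero_of_symm_of_skew hi (T := T) (fun a b => by
      rw [hT, hT, hBs, hBs, add_comm, hf.frameConn_symm hx]) (fun a b => by
      have h1 := (hS a b).1
      rw [add_apply, map_add, hn] at h1
      linarith)
  have h1 : ∀ y, m (n a X) y = 0 := by
    intro y
    have h2 := (hS a y).2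
    rw [add_apply, hT0, zero_add] at h2
    have h3 := hm.skew a X y
    linarith
  exact hi.eq_zero (h1 _)

end Berwald

set_option synthInstance.maxHeartbeats 200000

/-! ### Curvature of the lifted Lie algebra -/

section MetricLie

variable {L : Type*} [NormedAddCommGroup L] [NormedSpace ℝ L] [FiniteDimensional ℝ L]
  {m : L →L[ℝ] L →L[ℝ] ℝ} {n br ads : L →L[ℝ] L →L[ℝ] L}

/-- `m` is an inner product, `br` is skew-symmetric, and `ads a` is the `m`-adjoint of `br a`. -/
structure IsMetricBracket (m : L →L[ℝ] L →L[ℝ] ℝ) (br ads : L →L[ℝ] L →L[ℝ] L) : Prop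
    extends IsInnerForm m where
  skew : ∀ a b, br a b = -br b a
  adjoint : ∀ a b c, m (ads a b) c = m b (br a c)

/-- The Levi-Civita product `½([a, b] - ad*_a b - ad*_b a)`. -/
def koszul (br ads : L →L[ℝ] L →L[ℝ] L) : L →L[ℝ] L →L[ℝ] L :=
  (1 / 2 : ℝ) • (br - ads - ads.flip)

theorem koszul_apply (a b : L) :
    koszul br ads a b = (1 / 2 : ℝ) • (br a b - ads a b - ads b a) := rfl

/-- The inner product on pairs. -/
def liftForm (m : L →L[ℝ] L →L[ℝ] ℝ) : L × L →L[ℝ] L × L →L[ℝ] ℝ :=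
  m.bilinearComp (ContinuousLinearMap.fst ℝ L L) (ContinuousLinearMap.fst ℝ L L) +
    m.bilinearComp (ContinuousLinearMap.snd ℝ L L) (ContinuousLinearMap.snd ℝ L L)

theorem liftForm_apply (a b : L × L) : liftForm m a b = m a.1 b.1 + m a.2 b.2 := rfl

/-- The Levi-Civita product of `L × L` with the bracket
`[a, b] = ([a₁, b₁], [a₁, b₂] + [a₂, b₁])`. -/
def liftProduct (br ads : L →L[ℝ] L →L[ℝ] L) : L × L →L[ℝ] L × L →L[ℝ] L × L :=
  (ContinuousLinearMap.compL ℝ (L × L) L (L × L) (ContinuousLinearMap.inl ℝ L L)).comp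
      ((koszul br ads).bilinearComp (ContinuousLinearMap.fst ℝ L L) (ContinuousLinearMap.fst ℝ L L)
        - ((1 / 2 : ℝ) • (ads + ads.flip)).bilinearComp (ContinuousLinearMap.snd ℝ L L)
          (ContinuousLinearMap.snd ℝ L L)) +
    (ContinuousLinearMap.compL ℝ (L × L) L (L × L) (ContinuousLinearMap.inr ℝ L L)).comp
      (((1 / 2 : ℝ) • (br - ads)).bilinearComp (ContinuousLinearMap.fst ℝ L L)
          (ContinuousLinearMap.snd ℝ L L)
        - ((1 / 2 : ℝ) • (br + ads).flip).bilinearComp (ContinuousLinearMap.snd ℝ L L)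
          (ContinuousLinearMap.fst ℝ L L))

theorem liftProduct_apply (a b : L × L) :
    liftProduct br ads a b =
      (koszul br ads a.1 b.1 - (1 / 2 : ℝ) • (ads a.2 b.2 + ads b.2 a.2),
        (1 / 2 : ℝ) • (br a.1 b.2 - ads a.1 b.2) - (1 / 2 : ℝ) • (br b.1 a.2 + ads b.1 a.2)) := by
  refine Prod.ext ?_ ?_
  · simp [liftProduct]
  · simp [liftProduct]

/-- Skewness moves the outer products across `m`, so that iterated products occur only in the
bracket term. -/
theorem IsMetricProduct.curv (hm : IsMetricProduct m n) (a b : L) :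
    m (productCurv n a b b) a =
      m (n a b) (n b a) - m (n b b) (n a a) - m (n (n a b - n b a) b) a := by
  have h1 := hm.skew a (n b b) a
  have h2 := hm.skew b (n a b) a
  rw [productCurv, map_sub, map_sub, sub_apply, sub_apply]
  linarith

namespace IsMetricBracket

theorem self (hb : IsMetricBracket m br ads) (a : L) : br a a = 0 := by
  have h := hb.skew a a
  rw [eq_neg_iff_add_eq_zero, ← two_smul ℝ] at h
  exact (smul_eq_zero.1 h).resolve_left two_ne_zero

theorem koszul_sub (hb : IsMetricBracket m br ads) (a b : L) :
    koszul br ads a b - koszul br ads b a = br a b := by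
  rw [koszul_apply, koszul_apply, hb.skew b a]
  module

theorem isMetricProduct (hb : IsMetricBracket m br ads) : IsMetricProduct m (koszul br ads) where
  toIsInnerForm := hb.toIsInnerForm
  skew := fun a b c => by
    simp only [koszul_apply, map_smul, map_sub, smul_apply, sub_apply, hb.adjoint, smul_eq_mul,
      hb.symm b (ads _ _)]
    rw [hb.symm (br a b), hb.skew c b, map_neg]
    ring

theorem isInnerForm_lift (hb : IsMetricBracket m br ads) : IsInnerForm (liftForm m) where
  symm := fun a b => by rw [liftForm_apply, liftForm_apply, hb.symm, hb.symm a.2]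
  pos := fun a ha => by
    rw [liftForm_apply]
    have h1 := hb.nonneg a.1
    have h2 := hb.nonneg a.2
    by_contra hlt
    exact ha (Prod.ext (hb.eq_zero (by linarith)) (hb.eq_zero (by linarith)))

theorem isMetricProduct_lift (hb : IsMetricBracket m br ads) :
    IsMetricProduct (liftForm m) (liftProduct br ads) where
  toIsInnerForm := hb.isInnerForm_lift
  skew := fun a b c => by
    have h1 := hb.isMetricProduct.skew a.1 b.1 c.1
    have e : ∀ x y z, m x (ads y z) = m z (br y x) := fun x y z => by rw [hb.symm, hb.adjoint]
    have f : ∀ x y z, m (br x y) z = m z (br x y) := fun x y z => hb.symm _ _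
    simp only [liftForm_apply, liftProduct_apply, map_sub, map_add, map_smul, smul_apply, sub_apply,
      add_apply, hb.adjoint, e, f, smul_eq_mul]
    rw [hb.skew a.2 c.1, hb.skew b.2 c.1, hb.skew a.2 b.1, hb.skew c.2 b.1]
    simp only [map_neg]
    linarith

theorem liftProduct_sub (hb : IsMetricBracket m br ads) (a b : L × L) :
    liftProduct br ads a b - liftProduct br ads b a =
      (br a.1 b.1, br a.1 b.2 + br a.2 b.1) := by
  rw [liftProduct_apply, liftProduct_apply, Prod.mk_sub_mk]
  refine Prod.ext ?_ ?_
  · simp only []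
    rw [← hb.koszul_sub]
    module
  · simp only []
    rw [hb.skew a.2]
    module

theorem curv_koszul (hb : IsMetricBracket m br ads) (v y : L) :
    m (productCurv (koszul br ads) v y y) v =
      m (koszul br ads v y) (koszul br ads y v) - m (ads y y) (ads v v)
        - m (koszul br ads (br v y) y) v := by
  rw [hb.isMetricProduct.curv, hb.koszul_sub, koszul_apply y y, koszul_apply v v, hb.self, hb.self]
  have h : ∀ a : L, (1 / 2 : ℝ) • (0 - a - a) = -a := fun a => by module
  rw [h, h, map_neg, map_neg, neg_apply, neg_neg]

theorem bracket_left (hb : IsMetricBracket m br ads) (a b c : L) :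
    m (br a b) c = m (ads a c) b := by
  rw [hb.adjoint, hb.symm]

/-- The bracket term in inner products of br v y, ads v y and ads y v, the quantities in which the
mixed curvatures are compared. -/
theorem koszul_bracket (hb : IsMetricBracket m br ads) (v y : L) :
    m (koszul br ads (br v y) y) v =
      1 / 2 * (m (ads v y) (br v y) - m (ads y v) (br v y) + m (br v y) (br v y)) := by
  rw [koszul_apply, hb.skew (br v y) y]
  simp only [map_smul, map_sub, map_neg, smul_apply, sub_apply, neg_apply, smul_eq_mul, hb.adjoint]
  rw [hb.bracket_left y, hb.skew (br v y) v, hb.skew y v, map_neg, map_neg, hb.adjoint]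
  ring

/-- Pairs with zero second component are closed under `liftProduct`, which restricts there to
`koszul`: the complete lifts behave like a totally geodesic copy of the Lie algebra. -/
theorem curv_lift_cc (v y : L) :
    liftForm m (productCurv (liftProduct br ads) (v, 0) (y, 0) (y, 0)) (v, 0) =
      m (productCurv (koszul br ads) v y y) v := by
  have h : ∀ a b : L, liftProduct br ads (a, 0) (b, 0) = (koszul br ads a b, 0) := fun a b => by
    simp [liftProduct_apply]
  simp [productCurv, h, liftForm_apply]

/-- Adjointness and skewness reduce both sides to inner products of br v y, ads v y, ads y v and of
ads y y with ads v v; the comparison is then linear algebra. -/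
theorem curv_lift_vc (hb : IsMetricBracket m br ads) (v y : L) :
    liftForm m (productCurv (liftProduct br ads) (0, v) (y, 0) (y, 0)) (0, v) =
      m (productCurv (koszul br ads) v y y) v + 1 / 2 * m (br v (koszul br ads y v)) y
        - 1 / 2 * m (koszul br ads v (ads v y)) y + 1 / 4 * m (br v (ads v y)) y
        + 1 / 2 * m (br (br y v) v) y := by
  have h1 := hb.isMetricProduct.skew v (ads v y) y
  have h2 : br (br y v) v = br v (br v y) := by
    rw [hb.skew (br y v) v, hb.skew y v, map_neg, neg_neg]
  have h3 : m (ads y (br v y)) v = - m (br v y) (br v y) := by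
    rw [hb.adjoint, hb.skew y v, map_neg]
  rw [hb.isMetricProduct_lift.curv, hb.curv_koszul, hb.koszul_bracket, hb.liftProduct_sub, h2,
    hb.bracket_left v (koszul br ads y v), hb.bracket_left v (ads v y),
    hb.bracket_left v (br v y), eq_neg_of_add_eq_zero_left h1]
  simp only [liftForm_apply, liftProduct_apply, koszul_apply, hb.skew y v, hb.self, map_sub, map_add,
    map_smul, map_neg, map_zero, smul_apply, sub_apply, add_apply, neg_apply, zero_apply,
    smul_eq_mul, h3, hb.bracket_left y (br v y) v,
    hb.symm (br v y) (ads v y), hb.symm (br v y) (ads y v), hb.symm (ads y v) (ads v y)]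
  ring

/-- The counterpart of `curv_lift_vc` with v and y exchanged, in accordance with the symmetry of the
curvature numerator in the two flag vectors. -/
theorem curv_lift_cv (hb : IsMetricBracket m br ads) (v y : L) :
    liftForm m (productCurv (liftProduct br ads) (v, 0) (0, y) (0, y)) (v, 0) =
      m (productCurv (koszul br ads) v y y) v + 1 / 2 * m (br y (koszul br ads v y)) v
        - 1 / 2 * m (koszul br ads y (ads y v)) v + 1 / 4 * m (br y (ads y v)) v
        + 1 / 2 * m (br (br v y) y) v := by
  have h1 := hb.isMetricProduct.skew y (ads y v) v
  have h2 : br (br v y) y = -br y (br v y) := hb.skew _ _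
  have h3 : m (ads (br v y) y) v = - m (ads v y) (br v y) := by
    rw [hb.adjoint, hb.skew (br v y) v, map_neg, hb.adjoint]
  have h4 : m (ads y (br v y)) v = - m (br v y) (br v y) := by
    rw [hb.adjoint, hb.skew y v, map_neg]
  rw [hb.isMetricProduct_lift.curv, hb.curv_koszul, hb.koszul_bracket, hb.liftProduct_sub, h2,
    map_neg, neg_apply, hb.bracket_left y (koszul br ads v y), hb.bracket_left y (ads y v),
    hb.bracket_left y (br v y), eq_neg_of_add_eq_zero_left h1]
  simp only [liftForm_apply, liftProduct_apply, koszul_apply, hb.skew y v, hb.self, map_sub, map_add,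
    map_smul, map_neg, map_zero, smul_apply, sub_apply, add_apply, zero_apply,
    smul_eq_mul, h3, h4,
    hb.symm (br v y) (ads v y), hb.symm (br v y) (ads y v), hb.symm (ads y v) (ads v y)]
  ring

/-- Vertical lifts commute, so the bracket term is absent upstairs; the one contained in the
curvature of `koszul` is compensated on the right. -/
theorem curv_lift_vv (hb : IsMetricBracket m br ads) (v y : L) :
    liftForm m (productCurv (liftProduct br ads) (0, v) (0, y) (0, y)) (0, v) =
      m (productCurv (koszul br ads) v y y) v + m (koszul br ads (br v y) y) v
        + 1 / 4 * m (br v y) (br v y) := by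
  rw [hb.isMetricProduct_lift.curv, hb.curv_koszul, hb.liftProduct_sub]
  simp only [liftForm_apply, liftProduct_apply, koszul_apply v y, koszul_apply y v, hb.skew y v,
    map_sub, map_add, map_smul, map_neg, map_zero, smul_apply, sub_apply, add_apply, zero_apply,
    smul_eq_mul,
    hb.symm (br v y) (ads v y), hb.symm (br v y) (ads y v), hb.symm (ads y v) (ads v y)]
  ring

end IsMetricBracket

end MetricLie

/-! ### Vector fields in charts -/

section Charts

variable {W : Type*} [NormedAddCommGroup W] [NormedSpace ℝ W]
  {H : Type*} [TopologicalSpace H] (I : ModelWithCorners ℝ W H)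
  {M : Type*} [TopologicalSpace M] [ChartedSpace H M] [IsManifold I 1 M]

/-- Tangent spaces are identified with the model space through the preferred chart, so at the base
point of that chart a vector is its own component vector. -/
theorem components_apply (p : M) (v : TangentSpace I p) : components I p v = v := by
  rw [components, mfderiv_extChartAt_self]
  rfl

theorem components_inverse_apply (p : M) (v : W) : (components I p).inverse v = v := by
  have h := (components_invertible I p).self_apply_inverse v
  rwa [components_apply] at h

theorem inverse_coordFrame {p : M} {x : W} (hx : x ∈ (extChartAt I p).target) :
    (coordFrame I p x).inverse = mfderiv I 𝓘(ℝ, W) (extChartAt I p) ((extChartAt I p).symm x) :=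
  ContinuousLinearMap.inverse_eq (mfderivWithin_extChartAt_symm_comp_mfderiv_extChartAt hx)
    (mfderiv_extChartAt_comp_mfderivWithin_extChartAt_symm hx)

theorem coordFrame_fieldInChart {p : M} {x : W} (hx : x ∈ (extChartAt I p).target)
    (X : ∀ q : M, TangentSpace I q) :
    coordFrame I p x (fieldInChart I p X x) = X ((extChartAt I p).symm x) :=
  (isInvertible_mfderivWithin_extChartAt_symm hx).self_apply_inverse _

theorem fieldInChart_extChartAt {p q : M} (hq : q ∈ (extChartAt I p).source)
    (X : ∀ q : M, TangentSpace I q) :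
    fieldInChart I p X (extChartAt I p q) = tangentCoordChange I q p q (X q) := by
  have h1 : fieldInChart I p X (extChartAt I p q) =
      (coordFrame I p (extChartAt I p q)).inverse (X ((extChartAt I p).symm (extChartAt I p q))) :=
    rfl
  have hq' : q ∈ (chartAt H p).source := by rwa [extChartAt_source] at hq
  rw [h1, inverse_coordFrame I ((extChartAt I p).map_source hq), (extChartAt I p).left_inv hq,
    ← TangentBundle.continuousLinearMapAt_trivializationAt hq',
    TangentBundle.continuousLinearMapAt_trivializationAt_eq_core hq']
  rfl

/-- The cocycle relation of the tangent coordinate changes. -/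
theorem fieldInChart_change {p q r : M} (hp : r ∈ (extChartAt I p).source)
    (hq : r ∈ (extChartAt I q).source) (X : ∀ q : M, TangentSpace I q) :
    fieldInChart I p X (extChartAt I p r) =
      tangentCoordChange I q p r (fieldInChart I q X (extChartAt I q r)) := by
  rw [fieldInChart_extChartAt I hp, fieldInChart_extChartAt I hq]
  exact (tangentCoordChange_comp (I := I) (E := W) (v := X r) ⟨⟨mem_extChartAt_source r, hq⟩, hp⟩).symm

end Charts

/-! ### The left invariant frame in a chart of the group -/

section Group

variable {E : Type*} [NormedAddCommGroup E] [NormedSpace ℝ E] [FiniteDimensional ℝ E]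
  {G : Type*} [TopologicalSpace G] [ChartedSpace E G] [Group G] [LieGroup 𝓘(ℝ, E) ∞ G]

/-- The field is g ↦ T(mul)(0_g, v), with v at the identity, and the tangent map of a map of order ∞
again has order ∞. -/
theorem contMDiff_mulInvariantVectorField_infty (v : GroupLieAlgebra 𝓘(ℝ, E) G) :
    ContMDiff 𝓘(ℝ, E) 𝓘(ℝ, E).tangent ∞
      (fun g : G => (⟨g, mulInvariantVectorField v g⟩ : TangentBundle 𝓘(ℝ, E) G)) := by
  let fg : G → TangentBundle 𝓘(ℝ, E) G := fun g ↦ TotalSpace.mk' E g 0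
  have sfg : ContMDiff 𝓘(ℝ, E) 𝓘(ℝ, E).tangent ∞ fg := contMDiff_zeroSection _ _
  let fv : G → TangentBundle 𝓘(ℝ, E) G := fun _ ↦ TotalSpace.mk' E 1 v
  have sfv : ContMDiff 𝓘(ℝ, E) 𝓘(ℝ, E).tangent ∞ fv := contMDiff_const
  let F₁ : G → (TangentBundle 𝓘(ℝ, E) G × TangentBundle 𝓘(ℝ, E) G) := fun g ↦ (fg g, fv g)
  have S₁ : ContMDiff 𝓘(ℝ, E) (𝓘(ℝ, E).tangent.prod 𝓘(ℝ, E).tangent) ∞ F₁ := sfg.prodMk sfv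
  let F₂ : (TangentBundle 𝓘(ℝ, E) G × TangentBundle 𝓘(ℝ, E) G) →
      TangentBundle (𝓘(ℝ, E).prod 𝓘(ℝ, E)) (G × G) :=
    (equivTangentBundleProd 𝓘(ℝ, E) G 𝓘(ℝ, E) G).symm
  have S₂ : ContMDiff (𝓘(ℝ, E).tangent.prod 𝓘(ℝ, E).tangent) (𝓘(ℝ, E).prod 𝓘(ℝ, E)).tangent ∞ F₂ :=
    contMDiff_equivTangentBundleProd_symm
  let F₃ : TangentBundle (𝓘(ℝ, E).prod 𝓘(ℝ, E)) (G × G) → TangentBundle 𝓘(ℝ, E) G :=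
    tangentMap (𝓘(ℝ, E).prod 𝓘(ℝ, E)) 𝓘(ℝ, E) (fun (p : G × G) ↦ p.1 * p.2)
  have S₃ : ContMDiff (𝓘(ℝ, E).prod 𝓘(ℝ, E)).tangent 𝓘(ℝ, E).tangent ∞ F₃ :=
    ContMDiff.contMDiff_tangentMap (contMDiff_mul 𝓘(ℝ, E) ∞) (by simp)
  let S := (S₃.comp S₂).comp S₁
  convert! S with g
  · simp [F₁, F₂, F₃, fg, fv]
  · simp only [Function.comp_apply, tangentMap, F₃, F₂, F₁, fg, fv]
    rw [mfderiv_prod_eq_add_apply ((contMDiff_mul 𝓘(ℝ, E) ∞).mdifferentiableAt (by simp))]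
    change mfderiv 𝓘(ℝ, E) 𝓘(ℝ, E) (g * ·) 1 v = mfderiv 𝓘(ℝ, E) 𝓘(ℝ, E) (· * (1 : G)) g 0 +
      mfderiv 𝓘(ℝ, E) 𝓘(ℝ, E) (g * ·) 1 v
    exact ((congrArg (· + _) (ContinuousLinearMap.map_zero _)).trans (zero_add _)).symm

/-- The frame of left invariant fields, in the chart at `p`. -/
def groupFrame (p : G) (x : E) : E →L[ℝ] E :=
  LinearMap.toContinuousLinearMap
    { toFun := fun A => fieldInChart 𝓘(ℝ, E) p (mulInvariantVectorField A) x
      map_add' := fun (A B : GroupLieAlgebra 𝓘(ℝ, E) G) => by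
        have h := fieldInChart_linear p x 1 A B
        rw [one_smul, one_smul] at h
        exact h
      map_smul' := fun c (A : GroupLieAlgebra 𝓘(ℝ, E) G) => by
        have h0 := fieldInChart_linear p x 1 (0 : GroupLieAlgebra 𝓘(ℝ, E) G) 0
        have h := fieldInChart_linear p x c A 0
        simp only [smul_zero, add_zero, one_smul, left_eq_add] at h0 h
        rw [h0, add_zero] at h
        exact h }

theorem groupFrame_apply (p : G) (x : E) (A : E) :
    groupFrame p x A = fieldInChart 𝓘(ℝ, E) p (mulInvariantVectorField (I := 𝓘(ℝ, E)) A) x := rfl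

theorem mulInvariantVectorField_one (A : GroupLieAlgebra 𝓘(ℝ, E) G) :
    mulInvariantVectorField A (1 : G) = A := by
  have h5 : (fun y : G => 1 * y) = id := funext one_mul
  rw [mulInvariantVectorField, h5, mfderiv_id]
  rfl

/-- A left invariant field that vanishes at one point vanishes at the identity, by pulling back
along a left translation. -/
theorem groupFrame_invertible {p : G} {x : E} (hx : x ∈ (extChartAt 𝓘(ℝ, E) p).target) :
    (groupFrame p x).IsInvertible := by
  have : LieGroup 𝓘(ℝ, E) (minSmoothness ℝ 3) G := lieGroup_minSmoothness
  have hinj : Function.Injective (groupFrame p x).toLinearMap := by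
    rw [injective_iff_map_eq_zero]
    intro A hA
    have h1 : mulInvariantVectorField (I := 𝓘(ℝ, E)) A ((extChartAt 𝓘(ℝ, E) p).symm x) = 0 :=
      (isInvertible_mfderivWithin_extChartAt_symm (I := 𝓘(ℝ, E)) hx).inverse.injective
        (hA.trans (map_zero _).symm)
    have h3 := congrFun (mpullback_mulInvariantVectorField (I := 𝓘(ℝ, E))
      ((extChartAt 𝓘(ℝ, E) p).symm x) A) 1
    rw [mpullback_apply, mul_one, h1, map_zero] at h3
    exact (h3.trans (mulInvariantVectorField_one (A : GroupLieAlgebra 𝓘(ℝ, E) G))).symm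
  exact ⟨(LinearEquiv.ofInjectiveEndo _ hinj).toContinuousLinearEquiv, rfl⟩

theorem contDiffOn_groupFrame (p : G) :
    ContDiffOn ℝ ∞ (groupFrame p) (extChartAt 𝓘(ℝ, E) p).target := by
  have : CompleteSpace E := FiniteDimensional.complete ℝ E
  -- Pulling back a field costs one order of smoothness, which is free at ∞ since ∞ + 1 = ∞.
  have : IsManifold 𝓘(ℝ, E) (∞ + 1) G := inferInstanceAs (IsManifold 𝓘(ℝ, E) ∞ G)
  rw [contDiffOn_clm_apply]
  intro A x hx
  have h := ContMDiffWithinAt.mpullbackWithin_vectorField_of_eq' (I := 𝓘(ℝ, E)) (I' := 𝓘(ℝ, E))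
     (n := ∞) (m := ∞) (t := univ) (s := range 𝓘(ℝ, E)) (u := range 𝓘(ℝ, E)) (x₀ := x)
    ((contMDiff_mulInvariantVectorField_infty (G := G) A).contMDiffAt
      (x := (extChartAt 𝓘(ℝ, E) p).symm x)).contMDiffWithinAt
    (contMDiffWithinAt_extChartAt_symm_range p hx)
    (isInvertible_mfderivWithin_extChartAt_symm hx) (by simp) (by simpa using uniqueMDiffOn_univ) (by simp)
    (by simp) Subset.rfl rfl
  rw [contMDiffWithinAt_vectorSpace_iff_contDiffWithinAt] at h
  exact h.mono (by simp)

end Group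

section Charts

variable {L : Type*} [NormedAddCommGroup L] [NormedSpace ℝ L] [FiniteDimensional ℝ L]
  {W : Type*} [NormedAddCommGroup W] [NormedSpace ℝ W] [FiniteDimensional ℝ W]
  {H : Type*} [TopologicalSpace H] {I : ModelWithCorners ℝ W H}
  {M : Type*} [TopologicalSpace M] [ChartedSpace H M] [IsManifold I 1 M]
  {m : L →L[ℝ] L →L[ℝ] ℝ} {n : L →L[ℝ] L →L[ℝ] L} {U : Set W} {ξ : W → L →L[ℝ] W}
  {h : ∀ q : M, TangentSpace I q →L[ℝ] TangentSpace I q →L[ℝ] ℝ} {p : M}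

theorem fieldInChart_self (p : M) (X : ∀ q : M, TangentSpace I q) :
    fieldInChart I p X (extChartAt I p p) = X p := by
  rw [fieldInChart_extChartAt I (mem_extChartAt_source p)]
  exact tangentCoordChange_self (I := I) (E := W) (v := X p) (mem_extChartAt_source p)

/-- The covariant derivative of a frame field along a frame field. -/
theorem IsInvariantFrame.covDeriv_eq (hf : IsInvariantFrame m n U ξ (metricInChart I h p))
    (hm : IsMetricProduct m n) (hp : extChartAt I p p ∈ U) {X : ∀ q : M, TangentSpace I q} {b : L}
    (hX : ∀ x ∈ U, fieldInChart I p X x = ξ x b) (a : L) :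
    covDeriv I h X p (ξ (extChartAt I p p) a) = ξ (extChartAt I p p) (n a b) := by
  have h1 : fieldInChart I p X =ᶠ[𝓝 (extChartAt I p p)] fun x => ξ x b := by
    filter_upwards [hf.isOpen.mem_nhds hp] with x hx using hX x hx
  have h2 : fderiv ℝ (fun x => ξ x b) (extChartAt I p p) (ξ (extChartAt I p p) a) =
      fderiv ℝ ξ (extChartAt I p p) (ξ (extChartAt I p p) a) b := by
    rw [fderiv_clm_apply (hf.differentiableAt hp) (differentiableAt_const b)]
    simp
  refine (components_inverse_apply I p _).trans ?_
  rw [h1.fderiv_eq, hX _ hp]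
  erw [components_apply]
  rw [h2, hf.christoffel_eq hm hp]
  exact hf.cov_eq hp a b

end Charts

/-! ### Bracket, connection and curvature of the left invariant metric -/

section Group

variable {E : Type*} [NormedAddCommGroup E] [NormedSpace ℝ E] [FiniteDimensional ℝ E]
  {G : Type*} [TopologicalSpace G] [ChartedSpace E G] [Group G] [LieGroup 𝓘(ℝ, E) ∞ G]

variable (G) in
/-- The Lie bracket of `G`, as a bilinear map on the model space. -/
def groupBracket : E →L[ℝ] E →L[ℝ] E :=
  haveI : LieGroup 𝓘(ℝ, E) (minSmoothness ℝ 3) G := lieGroup_minSmoothness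
  haveI : CompleteSpace E := FiniteDimensional.complete ℝ E
  LinearMap.toContinuousBilinearMap
    (LinearMap.mk₂ ℝ (M := E) (Nₗ := E) (Pₗ := E)
      (fun A B : GroupLieAlgebra 𝓘(ℝ, E) G => (⁅A, B⁆ : GroupLieAlgebra 𝓘(ℝ, E) G))
      (fun A A' B : GroupLieAlgebra 𝓘(ℝ, E) G => add_lie A A' B)
      (fun c (A B : GroupLieAlgebra 𝓘(ℝ, E) G) => smul_lie c A B)
      (fun A B B' : GroupLieAlgebra 𝓘(ℝ, E) G => lie_add A B B')
      (fun c (A B : GroupLieAlgebra 𝓘(ℝ, E) G) => lie_smul c A B))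

variable (g : ContMDiffRiemannianMetric 𝓘(ℝ, E) ∞ E (fun x : G => TangentSpace 𝓘(ℝ, E) x))

/-- The inner product on the Lie algebra, as a bilinear form on the model space. -/
def groupForm : E →L[ℝ] E →L[ℝ] ℝ := lieInner g

/-- `ad*` as a bilinear map on the model space. -/
def groupAdStar : E →L[ℝ] E →L[ℝ] E :=
  LinearMap.toContinuousBilinearMap
    (LinearMap.mk₂ ℝ (fun A B : E => (groupForm g).inverse ((groupForm g B).comp (groupBracket G A)))
      (fun A A' B => by simp) (fun c A B => by simp) (fun A B B' => by simp) (fun c A B => by simp))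

theorem isMetricBracket : IsMetricBracket (groupForm g) (groupBracket G) (groupAdStar g) where
  symm := g.symm 1
  pos := g.pos 1
  skew := fun (A B : GroupLieAlgebra 𝓘(ℝ, E) G) => by
    have : LieGroup 𝓘(ℝ, E) (minSmoothness ℝ 3) G := lieGroup_minSmoothness
    have : CompleteSpace E := FiniteDimensional.complete ℝ E
    exact (lie_skew A B).symm
  adjoint := lieInner_adStar g

variable {g}

theorem inner_mulInvariantVectorField (hg : IsLeftInvariant g) (A B : GroupLieAlgebra 𝓘(ℝ, E) G) (x : G) :
    g.inner x (mulInvariantVectorField A x) (mulInvariantVectorField B x) = lieInner g A B := by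
  -- The points x * 1 and x are only propositionally equal, so the two inner products are compared
  -- on the model space.
  have h : ∀ u v : E, (g.inner (x * 1) : E →L[ℝ] E →L[ℝ] ℝ) u v =
      (g.inner x : E →L[ℝ] E →L[ℝ] ℝ) u v := fun u v => by rw [mul_one]
  exact (h _ _).symm.trans (hg x 1 A B)

/-- Lie brackets commute with the pullback to the chart, and the bracket of left invariant fields is
the left invariant field of the Lie algebra bracket. -/
theorem groupFrame_bracket (p : G) {x : E} (hx : x ∈ (extChartAt 𝓘(ℝ, E) p).target)
    (A B : GroupLieAlgebra 𝓘(ℝ, E) G) :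
    fderiv ℝ (groupFrame (E := E) p) x (groupFrame (E := E) p x A) B -
      fderiv ℝ (groupFrame (E := E) p) x (groupFrame (E := E) p x B) A =
        groupFrame (E := E) p x (groupBracket (E := E) G A B) := by
  have : LieGroup 𝓘(ℝ, E) (minSmoothness ℝ 3) G := lieGroup_minSmoothness
  have : CompleteSpace E := FiniteDimensional.complete ℝ E
  have hd : DifferentiableAt ℝ (groupFrame p) x :=
    ((contDiffOn_groupFrame p).contDiffAt ((isOpen_extChartAt_target p).mem_nhds hx)).differentiableAt (by simp)
  have h1 : ∀ A u : E, fderiv ℝ (groupFrame (E := E) p) x u A = fderiv ℝ (fun z => groupFrame p z A) x u := by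
    intro A u
    rw [fderiv_clm_apply hd (differentiableAt_const A)]
    simp
  have h := mpullbackWithin_mlieBracketWithin (I := 𝓘(ℝ, E)) (I' := 𝓘(ℝ, E)) (n := 2)
    (f := (extChartAt 𝓘(ℝ, E) p).symm) (s := range 𝓘(ℝ, E)) (t := univ) (x₀ := x)
    (V := mulInvariantVectorField A) (W := mulInvariantVectorField B)
    (mdifferentiableAt_mulInvariantVectorField A).mdifferentiableWithinAt
    (mdifferentiableAt_mulInvariantVectorField B).mdifferentiableWithinAt
    (by simpa using uniqueMDiffOn_univ) (contMDiffWithinAt_extChartAt_symm_range p hx) (by simp)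
    (by rw [minSmoothness_of_isRCLikeNormedField]) (by simp) (by simp)
  rw [mlieBracketWithin_univ, ← mulInvariantVector_mlieBracket, mlieBracketWithin_eq_lieBracketWithin] at h
  have hr : range 𝓘(ℝ, E) = univ := by simp
  refine (congrArg₂ (· - ·) (h1 B _) (h1 A _)).trans (Eq.trans ?_ h.symm)
  have e : ∀ f k : E → E, lieBracketWithin ℝ f k (range 𝓘(ℝ, E)) x =
      fderiv ℝ k x (f x) - fderiv ℝ f x (k x) := fun f k => by
    rw [lieBracketWithin_eq, hr, fderivWithin_univ, fderivWithin_univ]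
  exact (e (fun z => groupFrame (E := E) p z A) (fun z => groupFrame (E := E) p z B)).symm

theorem isInvariantFrame_group (hg : IsLeftInvariant g) (p : G) :
    IsInvariantFrame (groupForm g) (koszul (groupBracket G) (groupAdStar g))
      (extChartAt 𝓘(ℝ, E) p).target (groupFrame p) (metricInChart 𝓘(ℝ, E) g.inner p) where
  isOpen := isOpen_extChartAt_target p
  smooth := contDiffOn_groupFrame p
  invertible := fun x hx => groupFrame_invertible hx
  metric := fun x hx A B => by
    change g.inner _ (coordFrame 𝓘(ℝ, E) p x (groupFrame p x A)) (coordFrame 𝓘(ℝ, E) p x (groupFrame p x B)) = _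
    rw [groupFrame_apply, groupFrame_apply]
    erw [coordFrame_fieldInChart _ hx, coordFrame_fieldInChart _ hx]
    exact inner_mulInvariantVectorField hg _ _ _
  bracket := fun x hx A B => by
    rw [(isMetricBracket g).koszul_sub]
    exact groupFrame_bracket p hx A B

/-- At the identity the frame is the identity map, so frame coefficients there are Lie algebra
elements. -/
theorem groupFrame_one (A : E) : groupFrame (1 : G) (extChartAt 𝓘(ℝ, E) (1 : G) 1) A = A :=
  (fieldInChart_self (I := 𝓘(ℝ, E)) (1 : G) _).trans (mulInvariantVectorField_one _)

theorem nabla_eq (hg : IsLeftInvariant g) (A B : GroupLieAlgebra 𝓘(ℝ, E) G) :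
    nabla g A B = koszul (L := E) (groupBracket G) (groupAdStar g) A B := by
  have h := (isInvariantFrame_group hg 1).covDeriv_eq (isMetricBracket g).isMetricProduct
    (mem_extChartAt_target 1) (X := mulInvariantVectorField B) (b := B) (fun _ _ => rfl) A
  exact (congrArg (fun u : E => covDeriv 𝓘(ℝ, E) g.inner (mulInvariantVectorField B) 1 u)
    (groupFrame_one (G := G) (E := E) A)).symm.trans (h.trans (groupFrame_one (E := E) _))

theorem sectionalCurvature_eq (hg : IsLeftInvariant g) {V Y : E}
    (hY : groupForm g Y Y = 1) (hV : groupForm g V V = 1) (hYV : groupForm g Y V = 0) :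
    sectionalCurvature 𝓘(ℝ, E) g.inner 1 V Y =
      groupForm g (productCurv (koszul (groupBracket G) (groupAdStar g)) V Y Y) V := by
  have hf := isInvariantFrame_group hg 1
  have hx := mem_extChartAt_target (I := 𝓘(ℝ, E)) (1 : G)
  have h := hf.riemannCurv_eq (isMetricBracket g).isMetricProduct hx V Y Y
  have h2 := hf.metric _ hx (productCurv (koszul (groupBracket G) (groupAdStar g)) V Y Y) V
  rw [← h] at h2
  simp only [groupFrame_one] at h2
  have hVY : groupForm g V Y = 0 := ((isMetricBracket g).symm V Y).trans hYV
  have hd : groupForm g Y Y * groupForm g V V - groupForm g V Y ^ 2 = 1 := by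
    rw [hY, hV, hVY]
    norm_num
  refine (congrArg₂ (· / ·) ?_ hd).trans ((div_one _).trans h2)
  erw [components_apply, components_apply]

end Group

/-! ### Complete and vertical lifts under changes of chart -/

section Calculus

variable {E : Type*} [NormedAddCommGroup E] [NormedSpace ℝ E] {τ a b : E → E} {x₀ : E}

theorem fderiv_tangentMap (hτ : ContDiffAt ℝ 2 τ x₀) (y₀ u v : E) :
    fderiv ℝ (fun z : E × E => (τ z.1, fderiv ℝ τ z.1 z.2)) (x₀, y₀) (u, v) =
      (fderiv ℝ τ x₀ u, fderiv ℝ (fderiv ℝ τ) x₀ u y₀ + fderiv ℝ τ x₀ v) := by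
  have hd : DifferentiableAt ℝ τ x₀ := hτ.differentiableAt (by simp)
  have hdd : DifferentiableAt ℝ (fderiv ℝ τ) x₀ :=
    (hτ.fderiv_right (m := 1) (by norm_num)).differentiableAt (by simp)
  have h1 : HasFDerivAt (fun z : E × E => τ z.1) ((fderiv ℝ τ x₀).comp (ContinuousLinearMap.fst ℝ E E)) (x₀, y₀) :=
    HasFDerivAt.comp (g := τ) (x₀, y₀) hd.hasFDerivAt hasFDerivAt_fst
  have h2 : HasFDerivAt (fun z : E × E => fderiv ℝ τ z.1)
      ((fderiv ℝ (fderiv ℝ τ) x₀).comp (ContinuousLinearMap.fst ℝ E E)) (x₀, y₀) :=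
    HasFDerivAt.comp (G := E →L[ℝ] E) (g := fderiv ℝ τ) (f := Prod.fst) (x₀, y₀) hdd.hasFDerivAt hasFDerivAt_fst
  have h3 : HasFDerivAt (fun z : E × E => z.2) (ContinuousLinearMap.snd ℝ E E) (x₀, y₀) := hasFDerivAt_snd
  rw [(h1.prodMk (h2.clm_apply h3)).fderiv]
  simp [add_comm]

/-- The tangent map carries complete lifts to complete lifts. -/
theorem fderiv_tangentMap_completeLift (hτ : ContDiffAt ℝ 2 τ x₀) (ha : DifferentiableAt ℝ a x₀)
    (hb : DifferentiableAt ℝ b (τ x₀)) (hab : ∀ᶠ x in 𝓝 x₀, b (τ x) = fderiv ℝ τ x (a x)) (y₀ : E) :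
    fderiv ℝ (fun z : E × E => (τ z.1, fderiv ℝ τ z.1 z.2)) (x₀, y₀) (a x₀, fderiv ℝ a x₀ y₀) =
      (b (τ x₀), fderiv ℝ b (τ x₀) (fderiv ℝ τ x₀ y₀)) := by
  have hd : DifferentiableAt ℝ τ x₀ := hτ.differentiableAt (by simp)
  have hdd : DifferentiableAt ℝ (fderiv ℝ τ) x₀ :=
    (hτ.fderiv_right (m := 1) (by norm_num)).differentiableAt (by simp)
  have hs := hτ.isSymmSndFDerivAt (by simp)
  rw [fderiv_tangentMap hτ, hab.self_of_nhds]
  -- The relation b ∘ τ = Dτ · a is differentiated along y₀; symmetry of D²τ then matches the two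
  -- second order terms.
  have h := Filter.EventuallyEq.fderiv_eq (𝕜 := ℝ) (show (fun x => b (τ x)) =ᶠ[𝓝 x₀] fun x => fderiv ℝ τ x (a x) from hab)
  rw [fderiv_clm_apply hdd ha, fderiv_fun_comp x₀ hb hd] at h
  have h' := congrArg (fun T : E →L[ℝ] E => T y₀) h
  simp only [ContinuousLinearMap.comp_apply, add_apply, ContinuousLinearMap.flip_apply] at h'
  rw [h', hs.eq y₀ (a x₀), add_comm]

end Calculus

section Tangent

variable {E : Type*} [NormedAddCommGroup E] [NormedSpace ℝ E]
  {M : Type*} [TopologicalSpace M] [ChartedSpace E M] [IsManifold 𝓘(ℝ, E) ∞ M]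

theorem extChartAt_tangent_apply (p r : TangentBundle 𝓘(ℝ, E) M) :
    extChartAt 𝓘(ℝ, E).tangent p r = (extChartAt 𝓘(ℝ, E) p.proj r.proj,
      tangentCoordChange 𝓘(ℝ, E) r.proj p.proj r.proj r.2) := by
  rw [FiberBundle.extChartAt]
  rfl

theorem mem_source_tangent {p r : TangentBundle 𝓘(ℝ, E) M} :
    r ∈ (extChartAt 𝓘(ℝ, E).tangent p).source ↔ r.proj ∈ (extChartAt 𝓘(ℝ, E) p.proj).source := by
  rw [extChartAt_source, extChartAt_source, TangentBundle.mem_chart_source_iff]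

theorem mem_target_tangent {p : TangentBundle 𝓘(ℝ, E) M} {z : E × E} :
    z ∈ (extChartAt 𝓘(ℝ, E).tangent p).target ↔ z.1 ∈ (extChartAt 𝓘(ℝ, E) p.proj).target := by
  rw [FiberBundle.extChartAt_target, mem_prod, TangentBundle.trivializationAt_baseSet,
    ← extChartAt_source 𝓘(ℝ, E)]
  exact ⟨fun h => h.1.1, fun h => ⟨⟨h, (extChartAt 𝓘(ℝ, E) p.proj).map_target h⟩, mem_univ _⟩⟩

theorem extChartAt_tangent_symm_proj {p : TangentBundle 𝓘(ℝ, E) M} {z : E × E}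
    (hz : z ∈ (extChartAt 𝓘(ℝ, E).tangent p).target) :
    ((extChartAt 𝓘(ℝ, E).tangent p).symm z).proj = (extChartAt 𝓘(ℝ, E) p.proj).symm z.1 := by
  have h1 := extChartAt_tangent_apply p ((extChartAt 𝓘(ℝ, E).tangent p).symm z)
  rw [(extChartAt 𝓘(ℝ, E).tangent p).right_inv hz] at h1
  have h2 := congrArg Prod.fst h1
  simp only at h2
  rw [h2, (extChartAt 𝓘(ℝ, E) p.proj).left_inv
    (mem_source_tangent.1 ((extChartAt 𝓘(ℝ, E).tangent p).map_target hz))]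

/-- The transition maps of the tangent bundle are the tangent maps of the transition maps. -/
theorem tangent_transition_eventuallyEq {p q : TangentBundle 𝓘(ℝ, E) M}
    (hq : q ∈ (extChartAt 𝓘(ℝ, E).tangent p).source) :
    extChartAt 𝓘(ℝ, E).tangent p ∘ (extChartAt 𝓘(ℝ, E).tangent q).symm =ᶠ[𝓝 (extChartAt 𝓘(ℝ, E).tangent q q)]
      fun z => ((extChartAt 𝓘(ℝ, E) p.proj ∘ (extChartAt 𝓘(ℝ, E) q.proj).symm) z.1,
        fderiv ℝ (extChartAt 𝓘(ℝ, E) p.proj ∘ (extChartAt 𝓘(ℝ, E) q.proj).symm) z.1 z.2) := by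
  have h1 : (extChartAt 𝓘(ℝ, E).tangent q).target ∈ 𝓝 (extChartAt 𝓘(ℝ, E).tangent q q) :=
    extChartAt_target_mem_nhds q
  have h2 : (extChartAt 𝓘(ℝ, E).tangent q).symm ⁻¹' (extChartAt 𝓘(ℝ, E).tangent p).source ∈
      𝓝 (extChartAt 𝓘(ℝ, E).tangent q q) :=
    (continuousAt_extChartAt_symm q).preimage_mem_nhds
      (by rw [extChartAt_to_inv]; exact (isOpen_extChartAt_source p).mem_nhds hq)
  filter_upwards [h1, h2] with z hz1 hz2
  rw [mem_preimage] at hz2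
  have hr1 := (extChartAt 𝓘(ℝ, E).tangent q).map_target hz1
  have e1 := extChartAt_tangent_symm_proj hz1
  have e2 := extChartAt_tangent_apply q ((extChartAt 𝓘(ℝ, E).tangent q).symm z)
  rw [(extChartAt 𝓘(ℝ, E).tangent q).right_inv hz1] at e2
  rw [Function.comp_apply, extChartAt_tangent_apply]
  refine Prod.ext (by rw [e1]; rfl) ?_
  have e3 := congrArg Prod.snd e2
  have e4 := congrArg Prod.fst e2
  generalize (extChartAt 𝓘(ℝ, E).tangent q).symm z = r at *
  have h3 := tangentCoordChange_comp (I := 𝓘(ℝ, E)) (E := E) (w := r.proj) (x := q.proj) (y := p.proj) (z := r.proj) (v := r.2)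
    ⟨⟨mem_extChartAt_source r.proj, mem_source_tangent.1 hr1⟩, mem_source_tangent.1 hz2⟩
  refine h3.symm.trans ?_
  have h4 := tangentCoordChange_def (I := 𝓘(ℝ, E)) (x := q.proj) (y := p.proj) (z := r.proj)
  rw [h4]
  have hr : range 𝓘(ℝ, E) = univ := by simp
  rw [hr, fderivWithin_univ]
  exact congrArg₂ (fun (x y : E) => fderiv ℝ (extChartAt 𝓘(ℝ, E) p.proj ∘ (extChartAt 𝓘(ℝ, E) q.proj).symm) x y) e4.symm e3.symm

/-- The transition map of `M` from the chart at `q` to the chart at `p`. -/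
theorem contDiffAt_transition {p q : M} (hq : q ∈ (extChartAt 𝓘(ℝ, E) p).source) :
    ContDiffAt ℝ 2 (extChartAt 𝓘(ℝ, E) p ∘ (extChartAt 𝓘(ℝ, E) q).symm)
      (extChartAt 𝓘(ℝ, E) q q) := by
  have : IsManifold 𝓘(ℝ, E) 2 M := inferInstance
  have h := contDiffWithinAt_ext_coord_change (I := 𝓘(ℝ, E)) (n := 2) p q
    (y := extChartAt 𝓘(ℝ, E) q q) (by
      rw [PartialEquiv.trans_source]
      exact ⟨mem_extChartAt_target q, by rwa [mem_preimage, extChartAt_to_inv]⟩)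
  rwa [show range 𝓘(ℝ, E) = univ by simp, contDiffWithinAt_univ] at h

theorem fieldInChart_transition {p q : M} (hq : q ∈ (extChartAt 𝓘(ℝ, E) p).source)
    (X : ∀ q : M, TangentSpace 𝓘(ℝ, E) q) :
    ∀ᶠ x in 𝓝 (extChartAt 𝓘(ℝ, E) q q),
      fieldInChart 𝓘(ℝ, E) p X ((extChartAt 𝓘(ℝ, E) p ∘ (extChartAt 𝓘(ℝ, E) q).symm) x) =
        fderiv ℝ (extChartAt 𝓘(ℝ, E) p ∘ (extChartAt 𝓘(ℝ, E) q).symm) x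
          (fieldInChart 𝓘(ℝ, E) q X x) := by
  have h2 : (extChartAt 𝓘(ℝ, E) q).symm ⁻¹' (extChartAt 𝓘(ℝ, E) p).source ∈
      𝓝 (extChartAt 𝓘(ℝ, E) q q) :=
    (continuousAt_extChartAt_symm q).preimage_mem_nhds
      (by rw [extChartAt_to_inv]; exact (isOpen_extChartAt_source p).mem_nhds hq)
  filter_upwards [extChartAt_target_mem_nhds q, h2] with x hx1 hx2
  rw [mem_preimage] at hx2
  have h := fieldInChart_change 𝓘(ℝ, E) hx2 ((extChartAt 𝓘(ℝ, E) q).map_target hx1) X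
  rw [(extChartAt 𝓘(ℝ, E) q).right_inv hx1, tangentCoordChange_def,
    (extChartAt 𝓘(ℝ, E) q).right_inv hx1] at h
  simpa using h

/-- The lifts are prescribed at q only through the chart at the base point of q. With q chosen to
have coordinates z in the chart at p, the components of any field follow from those at q by the
derivative of a tangent map. -/
theorem fieldInChart_tangent {p : TangentBundle 𝓘(ℝ, E) M} {z : E × E}
    (hz : z ∈ (extChartAt 𝓘(ℝ, E).tangent p).target)
    (Z : ∀ q : TangentBundle 𝓘(ℝ, E) M, TangentSpace 𝓘(ℝ, E).tangent q) :
    ∃ q : TangentBundle 𝓘(ℝ, E) M, q ∈ (extChartAt 𝓘(ℝ, E).tangent p).source ∧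
      extChartAt 𝓘(ℝ, E).tangent p q = z ∧
      z = ((extChartAt 𝓘(ℝ, E) p.proj ∘ (extChartAt 𝓘(ℝ, E) q.proj).symm)
        (extChartAt 𝓘(ℝ, E) q.proj q.proj),
        fderiv ℝ (extChartAt 𝓘(ℝ, E) p.proj ∘ (extChartAt 𝓘(ℝ, E) q.proj).symm)
          (extChartAt 𝓘(ℝ, E) q.proj q.proj) (extChartAt 𝓘(ℝ, E).tangent q q).2) ∧
      fieldInChart 𝓘(ℝ, E).tangent p Z z =
        fderiv ℝ (fun w : E × E =>
          ((extChartAt 𝓘(ℝ, E) p.proj ∘ (extChartAt 𝓘(ℝ, E) q.proj).symm) w.1,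
            fderiv ℝ (extChartAt 𝓘(ℝ, E) p.proj ∘ (extChartAt 𝓘(ℝ, E) q.proj).symm) w.1 w.2))
          (extChartAt 𝓘(ℝ, E) q.proj q.proj, (extChartAt 𝓘(ℝ, E).tangent q q).2) (Z q) := by
  have : IsManifold 𝓘(ℝ, E).tangent 1 (TangentBundle 𝓘(ℝ, E) M) := inferInstance
  have hq := (extChartAt 𝓘(ℝ, E).tangent p).map_target hz
  refine ⟨(extChartAt 𝓘(ℝ, E).tangent p).symm z, hq,
    (extChartAt 𝓘(ℝ, E).tangent p).right_inv hz, ?_⟩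
  have hz' := (extChartAt 𝓘(ℝ, E).tangent p).right_inv hz
  generalize (extChartAt 𝓘(ℝ, E).tangent p).symm z = q at *
  have he := tangent_transition_eventuallyEq hq
  have e1 : extChartAt 𝓘(ℝ, E).tangent q q =
      (extChartAt 𝓘(ℝ, E) q.proj q.proj, (extChartAt 𝓘(ℝ, E).tangent q q).2) := by
    rw [extChartAt_tangent_apply]
  constructor
  · have h := he.self_of_nhds
    rw [Function.comp_apply, extChartAt_to_inv, hz', e1] at h
    exact h
  · subst hz'
    rw [fieldInChart_extChartAt _ hq, tangentCoordChange_def]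
    have hr : range 𝓘(ℝ, E).tangent = univ := by simp
    rw [hr, fderivWithin_univ, he.fderiv_eq, e1]

/-- The coordinate formula holds in every chart, not only at its base point, because complete lifts
are natural under tangent maps of transition maps. -/
theorem fieldInChart_completeLift {X : ∀ q : M, TangentSpace 𝓘(ℝ, E) q}
    (hX : ∀ p : M, ∀ x ∈ (extChartAt 𝓘(ℝ, E) p).target,
      DifferentiableAt ℝ (fieldInChart 𝓘(ℝ, E) p X) x)
    {p : TangentBundle 𝓘(ℝ, E) M} {z : E × E} (hz : z ∈ (extChartAt 𝓘(ℝ, E).tangent p).target) :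
    fieldInChart 𝓘(ℝ, E).tangent p (completeLift X) z =
      (fieldInChart 𝓘(ℝ, E) p.proj X z.1, fderiv ℝ (fieldInChart 𝓘(ℝ, E) p.proj X) z.1 z.2) := by
  obtain ⟨q, hq, hz', e, h⟩ := fieldInChart_tangent hz (completeLift X)
  have hq' := mem_source_tangent.1 hq
  have h1 : completeLift X q = (fieldInChart 𝓘(ℝ, E) q.proj X (extChartAt 𝓘(ℝ, E) q.proj q.proj),
      fderiv ℝ (fieldInChart 𝓘(ℝ, E) q.proj X) (extChartAt 𝓘(ℝ, E) q.proj q.proj)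
        (extChartAt 𝓘(ℝ, E).tangent q q).2) := components_inverse_apply 𝓘(ℝ, E).tangent q _
  have h2 : extChartAt 𝓘(ℝ, E) p.proj q.proj ∈ (extChartAt 𝓘(ℝ, E) p.proj).target := 
    (extChartAt 𝓘(ℝ, E) p.proj).map_source hq'
  have h3 := fderiv_tangentMap_completeLift (contDiffAt_transition hq')
    (hX q.proj _ (mem_extChartAt_target q.proj)) (hX p.proj _ (by simpa using h2))
    (fieldInChart_transition hq' X) (extChartAt 𝓘(ℝ, E).tangent q q).2
  rw [h, h1, e]
  exact h3

/-- On vertical vectors the derivative of a tangent map is just the derivative of the transition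
map. -/
theorem fieldInChart_verticalLift {X : ∀ q : M, TangentSpace 𝓘(ℝ, E) q}
    {p : TangentBundle 𝓘(ℝ, E) M} {z : E × E} (hz : z ∈ (extChartAt 𝓘(ℝ, E).tangent p).target) :
    fieldInChart 𝓘(ℝ, E).tangent p (verticalLift X) z =
      (0, fieldInChart 𝓘(ℝ, E) p.proj X z.1) := by
  obtain ⟨q, hq, hz', e, h⟩ := fieldInChart_tangent hz (verticalLift X)
  have hq' := mem_source_tangent.1 hq
  have h1 : verticalLift X q =
      ((0 : E), fieldInChart 𝓘(ℝ, E) q.proj X (extChartAt 𝓘(ℝ, E) q.proj q.proj)) :=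
    components_inverse_apply 𝓘(ℝ, E).tangent q _
  rw [h, h1, e, fderiv_tangentMap (contDiffAt_transition hq'), map_zero, map_zero, zero_apply,
    zero_add, (fieldInChart_transition hq' X).self_of_nhds]

end Tangent

/-! ### The frame of lifts on the tangent bundle -/

section TangentFrame

variable {L W : Type*} [NormedAddCommGroup L] [NormedSpace ℝ L] [FiniteDimensional ℝ L]
  [NormedAddCommGroup W] [NormedSpace ℝ W] [FiniteDimensional ℝ W]

/-- The frame of complete and vertical lifts of the frame `ξ`. -/
def tangentFrame (ξ : W → L →L[ℝ] W) (z : W × W) : L × L →L[ℝ] W × W :=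
  ((ξ z.1).comp (ContinuousLinearMap.fst ℝ L L)).prod
    ((fderiv ℝ ξ z.1 z.2).comp (ContinuousLinearMap.fst ℝ L L) +
      (ξ z.1).comp (ContinuousLinearMap.snd ℝ L L))

theorem tangentFrame_apply (ξ : W → L →L[ℝ] W) (z : W × W) (a : L × L) :
    tangentFrame ξ z a = (ξ z.1 a.1, fderiv ℝ ξ z.1 z.2 a.1 + ξ z.1 a.2) := rfl

namespace IsInvariantFrame

variable {m : L →L[ℝ] L →L[ℝ] ℝ} {n : L →L[ℝ] L →L[ℝ] L} {U : Set W}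
  {ξ : W → L →L[ℝ] W} {h : W → W →L[ℝ] W →L[ℝ] ℝ} {x : W}

theorem differentiableAt_fderiv (hf : IsInvariantFrame m n U ξ h) (hx : x ∈ U) :
    DifferentiableAt ℝ (fderiv ℝ ξ) x :=
  ((hf.contDiffAt hx).fderiv_right (m := 1) (WithTop.coe_le_coe.2 (le_top : (2 : ℕ∞) ≤ ⊤))).differentiableAt
    (by simp)

theorem contDiffOn_tangentFrame (hf : IsInvariantFrame m n U ξ h) :
    ContDiffOn ℝ ∞ (tangentFrame ξ) (U ×ˢ univ) := by
  rw [contDiffOn_clm_apply]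
  intro a z hz
  refine ContDiffAt.contDiffWithinAt ?_
  have h1 : ContDiffAt ℝ ∞ (fun z : W × W => ξ z.1) z := (hf.contDiffAt hz.1).comp z contDiffAt_fst
  have h2 : ContDiffAt ℝ ∞ (fun z : W × W => fderiv ℝ ξ z.1) z :=
    ContDiffAt.comp (g := fderiv ℝ ξ) z ((hf.contDiffAt hz.1).fderiv_right (m := ∞) (by simp)) contDiffAt_fst
  exact (h1.clm_apply contDiffAt_const).prodMk
    (((h2.clm_apply contDiffAt_snd).clm_apply contDiffAt_const).add (h1.clm_apply contDiffAt_const))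

theorem fderiv_tangentFrame (hf : IsInvariantFrame m n U ξ h) (hx : x ∈ U) (y u v : W) (a : L × L) :
    fderiv ℝ (tangentFrame ξ) (x, y) (u, v) a =
      (fderiv ℝ ξ x u a.1, fderiv ℝ (fderiv ℝ ξ) x u y a.1 + fderiv ℝ ξ x v a.1 +
        fderiv ℝ ξ x u a.2) := by
  have hd : DifferentiableAt ℝ (tangentFrame ξ) (x, y) :=
    (hf.contDiffOn_tangentFrame.contDiffAt ((hf.isOpen.prod isOpen_univ).mem_nhds ⟨hx, mem_univ _⟩)).differentiableAt
      (by simp)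
  have h1 : HasFDerivAt (fun z : W × W => ξ z.1) ((fderiv ℝ ξ x).comp (ContinuousLinearMap.fst ℝ W W)) (x, y) :=
    HasFDerivAt.comp (G := L →L[ℝ] W) (g := ξ) (f := Prod.fst) (x, y) (hf.differentiableAt hx).hasFDerivAt hasFDerivAt_fst
  have hfst : HasFDerivAt (Prod.fst : W × W → W) (ContinuousLinearMap.fst ℝ W W) (x, y) :=
    hasFDerivAt_fst
  have hdd : HasFDerivAt (fderiv ℝ ξ) (fderiv ℝ (fderiv ℝ ξ) x) x :=
    (hf.differentiableAt_fderiv hx).hasFDerivAt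
  have h2 : HasFDerivAt (fun z : W × W => fderiv ℝ ξ z.1)
      ((fderiv ℝ (fderiv ℝ ξ) x).comp (ContinuousLinearMap.fst ℝ W W)) (x, y) :=
    HasFDerivAt.comp (G := W →L[ℝ] L →L[ℝ] W) (g := fderiv ℝ ξ) (f := Prod.fst) (x, y) hdd hfst
  have h3 : HasFDerivAt (fun z : W × W => z.2) (ContinuousLinearMap.snd ℝ W W) (x, y) := hasFDerivAt_snd
  have hc : ∀ c : L, HasFDerivAt (fun _ : W × W => c) (0 : W × W →L[ℝ] L) (x, y) := fun c => hasFDerivAt_const c _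
  have h4 := (h1.clm_apply (hc a.1)).prodMk
    (((h2.clm_apply h3).clm_apply (hc a.1)).add (h1.clm_apply (hc a.2)))
  have h5 : fderiv ℝ (tangentFrame ξ) (x, y) (u, v) a =
      fderiv ℝ (fun z => tangentFrame ξ z a) (x, y) (u, v) := by
    rw [fderiv_clm_apply hd (differentiableAt_const a)]
    simp
  rw [h5]
  refine (congrArg (fun T : W × W →L[ℝ] W × W => T (u, v)) h4.fderiv).trans ?_
  simp [add_comm]

/-- The frame is block triangular with ξ in both diagonal blocks. -/
theorem isInvertible_tangentFrame (hf : IsInvariantFrame m n U ξ h) {z : W × W} (hz : z.1 ∈ U) :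
    (tangentFrame ξ z).IsInvertible := by
  obtain ⟨e, he⟩ := hf.invertible _ hz
  have hinj : Function.Injective (tangentFrame ξ z).toLinearMap := by
    rw [injective_iff_map_eq_zero]
    intro a ha
    have h0 : tangentFrame ξ z a = 0 := ha
    rw [tangentFrame_apply, Prod.mk_eq_zero] at h0
    have h1 : a.1 = 0 := (hf.invertible _ hz).injective (h0.1.trans (map_zero _).symm)
    have h2 := h0.2
    rw [h1, map_zero, zero_add] at h2
    exact Prod.ext h1 ((hf.invertible _ hz).injective (h2.trans (map_zero _).symm))
  have hd : Module.finrank ℝ (L × L) = Module.finrank ℝ (W × W) := by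
    rw [Module.finrank_prod, Module.finrank_prod, e.toLinearEquiv.finrank_eq]
  exact ⟨(LinearEquiv.ofInjectiveOfFinrankEq _ hinj hd).toContinuousLinearEquiv, rfl⟩

/-- The complete and vertical lifts of an invariant frame are an invariant frame of the tangent
bundle. -/
theorem tangent {br ads : L →L[ℝ] L →L[ℝ] L} (hb : IsMetricBracket m br ads)
    (hf : IsInvariantFrame m (koszul br ads) U ξ h) {k : W × W → W × W →L[ℝ] W × W →L[ℝ] ℝ}
    (hk : ∀ z : W × W, z.1 ∈ U → ∀ a b,
      k z (tangentFrame ξ z a) (tangentFrame ξ z b) = liftForm m a b) :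
    IsInvariantFrame (liftForm m) (liftProduct br ads) (U ×ˢ univ) (tangentFrame ξ) k where
  isOpen := hf.isOpen.prod isOpen_univ
  smooth := hf.contDiffOn_tangentFrame
  invertible := fun z hz => hf.isInvertible_tangentFrame hz.1
  metric := fun z hz => hk z hz.1
  bracket := by
    rintro ⟨x, y⟩ ⟨hx, -⟩ a b
    replace hx : x ∈ U := hx
    have hbr : ∀ z ∈ U, ∀ a b, fderiv ℝ ξ z (ξ z a) b - fderiv ℝ ξ z (ξ z b) a = ξ z (br a b) :=
      fun z hz a b => by rw [hf.bracket z hz, hb.koszul_sub]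
    have hd := hf.differentiableAt hx
    have hdd := hf.differentiableAt_fderiv hx
    have hs := (hf.contDiffAt hx).isSymmSndFDerivAt (by
      rw [minSmoothness_of_isRCLikeNormedField]
      exact WithTop.coe_le_coe.2 (le_top : (2 : ℕ∞) ≤ ⊤))
    have hD : ∀ a b : L, fderiv ℝ (fun z => fderiv ℝ ξ z (ξ z a) b) x y =
        fderiv ℝ (fderiv ℝ ξ) x y (ξ x a) b + fderiv ℝ ξ x (fderiv ℝ ξ x y a) b := by
      intro a b
      have h1 : HasFDerivAt (fun z => ξ z a) ((fderiv ℝ ξ x).flip a) x := by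
        simpa using hd.hasFDerivAt.clm_apply (hasFDerivAt_const a x)
      have h2 := (hdd.hasFDerivAt.clm_apply h1).clm_apply (hasFDerivAt_const b x)
      refine (congrArg (fun T : W →L[ℝ] W => T y) h2.fderiv).trans ?_
      simp [add_comm]
    have hdiff : ∀ a b : L, DifferentiableAt ℝ (fun z => fderiv ℝ ξ z (ξ z a) b) x := fun a b =>
      (hdd.clm_apply (hd.clm_apply (differentiableAt_const a))).clm_apply (differentiableAt_const b)
    -- The second component of the bracket of two complete lifts is the derivative along y of the
    -- bracket relation of ξ.
    have h0 : (fun z => fderiv ℝ ξ z (ξ z a.1) b.1 - fderiv ℝ ξ z (ξ z b.1) a.1) =ᶠ[𝓝 x]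
        fun z => ξ z (br a.1 b.1) := by
      filter_upwards [hf.isOpen.mem_nhds hx] with z hz using hbr z hz _ _
    have h1 := congrArg (fun T : W →L[ℝ] W => T y) (h0.fderiv_eq (𝕜 := ℝ))
    rw [fderiv_fun_sub (hdiff _ _) (hdiff _ _), fderiv_clm_apply hd (differentiableAt_const _)] at h1
    simp only [sub_apply, hD, fderiv_fun_const, Pi.zero_apply, ContinuousLinearMap.comp_zero, zero_add,
      ContinuousLinearMap.flip_apply] at h1
    have h2 := hbr x hx a.1 b.2
    have h3 := hbr x hx a.2 b.1
    have h4 := hbr x hx a.1 b.1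
    simp only [hb.liftProduct_sub, tangentFrame_apply, hf.fderiv_tangentFrame hx]
    rw [Prod.mk_sub_mk]
    refine Prod.ext h4 ?_
    simp only [map_add, add_apply]
    rw [← h1, ← h2, ← h3, hs.eq (ξ x a.1) y, hs.eq (ξ x b.1) y]
    abel

end IsInvariantFrame

end TangentFrame

section Group

variable {E : Type*} [NormedAddCommGroup E] [NormedSpace ℝ E] [FiniteDimensional ℝ E]
  {G : Type*} [TopologicalSpace G] [ChartedSpace E G] [Group G] [LieGroup 𝓘(ℝ, E) ∞ G]
  {g : ContMDiffRiemannianMetric 𝓘(ℝ, E) ∞ E (fun x : G => TangentSpace 𝓘(ℝ, E) x)}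

theorem differentiableAt_groupFrame {p : G} {x : E} (hx : x ∈ (extChartAt 𝓘(ℝ, E) p).target) :
    DifferentiableAt ℝ (groupFrame p) x :=
  ((contDiffOn_groupFrame p).contDiffAt
    ((isOpen_extChartAt_target p).mem_nhds hx)).differentiableAt (by simp)

theorem fieldInChart_liftC {p : TangentBundle 𝓘(ℝ, E) G} {z : E × E}
    (hz : z ∈ (extChartAt 𝓘(ℝ, E).tangent p).target) (A : E) :
    fieldInChart 𝓘(ℝ, E).tangent p (liftC (E := E) (G := G) A) z = tangentFrame (groupFrame p.proj) z (A, 0) := by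
  refine (fieldInChart_completeLift (fun q x hx => ?_) hz).trans ?_
  · exact (differentiableAt_groupFrame hx).clm_apply (differentiableAt_const A)
  · rw [tangentFrame_apply, map_zero, add_zero]
    refine Prod.ext rfl ?_
    have h := fderiv_clm_apply (differentiableAt_groupFrame (mem_target_tangent.1 hz)) (differentiableAt_const A)
    refine (congrArg (fun T : E →L[ℝ] E => T z.2) h).trans ?_
    simp

theorem fieldInChart_liftV {p : TangentBundle 𝓘(ℝ, E) G} {z : E × E}
    (hz : z ∈ (extChartAt 𝓘(ℝ, E).tangent p).target) (A : E) :
    fieldInChart 𝓘(ℝ, E).tangent p (liftV (E := E) (G := G) A) z = tangentFrame (groupFrame p.proj) z (0, A) := by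
  refine (fieldInChart_verticalLift hz).trans ?_
  rw [tangentFrame_apply, map_zero, map_zero, zero_add]
  rfl

theorem coordFrame_tangentFrame {p : TangentBundle 𝓘(ℝ, E) G} {z : E × E}
    (hz : z ∈ (extChartAt 𝓘(ℝ, E).tangent p).target) (a : E × E) :
    coordFrame 𝓘(ℝ, E).tangent p z (tangentFrame (groupFrame p.proj) z a) =
      liftC (E := E) (G := G) a.1 ((extChartAt 𝓘(ℝ, E).tangent p).symm z) + liftV (E := E) (G := G) a.2 ((extChartAt 𝓘(ℝ, E).tangent p).symm z) := by
  have : IsManifold 𝓘(ℝ, E).tangent 1 (TangentBundle 𝓘(ℝ, E) G) := inferInstance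
  have h : a = (a.1, 0) + (0, a.2) := by simp
  have h1 := coordFrame_fieldInChart 𝓘(ℝ, E).tangent hz (liftC (E := E) (G := G) a.1)
  have h2 := coordFrame_fieldInChart 𝓘(ℝ, E).tangent hz (liftV (E := E) (G := G) a.2)
  rw [fieldInChart_liftC hz] at h1
  rw [fieldInChart_liftV hz] at h2
  rw [← h1, ← h2, ← map_add, ← map_add, ← h]

/-- Through this, g̃ on TG enters the same algebraic formalism as the metric on G. -/
theorem isInvariantFrame_tangent (hg : IsLeftInvariant g) (p : TangentBundle 𝓘(ℝ, E) G) :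
    IsInvariantFrame (liftForm (groupForm g)) (liftProduct (groupBracket G) (groupAdStar g))
      (extChartAt 𝓘(ℝ, E).tangent p).target (tangentFrame (groupFrame p.proj))
      (metricInChart 𝓘(ℝ, E).tangent (liftedMetric g) p) := by
  have hU : (extChartAt 𝓘(ℝ, E).tangent p).target =
      (extChartAt 𝓘(ℝ, E) p.proj).target ×ˢ univ := by
    ext z
    rw [mem_target_tangent, mem_prod]
    simp
  rw [hU]
  refine (isInvariantFrame_group hg p.proj).tangent (isMetricBracket g) fun z hz a b => ?_
  have hz' : z ∈ (extChartAt 𝓘(ℝ, E).tangent p).target := mem_target_tangent.2 hz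
  change liftedMetric g _ (coordFrame 𝓘(ℝ, E).tangent p z _) (coordFrame 𝓘(ℝ, E).tangent p z _) = _
  rw [coordFrame_tangentFrame hz', coordFrame_tangentFrame hz']
  exact liftedMetric_apply g _ _ _ _ _

end Group

/-! ### The case of a constant profile -/

theorem profileD_eq_zero {φ : ℝ → ℝ} {r s : ℝ} (hc : ∀ t, |t| ≤ r → φ t = φ 0) (hs : |s| < r) : profileD φ s = 0 := by
  have hev : ∀ t, |t| < r → φ =ᶠ[𝓝 t] fun _ => φ 0 := fun t ht => by
    filter_upwards [isOpen_Ioo.mem_nhds (abs_lt.1 ht)] with z hz using hc z (abs_lt.2 hz).le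
  have hd : deriv φ =ᶠ[𝓝 s] fun _ => 0 := by
    filter_upwards [isOpen_Ioo.mem_nhds (abs_lt.1 hs)] with z hz
    rw [(hev z (abs_lt.2 hz)).deriv_eq, deriv_const]
  rw [profileD, hd.deriv_eq, deriv_const, zero_div]

section Frame

variable {L W : Type*} [NormedAddCommGroup L] [NormedSpace ℝ L] [FiniteDimensional ℝ L]
  [NormedAddCommGroup W] [NormedSpace ℝ W] [FiniteDimensional ℝ W]
  {m : L →L[ℝ] L →L[ℝ] ℝ} {n : L →L[ℝ] L →L[ℝ] L} {U : Set W}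
  {ξ : W → L →L[ℝ] W} {h : W → W →L[ℝ] W →L[ℝ] ℝ} {F : W → W → ℝ} {φ : ℝ → ℝ} {b₀ : ℝ} {X : L} {x : W}

/-- The flag curvature when `φ` is constant, so that `F` is a multiple of the norm of `h`. -/
theorem IsInvariantFrame.flagCurvatureLocal_eq_of_const (hf : IsInvariantFrame m n U ξ h)
    (hm : IsMetricProduct m n) (hφ : IsAlphaBetaProfile φ b₀) (hX : √(m X X) < b₀)
    (hF : ∀ x ∈ U, ∀ y, F x y ^ 2 = sqNorm m X φ ((ξ x).inverse y))
    (hc : ∀ s, |s| ≤ √(m X X) → φ s = φ 0)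
    (hx : x ∈ U) {y u : L} (hy : m y y = 1) (hu : m u u = 1) (hyu : m y u = 0) :
    flagCurvatureLocal F x (ξ x y) (ξ x u) =
      1 / (φ (m X y) ^ 2 * (1 + m X u ^ 2 * profileD φ (m X y))) *
        m (productCurv n u y y) u := by
  have hi := hm.toIsInnerForm
  -- Since φ is constant on all slopes that occur, X may be replaced by 0, for which parallelism is
  -- trivial.
  have hF0 : ∀ x ∈ U, ∀ y, F x y ^ 2 = sqNorm m 0 φ ((ξ x).inverse y) := by
    intro x hx y
    rw [hF x hx y]
    generalize (ξ x).inverse y = a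
    rcases eq_or_ne a 0 with rfl | ha
    · simp [sqNorm]
    · rw [sqNorm, sqNorm, hc _ (hi.abs_slope_le ha), hc _ ((hi.abs_slope_le ha).trans (by simp))]
  have hy0 : y ≠ 0 := by
    rintro rfl
    simp at hy
  have h1 := hf.flagCurvatureLocal_eq hm hφ (X := 0)
    (by simpa using (Real.sqrt_nonneg (m X X)).trans_lt hX) hF0 (fun a => map_zero _) hx hy hu hyu
  have h2 : φ (m X y) = φ 0 := hc _ (by
    have h := hi.abs_slope_le (X := X) hy0
    rwa [slope, hy, Real.sqrt_one, div_one] at h)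
  -- If m X u ≠ 0, Bessel's inequality puts m X y strictly inside the interval on which φ is
  -- constant, so D vanishes there. At an endpoint φ is not controlled on both sides, but then m X u
  -- = 0.
  have h3 : m X u ^ 2 * profileD φ (m X y) = 0 := by
    rcases eq_or_ne (m X u) 0 with h | h
    · simp [h]
    · rw [profileD_eq_zero hc, mul_zero]
      have hb := hi.sq_mul_le X y u hyu
      rw [hy, hu, mul_one, mul_one, mul_one] at hb
      refine Real.lt_sqrt_of_sq_lt ?_
      rw [sq_abs]
      have := sq_pos_of_ne_zero h
      linarith
  rw [h1, h2, h3]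
  simp

end Frame

/-! ### Flag curvatures of the lifted metric -/

section Charts

variable {L : Type*} [NormedAddCommGroup L] [NormedSpace ℝ L] [FiniteDimensional ℝ L]
  {W : Type*} [NormedAddCommGroup W] [NormedSpace ℝ W] [FiniteDimensional ℝ W]
  {H : Type*} [TopologicalSpace H] {I : ModelWithCorners ℝ W H}
  {M : Type*} [TopologicalSpace M] [ChartedSpace H M] [IsManifold I 1 M]
  {m : L →L[ℝ] L →L[ℝ] ℝ} {n : L →L[ℝ] L →L[ℝ] L} {ξ : W → L →L[ℝ] W}
  {h : ∀ q : M, TangentSpace I q →L[ℝ] TangentSpace I q →L[ℝ] ℝ} {p : M}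

/-- An `(α,β)`-metric in an invariant frame. -/
theorem IsInvariantFrame.alphaBetaMetric_sq
    (hf : IsInvariantFrame m n (extChartAt I p).target ξ (metricInChart I h p))
    (hm : IsInnerForm m) {X : ∀ q : M, TangentSpace I q} {b : L}
    (hX : ∀ x ∈ (extChartAt I p).target, fieldInChart I p X x = ξ x b) (φ : ℝ → ℝ) {x : W}
    (hx : x ∈ (extChartAt I p).target) (y : W) :
    finslerInChart I (alphaBetaMetric I h X φ) p x y ^ 2 = sqNorm m b φ ((ξ x).inverse y) := by
  have h1 : h ((extChartAt I p).symm x) (coordFrame I p x y) (coordFrame I p x y) =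
      m ((ξ x).inverse y) ((ξ x).inverse y) := by
    rw [← hf.metric x hx, hf.apply_inverse hx]
    rfl
  have h2 : h ((extChartAt I p).symm x) (X ((extChartAt I p).symm x)) (coordFrame I p x y) =
      m b ((ξ x).inverse y) := by
    rw [← hf.metric x hx, hf.apply_inverse hx, ← hX x hx, ← coordFrame_fieldInChart I hx X]
    rfl
  rw [finslerInChart, alphaBetaMetric, h1, h2, mul_pow, Real.sq_sqrt (hm.nonneg _), sqNorm, slope]

end Charts

section Group

variable {E : Type*} [NormedAddCommGroup E] [NormedSpace ℝ E] [FiniteDimensional ℝ E]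
  {G : Type*} [TopologicalSpace G] [ChartedSpace E G] [Group G] [LieGroup 𝓘(ℝ, E) ∞ G]
  {g : ContMDiffRiemannianMetric 𝓘(ℝ, E) ∞ E (fun x : G => TangentSpace 𝓘(ℝ, E) x)}

theorem liftC_eq (p : TangentBundle 𝓘(ℝ, E) G) (A : E) :
    liftC (E := E) (G := G) A p =
      tangentFrame (groupFrame p.proj) (extChartAt 𝓘(ℝ, E).tangent p p) (A, 0) := by
  rw [← fieldInChart_liftC (mem_extChartAt_target p), fieldInChart_self]

theorem liftV_eq (p : TangentBundle 𝓘(ℝ, E) G) (A : E) :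
    liftV (E := E) (G := G) A p =
      tangentFrame (groupFrame p.proj) (extChartAt 𝓘(ℝ, E).tangent p p) (0, A) := by
  rw [← fieldInChart_liftV (mem_extChartAt_target p), fieldInChart_self]

/-- The flag curvature of the vertical lift of an `(α,β)`-metric, when the lift is of Berwald
type. -/
theorem flagCurvature_verticalLiftedMetric (hg : IsLeftInvariant g) {X : E} {φ : ℝ → ℝ} {b₀ : ℝ}
    (hφ : IsAlphaBetaProfile φ b₀) (hX : √(groupForm g X X) < b₀)
    (hB : IsBerwald 𝓘(ℝ, E).tangent (verticalLiftedMetric g X φ))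
    (hR : (∃ a c : ℝ, c ≠ 0 ∧ ∀ s : ℝ, |s| ≤ √(groupForm g X X) → φ s ^ 2 = a + c * s ^ 2) →
      IsParallel 𝓘(ℝ, E).tangent (liftedMetric g) (liftV (E := E) (G := G) X))
    (p : TangentBundle 𝓘(ℝ, E) G) {y u : E × E} (hy : liftForm (groupForm g) y y = 1)
    (hu : liftForm (groupForm g) u u = 1) (hyu : liftForm (groupForm g) y u = 0) :
    flagCurvature 𝓘(ℝ, E).tangent (verticalLiftedMetric g X φ) p
        (tangentFrame (groupFrame p.proj) (extChartAt 𝓘(ℝ, E).tangent p p) y)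
        (tangentFrame (groupFrame p.proj) (extChartAt 𝓘(ℝ, E).tangent p p) u) =
      1 / (φ (liftForm (groupForm g) (0, X) y) ^ 2 * (1 + liftForm (groupForm g) (0, X) u ^ 2 *
          profileD φ (liftForm (groupForm g) (0, X) y))) *
        liftForm (groupForm g)
          (productCurv (liftProduct (groupBracket G) (groupAdStar g)) u y y) u := by
  have hf := isInvariantFrame_tangent hg p
  have hm := (isMetricBracket g).isMetricProduct_lift
  have hx : extChartAt 𝓘(ℝ, E).tangent p p ∈ (extChartAt 𝓘(ℝ, E).tangent p).target :=
    mem_extChartAt_target p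
  have hXX : liftForm (groupForm g) (0, X) (0, X) = groupForm g X X := by
    rw [liftForm_apply, map_zero, zero_add]
  rw [← hXX] at hX hR
  have hF : ∀ x ∈ (extChartAt 𝓘(ℝ, E).tangent p).target, ∀ y,
      finslerInChart 𝓘(ℝ, E).tangent (verticalLiftedMetric g X φ) p x y ^ 2 =
        sqNorm (liftForm (groupForm g)) (0, X) φ
          ((tangentFrame (groupFrame p.proj) x).inverse y) := fun x hx y =>
    hf.alphaBetaMetric_sq hm.toIsInnerForm (fun z hz => fieldInChart_liftV hz X) φ hx y
  refine (congrArg₂ (flagCurvatureLocal _ _) (components_apply _ p _) (components_apply _ p _)).trans ?_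
  -- Either X^v is parallel or φ is constant on the range of slopes: if φ² = a + c s² there, c = 0
  -- gives constancy by positivity of φ and c ≠ 0 is covered by `hR`; otherwise the Berwald
  -- condition applies.
  have key : (∀ a, liftProduct (groupBracket G) (groupAdStar g) a (0, X) = 0) ∨
      ∀ s, |s| ≤ √(liftForm (groupForm g) (0, X) (0, X)) → φ s = φ 0 := by
    by_cases hne : ∃ a c : ℝ, ∀ s, |s| ≤ √(liftForm (groupForm g) (0, X) (0, X)) →
        φ s ^ 2 = a + c * s ^ 2
    · obtain ⟨a, c, hac⟩ := hne
      rcases eq_or_ne c 0 with rfl | hc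
      · refine Or.inr fun s hs => ?_
        have h0 : |(0 : ℝ)| ≤ √(liftForm (groupForm g) (0, X) (0, X)) := by simp
        have h1 : φ s ^ 2 = φ 0 ^ 2 := by rw [hac s hs, hac 0 h0, zero_mul, zero_mul]
        exact (pow_left_inj₀ (hφ.pos s (abs_lt.1 (hs.trans_lt hX))).le
          (hφ.pos 0 (abs_lt.1 (h0.trans_lt hX))).le two_ne_zero).1 h1
      · refine Or.inl fun b => ?_
        have h1 := hf.covDeriv_eq hm hx (fun z hz => fieldInChart_liftV hz X) b
        exact (hf.invertible _ hx).injective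
          ((h1.symm.trans (hR ⟨a, c, hc, hac⟩ p _)).trans (map_zero _).symm)
    · obtain ⟨Γ, hΓ⟩ := hB p
      exact Or.inl (hf.parallel_of_berwald hm hφ hX hF hne hx (Γ _) fun y hy => hΓ _ hx y hy)
  rcases key with hp | hc
  · exact hf.flagCurvatureLocal_eq hm hφ hX hF hp hx hy hu hyu
  · exact hf.flagCurvatureLocal_eq_of_const hm hφ hX hF hc hx hy hu hyu

/-- The flag curvatures of the flags spanned by complete and vertical lifts. -/
theorem flagCurvature_lifts (hg : IsLeftInvariant g) {X : E} {φ : ℝ → ℝ} {b₀ : ℝ}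
    (hφ : IsAlphaBetaProfile φ b₀) (hX : √(groupForm g X X) < b₀)
    (hB : IsBerwald 𝓘(ℝ, E).tangent (verticalLiftedMetric g X φ))
    (hR : (∃ a c : ℝ, c ≠ 0 ∧ ∀ s : ℝ, |s| ≤ √(groupForm g X X) → φ s ^ 2 = a + c * s ^ 2) →
      IsParallel 𝓘(ℝ, E).tangent (liftedMetric g) (liftV (E := E) (G := G) X))
    {Y V : E} (hY : groupForm g Y Y = 1) (hV : groupForm g V V = 1) (hYV : groupForm g Y V = 0)
    (p : TangentBundle 𝓘(ℝ, E) G) :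
    flagCurvature 𝓘(ℝ, E).tangent (verticalLiftedMetric g X φ) p
          (liftC (E := E) (G := G) Y p) (liftC (E := E) (G := G) V p) =
        1 / φ 0 ^ 2 * sectionalCurvature 𝓘(ℝ, E) g.inner 1 V Y ∧
    flagCurvature 𝓘(ℝ, E).tangent (verticalLiftedMetric g X φ) p
          (liftC (E := E) (G := G) Y p) (liftV (E := E) (G := G) V p) =
        1 / (φ 0 ^ 2 * (1 + groupForm g X V ^ 2 * profileD φ 0)) *
          (sectionalCurvature 𝓘(ℝ, E) g.inner 1 V Y
            + 1 / 2 * groupForm g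
              (groupBracket G V (koszul (groupBracket G) (groupAdStar g) Y V)) Y
            - 1 / 2 * groupForm g
              (koszul (groupBracket G) (groupAdStar g) V (groupAdStar g V Y)) Y
            + 1 / 4 * groupForm g (groupBracket G V (groupAdStar g V Y)) Y
            + 1 / 2 * groupForm g (groupBracket G (groupBracket G Y V) V) Y) ∧
    flagCurvature 𝓘(ℝ, E).tangent (verticalLiftedMetric g X φ) p
          (liftV (E := E) (G := G) Y p) (liftC (E := E) (G := G) V p) =
        1 / φ (groupForm g X Y) ^ 2 *
          (sectionalCurvature 𝓘(ℝ, E) g.inner 1 V Y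
            + 1 / 2 * groupForm g
              (groupBracket G Y (koszul (groupBracket G) (groupAdStar g) V Y)) V
            - 1 / 2 * groupForm g
              (koszul (groupBracket G) (groupAdStar g) Y (groupAdStar g Y V)) V
            + 1 / 4 * groupForm g (groupBracket G Y (groupAdStar g Y V)) V
            + 1 / 2 * groupForm g (groupBracket G (groupBracket G V Y) Y) V) ∧
    flagCurvature 𝓘(ℝ, E).tangent (verticalLiftedMetric g X φ) p
          (liftV (E := E) (G := G) Y p) (liftV (E := E) (G := G) V p) =
        1 / (φ (groupForm g X Y) ^ 2 *
            (1 + groupForm g X V ^ 2 * profileD φ (groupForm g X Y))) *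
          (sectionalCurvature 𝓘(ℝ, E) g.inner 1 V Y
            + groupForm g
              (koszul (groupBracket G) (groupAdStar g) (groupBracket G V Y) Y) V
            + 1 / 4 * groupForm g (groupBracket G V Y) (groupBracket G V Y)) := by
  have hb := isMetricBracket g
  have hc := fun {y u : E × E} => flagCurvature_verticalLiftedMetric hg hφ hX hB hR p (y := y) (u := u)
  have hK := sectionalCurvature_eq hg hY hV hYV
  have e1 : ∀ A B : E, liftForm (groupForm g) (A, 0) (B, 0) = groupForm g A B := fun A B => by
    rw [liftForm_apply, map_zero, add_zero]
  have e2 : ∀ A B : E, liftForm (groupForm g) (0, A) (0, B) = groupForm g A B := fun A B => by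
    rw [liftForm_apply, map_zero, zero_add]
  have e3 : ∀ A B : E, liftForm (groupForm g) (A, 0) (0, B) = 0 := fun A B => by
    rw [liftForm_apply, map_zero, map_zero, zero_add]
    rfl
  have e4 : ∀ A B : E, liftForm (groupForm g) (0, A) (B, 0) = 0 := fun A B => by
    rw [liftForm_apply, map_zero, map_zero, add_zero]
    rfl
  -- X^v is orthogonal to complete lifts: a flagpole Y^c has slope 0, and a transverse edge V^c
  -- makes the D term disappear.
  refine ⟨?_, ?_, ?_, ?_⟩
  · have h := hc (y := (Y, 0)) (u := (V, 0)) ((e1 _ _).trans hY) ((e1 _ _).trans hV)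
      ((e1 _ _).trans hYV)
    rw [IsMetricBracket.curv_lift_cc, e4, e4, ← hK, sq (0 : ℝ), zero_mul, zero_mul, add_zero, mul_one] at h
    exact (congrArg₂ (flagCurvature _ _ p) (liftC_eq p Y) (liftC_eq p V)).trans h
  · have h := hc (y := (Y, 0)) (u := (0, V)) ((e1 _ _).trans hY) ((e2 _ _).trans hV) (e3 _ _)
    rw [hb.curv_lift_vc, e4, e2, ← hK] at h
    exact (congrArg₂ (flagCurvature _ _ p) (liftC_eq p Y) (liftV_eq p V)).trans h
  · have h := hc (y := (0, Y)) (u := (V, 0)) ((e2 _ _).trans hY) ((e1 _ _).trans hV) (e4 _ _)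
    rw [hb.curv_lift_cv, e2, e4, ← hK, sq (0 : ℝ), zero_mul, zero_mul, add_zero, mul_one] at h
    exact (congrArg₂ (flagCurvature _ _ p) (liftV_eq p Y) (liftC_eq p V)).trans h
  · have h := hc (y := (0, Y)) (u := (0, V)) ((e2 _ _).trans hY) ((e2 _ _).trans hV)
      ((e2 _ _).trans hYV)
    rw [hb.curv_lift_vv, e2, e2, ← hK] at h
    exact (congrArg₂ (flagCurvature _ _ p) (liftV_eq p Y) (liftV_eq p V)).trans h

end Group

end LieFinsler

end

theorem mainTheorem6
    {E : Type*} [NormedAddCommGroup E] [NormedSpace ℝ E] [FiniteDimensional ℝ E]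
    {G : Type*} [TopologicalSpace G] [ChartedSpace E G] [Group G] [LieGroup 𝓘(ℝ, E) ∞ G]
    (g : ContMDiffRiemannianMetric 𝓘(ℝ, E) ∞ E (fun x : G => TangentSpace 𝓘(ℝ, E) x))
    (hg : IsLeftInvariant g)
    (X : GroupLieAlgebra 𝓘(ℝ, E) G) (φ : ℝ → ℝ) (b₀ : ℝ) (hφ : IsAlphaBetaProfile φ b₀)
    (hX : √(lieInner g X X) < b₀)
    (hB : IsBerwald 𝓘(ℝ, E).tangent (verticalLiftedMetric g X φ))
    (hR : (∃ a c : ℝ, c ≠ 0 ∧ ∀ s : ℝ, |s| ≤ √(lieInner g X X) → φ s ^ 2 = a + c * s ^ 2) →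
      IsParallel 𝓘(ℝ, E).tangent (liftedMetric g) (liftV X))
    (Y V : GroupLieAlgebra 𝓘(ℝ, E) G)
    (hY : lieInner g Y Y = 1) (hV : lieInner g V V = 1) (hYV : lieInner g Y V = 0)
    (p : TangentBundle 𝓘(ℝ, E) G) :
    flagCurvature 𝓘(ℝ, E).tangent (verticalLiftedMetric g X φ) p (liftC Y p) (liftC V p) =
        1 / φ 0 ^ 2 * sectionalCurvature 𝓘(ℝ, E) g.inner 1 V Y ∧
    flagCurvature 𝓘(ℝ, E).tangent (verticalLiftedMetric g X φ) p (liftC Y p) (liftV V p) =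
        1 / (φ 0 ^ 2 * (1 + lieInner g X V ^ 2 * profileD φ 0)) *
          (sectionalCurvature 𝓘(ℝ, E) g.inner 1 V Y
            + 1 / 2 * lieInner g ⁅V, nabla g Y V⁆ Y
            - 1 / 2 * lieInner g (nabla g V (adStar g V Y)) Y
            + 1 / 4 * lieInner g ⁅V, adStar g V Y⁆ Y
            + 1 / 2 * lieInner g ⁅⁅Y, V⁆, V⁆ Y) ∧
    flagCurvature 𝓘(ℝ, E).tangent (verticalLiftedMetric g X φ) p (liftV Y p) (liftC V p) =
        1 / φ (lieInner g X Y) ^ 2 *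
          (sectionalCurvature 𝓘(ℝ, E) g.inner 1 V Y
            + 1 / 2 * lieInner g ⁅Y, nabla g V Y⁆ V
            - 1 / 2 * lieInner g (nabla g Y (adStar g Y V)) V
            + 1 / 4 * lieInner g ⁅Y, adStar g Y V⁆ V
            + 1 / 2 * lieInner g ⁅⁅V, Y⁆, Y⁆ V) ∧
    flagCurvature 𝓘(ℝ, E).tangent (verticalLiftedMetric g X φ) p (liftV Y p) (liftV V p) =
        1 / (φ (lieInner g X Y) ^ 2 *
            (1 + lieInner g X V ^ 2 * profileD φ (lieInner g X Y))) *
          (sectionalCurvature 𝓘(ℝ, E) g.inner 1 V Y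
            + lieInner g (nabla g ⁅V, Y⁆ Y) V
            + 1 / 4 * lieInner g ⁅V, Y⁆ ⁅V, Y⁆) := by
  -- After `nabla` is rewritten as the Koszul product, the bracket, ad* and inner product agree
  -- definitionally with their versions on the model space.
  rw [nabla_eq hg Y V, nabla_eq hg V (adStar g V Y), nabla_eq hg V Y, nabla_eq hg Y (adStar g Y V),
    nabla_eq hg ⁅V, Y⁆ Y]
  exact flagCurvature_lifts hg hφ hX hB hR hY hV hYV p
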